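/- **Setting.** Let $M>0$ and $|a|\le M$, and put $r_\pm=M\pm\sqrt{M^2-a^2}$, $\Delta=(r-r_+)(r-r_-)$, $\Sigma=r^2+a^2\cos^2\theta$. The Kerr exterior is $\mathbb R_t\times[r_+,\infty)_r\times\mathbb S^2$ (boundary $\mathcal H^+=\{r=r_+\}$ included) with the metric, in Kerr coordinates $(t,r,\theta,\phi)$, $$g=-\Big(1-\tfrac{2Mr}{\Sigma}\Big)dt^2+2\,dt\,dr+\Sigma\,d\theta^2+\tfrac{(r^2+a^2)^2-\Delta a^2\sin^2\theta}{\Sigma}\sin^2\theta\,d\phi^2-2a\sin^2\theta\,dr\,d\phi-\tfrac{4aMr}{\Sigma}\sin^2\theta\,dt\,d\phi .$$ Let $e_3=-\partial_r$, $e_4=\tfrac{2(r^2+a^2)}{\Sigma}\partial_t+\tfrac{\Delta}{\Sigma}\partial_r+\tfrac{2a}{\Sigma}\partial_\phi$ (so $g(e_3,e_4)=-2$), and let $(e_1,e_2)$ be the orthonormal frame of the horizontal distribution $\langle e_3,e_4\rangle^\perp$ given by $$e_1=\tfrac{a^2\sin\theta\cos\theta}{\Sigma}\partial_t+\tfrac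 r\Sigma\partial_\theta+\tfrac{a\cos\theta}{\Sigma\sin\theta}\partial_\phi,\qquad e_2=\tfrac{ar\sin\theta}{\Sigma}\partial_t-\tfrac{a\cos\theta}{\Sigma}\partial_\theta+\tfrac{r}{\Sigma\sin\theta}\partial_\phi ,$$ with $\varepsilon_{12}=1$. Horizontal one-forms are one-forms annihilating $e_3,e_4$; $\slashed\nabla$ is the connection induced on them by the Levi-Civita connection $\nabla$ (by projection), $\slashed{\mathrm{div}}\,\varsigma=\sum_A(\slashed\nabla_A\varsigma)_A$, $\slashed{\mathrm{curl}}\,\varsigma=(\slashed\nabla_1\varsigma)_2-(\slashed\nabla_2\varsigma)_1$, ${}^\star\varsigma=(\varsigma_2,-\varsigma_1)$, and norms are taken with respect to $g$. Let $\chi_{AB}=g(\nabla_Ae_4,e_B)$, $\underline\chi_{AB}=g(\nabla_Ae_3,e_B)$, $\nabla_4e_4=\hat\omega e_4$, and $$\mathfrak T(\alpha)_A=\tfrac12\Sigma\big((\slashed\nabla_3\alpha)_A+\underline\chi_{AB}\alpha_B\big),\qquad \underline{\mathfrak T}(\underline\alpha)_A=\tfrac12\Sigma\big((\slashed\nabla_4\underline\alpha)_A+\chi_{AB}\underline\alpha_B+\hat\omega\,\underline\alpha_A\big).$$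 *Time function.* Let $\iota,\zeta:\mathbb R\to[0,1]$ be smooth with $\iota=1$ for $r\le\frac{17M}8$, $\iota=0$ for $r\ge\frac{9M}4$, $\zeta=0$ for $r\le3M$, $\zeta=1$ for $r\ge4M$, and such that $w:=\frac{r^2+a^2}\Delta-\iota\big(\frac{r^2+a^2}\Delta-1\big)$ satisfies $w>0$ and $2-(1-\frac{2Mr}\Sigma)w>0$ for $r>r_+$. Put $\tilde t^*=t-\int_{9M/4}^r\big[(1-\iota)\frac{s^2+a^2}{\Delta(s)}+\iota\big]ds-\zeta(r)\big(r+2M\log r-\frac{3M^2}r\big)$, $\Sigma_0=\{\tilde t^*=0\}$, $\mathbb S^2_{\tau,r_+}=\{\tilde t^*=\tau,\ r=r_+\}$, $d\Omega=\sin\theta\,d\theta\,d\phi$. $L^2(\mathbb S^2_{0,r_+})$ is taken with respect to the induced area form rescaled to total mass $4\pi$. *Modified solutions.* Let $c=\frac14\Sigma[(\mathrm{tr}\underline\chi)^2-(\varepsilon\cdot\underline\chi)^2]$ and $d=\frac12\Sigma(\varepsilon\cdot\underline\chi)(\mathrm{tr}\underline\chi)$, with $\varepsilon\cdot\underline\chi=\underline\chi_{12}-\underline\chi_{21}$.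 A *modified solution* is a quadruple $\mathfrak S=(\alpha,\underline\alpha,\hat\rho,\hat\sigma)$ of horizontal one-forms $\alpha,\underline\alpha$ and functions $\hat\rho,\hat\sigma$, smooth on $\{\tilde t^*\ge0\}$ up to and including $\mathcal H^+$ and $\Sigma_0$, that satisfies there $$\begin{aligned} e_3\hat\sigma&=\Sigma d\,\slashed{\mathrm{div}}\,\underline\alpha-\Sigma c\,\slashed{\mathrm{curl}}\,\underline\alpha, & e_3\hat\rho&=-\Sigma c\,\slashed{\mathrm{div}}\,\underline\alpha-\Sigma d\,\slashed{\mathrm{curl}}\,\underline\alpha,\\ e_4\hat\sigma&=-d\,\slashed{\mathrm{div}}(\Sigma\alpha)-c\,\slashed{\mathrm{curl}}(\Sigma\alpha), & e_4\hat\rho&=c\,\slashed{\mathrm{div}}(\Sigma\alpha)-d\,\slashed{\mathrm{curl}}(\Sigma\alpha),\\ \slashed\nabla\hat\sigma&=-d\,(\mathfrak T(\alpha)-\underline{\mathfrak T}(\underline\alpha))-c\,({}^\star\mathfrak T(\alpha)+{}^\star\underline{\mathfrak T}(\underline\alpha)), & \slashed\nabla\hat\rho&=c\,(\mathfrak T(\alpha)-\underline{\mathfrak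 T}(\underline\alpha))-d\,({}^\star\mathfrak T(\alpha)+{}^\star\underline{\mathfrak T}(\underline\alpha)). \end{aligned}$$ Its seed data are $\alpha|_{\Sigma_0},\underline\alpha|_{\Sigma_0},\hat\rho|_{\mathbb S^2_{0,r_+}},\hat\sigma|_{\mathbb S^2_{0,r_+}}$. For $\mathfrak q_1,\mathfrak q_2\in\mathbb R$, $\mathfrak S_{\mathfrak q_1,\mathfrak q_2}=(0,0,\mathfrak q_1,\mathfrak q_2)$ is the modified stationary solution. Finally $$\mathbb E_{\mathcal H^+}[r^2\alpha](\tau_1,\tau_2)=\int_{\tau_1}^{\tau_2}\int_{\mathbb S^2_{s,r_+}}\big(|r^2\alpha|^2+|\slashed\nabla(r^2\alpha)|^2+|\slashed\nabla_4(r^2\alpha)|^2\big)\,d\Omega\,ds .$$ **Lemma.** Let $M>0$ and $p_\alpha>0$. (0) For all $|a|\le M$, the constant $I_{a,M}:=\int_{\mathbb S^2}\frac{1-(a/r_+)^2\cos^2\theta}{1+(a/r_+)^2\cos^2\theta}\,d\Omega$ is nonzero; it equals $4\pi\Big(\frac{2\arctan(a/r_+)}{a/r_+}-1\Big)$ if $a\ne0$,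 and $4\pi$ if $a=0$. There is a constant $C=C(M,p_\alpha)>0$ such that, for every $|a|\le M$ and all $\iota,\zeta$ as above, there are real-valued functions $\mathfrak q_1,\mathfrak q_2$ of the seed data, depending only on the restriction of $(\alpha,\hat\rho,\hat\sigma)$ to $\mathbb S^2_{0,r_+}$, with the following property. Let $\mathbb D\ge0$ be any functional of the seed data, and let $\mathfrak S$ be a modified solution such that $$\lim_{\tau\to\infty}\int_{\mathbb S^2_{\tau,r_+}}\big(|\mathfrak T(\alpha)|^2+|\underline{\mathfrak T}(\underline\alpha)|^2\big)d\Omega=0,\qquad \mathbb E_{\mathcal H^+}[r^2\alpha](\tau,\infty)\le\frac{\mathbb D}{(1+\tau)^{1+p_\alpha}}\quad\text{for all }\tau\ge0 ,$$ where $\mathbb D$ is evaluated on the seed data of $\mathfrak S$. Then: (1) for all $\tau\ge0$, $$\Big|\int_{\mathbb S^2_{\tau,r_+}}\hat\rho\,d\Omega\Big|^2+\Big|\int_{\mathbb S^2_{\tau,r_+}}\hat\sigma\,d\Omega\Big|^2\le C\Big(\|\hat\rho\|^2_{L^2(\mathbb S^2_{0,r_+})}+\|\hat\sigma\|^2_{L^2(\mathbb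 S^2_{0,r_+})}+\mathbb D\Big);$$ (2) with $\mathfrak q_1,\mathfrak q_2$ evaluated on the seed data of $\mathfrak S$, the normalised solution $\widetilde{\mathfrak S}=\mathfrak S-\mathfrak S_{\mathfrak q_1,\mathfrak q_2}$ satisfies, for all $\tau\ge0$, $$\Big|\int_{\mathbb S^2_{\tau,r_+}}\hat\rho[\widetilde{\mathfrak S}]\,d\Omega\Big|^2+\Big|\int_{\mathbb S^2_{\tau,r_+}}\hat\sigma[\widetilde{\mathfrak S}]\,d\Omega\Big|^2\le C\,\frac{\mathbb D}{(1+\tau)^{p_\alpha}} .$$ -/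

import Mathlib

open scoped ContDiff NNReal ENNReal Topology

namespace KerrMaxwell

noncomputable section

/-! ## The Kerr exterior in Kerr coordinates

Vectors of `R4` serve in two ways: as Kerr coordinates `q = (t, r, θ, φ)` (ingoing coordinates, regular
at the horizon), and as points `p = (t, x, y, z)` of the global chart of the exterior in which
`(x, y, z) = r (sin θ cos φ, sin θ sin φ, cos θ)`. The global chart identifies the manifold with boundary
`ℝ × [r₊, ∞) × S²` with `{p | r₊ ≤ |(x, y, z)|}`; it has no singularity on the axis. -/

abbrev R4 : Type := Fin 4 → ℝ

/-- A field of spacetime covectors. -/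
abbrev OneForm : Type := R4 → R4 →L[ℝ] ℝ

def rPlus (a M : ℝ) : ℝ := M + Real.sqrt (M ^ 2 - a ^ 2)

def rMinus (a M : ℝ) : ℝ := M - Real.sqrt (M ^ 2 - a ^ 2)

/-- `Δ(r) = (r - r₊)(r - r₋)`. -/
def Del (a M r : ℝ) : ℝ := (r - rPlus a M) * (r - rMinus a M)

/-- `Σ(r, θ) = r² + a² cos² θ`, as a function of the Kerr coordinates. -/
def Sig (a : ℝ) (q : R4) : ℝ := q 1 ^ 2 + a ^ 2 * Real.cos (q 2) ^ 2

/-- The components of the Kerr metric in the Kerr coordinates `(t, r, θ, φ)`. -/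
def kerrMetric (a M : ℝ) (q : R4) : Matrix (Fin 4) (Fin 4) ℝ :=
  !![-(1 - 2 * M * q 1 / Sig a q), 1, 0, -(2 * a * M * q 1 / Sig a q) * Real.sin (q 2) ^ 2;
     1, 0, 0, -a * Real.sin (q 2) ^ 2;
     0, 0, Sig a q, 0;
     -(2 * a * M * q 1 / Sig a q) * Real.sin (q 2) ^ 2, -a * Real.sin (q 2) ^ 2, 0,
       ((q 1 ^ 2 + a ^ 2) ^ 2 - Del a M (q 1) * a ^ 2 * Real.sin (q 2) ^ 2) / Sig a q
         * Real.sin (q 2) ^ 2]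

/-- `g(u, v)` at the point with Kerr coordinates `q`. -/
def kerrInner (a M : ℝ) (q u v : R4) : ℝ := dotProduct u ((kerrMetric a M q).mulVec v)

/-- The coordinate map from Kerr coordinates to the global chart. -/
def chart (q : R4) : R4 :=
  ![q 0, q 1 * Real.sin (q 2) * Real.cos (q 3), q 1 * Real.sin (q 2) * Real.sin (q 3),
    q 1 * Real.cos (q 2)]

/-- The function `r` in the global chart. -/
def radius (p : R4) : ℝ := Real.sqrt (p 1 ^ 2 + p 2 ^ 2 + p 3 ^ 2)

/-- A covector field of the global chart, expressed in Kerr coordinates. -/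
def pullback (ς : OneForm) : OneForm := fun q => (ς (chart q)).comp (fderiv ℝ chart q)

/-! ## The algebraically special frame

`e₃ = -∂_r`, `e₄ = 2 (r² + a²) / Σ ∂_t + Δ / Σ ∂_r + 2 a / Σ ∂_φ` in Kerr coordinates; in Boyer–Lindquist
coordinates these are `(r² + a²) / Δ ∂_t - ∂_r + a / Δ ∂_φ` and
`(r² + a²) / Σ ∂_t + Δ / Σ ∂_r + a / Σ ∂_φ`. The pair `(e₁, e₂)` is an orthonormal basis, off the axis,
of the orthogonal complement of `e₃` and `e₄` (the horizontal distribution). -/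

def e3 (_q : R4) : R4 := ![0, -1, 0, 0]

def e4 (a M : ℝ) (q : R4) : R4 :=
  ![2 * (q 1 ^ 2 + a ^ 2) / Sig a q, Del a M (q 1) / Sig a q, 0, 2 * a / Sig a q]

def frame (a : ℝ) (A : Fin 2) (q : R4) : R4 :=
  if A = 0 then
    ![a ^ 2 * Real.sin (q 2) * Real.cos (q 2) / Sig a q, 0, q 1 / Sig a q,
      a * Real.cos (q 2) / (Sig a q * Real.sin (q 2))]
  else
    ![a * q 1 * Real.sin (q 2) / Sig a q, 0, -(a * Real.cos (q 2)) / Sig a q,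
      q 1 / (Sig a q * Real.sin (q 2))]

/-- `g(∇_X Y, Z)` at `q` for the Levi-Civita connection of the Kerr metric, with `X`, `Z` vectors and `Y`
a vector field: the derivative of the components of `Y` plus the Christoffel symbols of the first kind. -/
def leviCivita (a M : ℝ) (q X : R4) (Y : R4 → R4) (Z : R4) : ℝ :=
  kerrInner a M q (fderiv ℝ Y q X) Z
    + (1 / 2) * (fderiv ℝ (fun q' => kerrInner a M q' (Y q) Z) q X
        + fderiv ℝ (fun q' => kerrInner a M q' X Z) q (Y q)
        - fderiv ℝ (fun q' => kerrInner a M q' X (Y q)) q Z)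

/-- `χ_{AB} = g(∇_A e₄, e_B)`. -/
def chi (a M : ℝ) (q : R4) (A B : Fin 2) : ℝ :=
  leviCivita a M q (frame a A q) (e4 a M) (frame a B q)

/-- `χ̲_{AB} = g(∇_A e₃, e_B)`. -/
def chiBar (a M : ℝ) (q : R4) (A B : Fin 2) : ℝ :=
  leviCivita a M q (frame a A q) e3 (frame a B q)

/-- `ω̂`, defined by `∇₄ e₄ = ω̂ e₄`; recall that `g(e₃, e₄) = -2`. -/
def omegaHat (a M : ℝ) (q : R4) : ℝ :=
  -(1 / 2) * leviCivita a M q (e4 a M q) (e4 a M) (e3 q)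

/-- `tr χ̲`. -/
def trChiBar (a M : ℝ) (q : R4) : ℝ := chiBar a M q 0 0 + chiBar a M q 1 1

/-- `ε · χ̲ = ε^{AB} χ̲_{AB}`, with `ε(e₁, e₂) = 1`. -/
def epsChiBar (a M : ℝ) (q : R4) : ℝ := chiBar a M q 0 1 - chiBar a M q 1 0

/-! ## Horizontal one-forms

A horizontal one-form is represented by its canonical extension, a spacetime one-form that annihilates
`e₃` and `e₄`. The horizontal connection is the projection of the Levi-Civita connection. Below, `ς` is
given in Kerr coordinates. -/

/-- The component `ς_A = ς(e_A)`. -/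
def comp (a : ℝ) (ς : OneForm) (A : Fin 2) (q : R4) : ℝ := ς q (frame a A q)

/-- `(∇̸_X ς)(e_B) = X(ς(e_B)) - ∑_C g(∇_X e_B, e_C) ς(e_C)`. -/
def nablaH (a M : ℝ) (ς : OneForm) (q X : R4) (B : Fin 2) : ℝ :=
  fderiv ℝ (comp a ς B) q X
    - ∑ C : Fin 2, leviCivita a M q X (frame a B) (frame a C q) * comp a ς C q

def divH (a M : ℝ) (ς : OneForm) (q : R4) : ℝ := ∑ A : Fin 2, nablaH a M ς q (frame a A q) A

/-- `ε^{AB} (∇̸_A ς)_B`. -/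
def curlH (a M : ℝ) (ς : OneForm) (q : R4) : ℝ :=
  nablaH a M ς q (frame a 0 q) 1 - nablaH a M ς q (frame a 1 q) 0

/-- The horizontal Hodge dual `(⋆v)_A = ε_A^B v_B`, on components. -/
def hodge (v : Fin 2 → ℝ) : Fin 2 → ℝ := ![v 1, -v 0]

/-- The pointwise squared norms of `ς`, `∇̸ς` and `∇̸₄ς`. -/
def normSq (a : ℝ) (ς : OneForm) (q : R4) : ℝ := ∑ A : Fin 2, comp a ς A q ^ 2

def nablaNormSq (a M : ℝ) (ς : OneForm) (q : R4) : ℝ :=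
  ∑ A : Fin 2, ∑ B : Fin 2, nablaH a M ς q (frame a A q) B ^ 2

def nabla4NormSq (a M : ℝ) (ς : OneForm) (q : R4) : ℝ :=
  ∑ B : Fin 2, nablaH a M ς q (e4 a M q) B ^ 2

/-- The components of `𝔗(α) = ½ Σ (∇̸₃ α + χ̲^♯₂ · α)`. -/
def fT (a M : ℝ) (α : OneForm) (q : R4) (A : Fin 2) : ℝ :=
  (1 / 2) * Sig a q * (nablaH a M α q (e3 q) A + ∑ B : Fin 2, chiBar a M q A B * comp a α B q)

/-- The components of `𝔗̲(α̲) = ½ Σ (∇̸₄ α̲ + χ^♯₂ · α̲ + ω̂ α̲)`. -/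
def fTBar (a M : ℝ) (αb : OneForm) (q : R4) (A : Fin 2) : ℝ :=
  (1 / 2) * Sig a q * (nablaH a M αb q (e4 a M q) A + ∑ B : Fin 2, chi a M q A B * comp a αb B q
    + omegaHat a M q * comp a αb A q)

/-! ## Hyperboloidal time, the horizon spheres and the initial hypersurface -/

/-- The cut-off `ι` used to define the Kerr-star time. -/
structure IsStarCutoff (a M : ℝ) (ι : ℝ → ℝ) : Prop where
  smooth : ContDiff ℝ ∞ ι
  mem_Icc : ∀ r, ι r ∈ Set.Icc (0 : ℝ) 1
  eq_one : ∀ r, r ≤ 17 * M / 8 → ι r = 1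
  eq_zero : ∀ r, 9 * M / 4 ≤ r → ι r = 0
  pos : ∀ r, rPlus a M < r →
    0 < (r ^ 2 + a ^ 2) / Del a M r - ι r * ((r ^ 2 + a ^ 2) / Del a M r - 1)
  spacelike : ∀ r θ, rPlus a M < r →
    0 < 2 - (1 - 2 * M * r / (r ^ 2 + a ^ 2 * Real.cos θ ^ 2))
      * ((r ^ 2 + a ^ 2) / Del a M r - ι r * ((r ^ 2 + a ^ 2) / Del a M r - 1))

/-- The cut-off `ζ` used to define the hyperboloidal time. -/
structure IsHyperboloidalCutoff (M : ℝ) (ζ : ℝ → ℝ) : Prop where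
  smooth : ContDiff ℝ ∞ ζ
  mem_Icc : ∀ r, ζ r ∈ Set.Icc (0 : ℝ) 1
  eq_zero : ∀ r, r ≤ 3 * M → ζ r = 0
  eq_one : ∀ r, 4 * M ≤ r → ζ r = 1

/-- The height function `h` with `t̃* = t - h(r)`. The integral gives the Kerr-star time, the other term
makes the level sets of `t̃*` hyperboloidal. -/
def height (a M : ℝ) (ι ζ : ℝ → ℝ) (r : ℝ) : ℝ :=
  (∫ s in (9 * M / 4)..r, ((1 - ι s) * ((s ^ 2 + a ^ 2) / Del a M s) + ι s))
    + ζ r * (r + 2 * M * Real.log r - 3 * M ^ 2 / r)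

/-- The future `{t̃* ≥ 0}` in the exterior (horizon included) of the initial hypersurface, in the global
chart. -/
def futureRegion (a M : ℝ) (ι ζ : ℝ → ℝ) : Set R4 :=
  {p | rPlus a M ≤ radius p ∧ 0 ≤ p 0 - height a M ι ζ (radius p)}

/-- The initial hypersurface `Σ₀ = {t̃* = 0}`, in the global chart. -/
def initialSurface (a M : ℝ) (ι ζ : ℝ → ℝ) : Set R4 :=
  {p | rPlus a M ≤ radius p ∧ p 0 - height a M ι ζ (radius p) = 0}

/-- The initial horizon sphere `Σ₀ ∩ {r = r₊}`, in the global chart. -/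
def initialSphere (a M : ℝ) (ι ζ : ℝ → ℝ) : Set R4 :=
  {p | radius p = rPlus a M ∧ p 0 - height a M ι ζ (radius p) = 0}

/-- The Kerr coordinates of the points of the horizon sphere `{t̃* = τ, r = r₊}`. -/
def horizonPoint (a M : ℝ) (ι ζ : ℝ → ℝ) (τ θ φ : ℝ) : R4 :=
  ![τ + height a M ι ζ (rPlus a M), rPlus a M, θ, φ]

/-- `∫ f dΩ`, with `dΩ = sin θ dθ dφ`. -/
def sphereIntegral (f : ℝ → ℝ → ℝ) : ℝ :=
  ∫ φ in (0 : ℝ)..2 * Real.pi, ∫ θ in (0 : ℝ)..Real.pi, f θ φ * Real.sin θ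

/-- The area density `√(det)` of the metric induced by the Kerr metric on the spheres of constant
`t̃*` and `r`, in the coordinates `(θ, φ)`. -/
def areaDensity (a M : ℝ) (q : R4) : ℝ :=
  Real.sqrt (kerrMetric a M q 2 2 * kerrMetric a M q 3 3 - kerrMetric a M q 2 3 ^ 2)

/-- The squared `L²` norm on the horizon sphere at time `τ` of a function of the Kerr coordinates, for
the induced area form rescaled to total mass `4π`. -/
def horizonL2Sq (a M : ℝ) (ι ζ : ℝ → ℝ) (f : R4 → ℝ) (τ : ℝ) : ℝ :=
  4 * Real.pi
    / (∫ φ in (0 : ℝ)..2 * Real.pi, ∫ θ in (0 : ℝ)..Real.pi,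
        areaDensity a M (horizonPoint a M ι ζ τ θ φ))
    * ∫ φ in (0 : ℝ)..2 * Real.pi, ∫ θ in (0 : ℝ)..Real.pi,
        f (horizonPoint a M ι ζ τ θ φ) ^ 2 * areaDensity a M (horizonPoint a M ι ζ τ θ φ)

/-- The horizon energy flux
`∫_{τ₁}^{τ₂} ∫_{S²} (|ς|² + |∇̸ς|² + |∇̸₄ς|²) dΩ dt̃*`, for `ς` given in Kerr coordinates. -/
def horizonFlux (a M : ℝ) (ι ζ : ℝ → ℝ) (ς : OneForm) (τ₁ : ℝ) (τ₂ : EReal) : ℝ≥0∞ :=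
  ∫⁻ s in {s : ℝ | τ₁ < s ∧ (s : EReal) < τ₂}, ENNReal.ofReal (sphereIntegral fun θ φ =>
    normSq a ς (horizonPoint a M ι ζ s θ φ)
      + nablaNormSq a M ς (horizonPoint a M ι ζ s θ φ)
      + nabla4NormSq a M ς (horizonPoint a M ι ζ s θ φ))

/-! ## The modified Maxwell equations -/

/-- A quadruple `(α, α̲, ρ̂, σ̂)` of fields in the global chart. -/
@[ext]
structure Fields where
  al : OneForm
  alb : OneForm
  rho : R4 → ℝ
  sigma : R4 → ℝ

instance : Sub Fields :=
  ⟨fun S S' => ⟨S.al - S'.al, S.alb - S'.alb, S.rho - S'.rho, S.sigma - S'.sigma⟩⟩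

/-- The modified stationary solution with charges `q₁`, `q₂`. -/
def stationary (q₁ q₂ : ℝ) : Fields := ⟨0, 0, fun _ => q₁, fun _ => q₂⟩

/-- `¼ Σ ((tr χ̲)² - (ε · χ̲)²)`. -/
def coefC (a M : ℝ) (q : R4) : ℝ :=
  (1 / 4) * Sig a q * (trChiBar a M q ^ 2 - epsChiBar a M q ^ 2)

/-- `½ Σ (ε · χ̲) (tr χ̲)`. -/
def coefD (a M : ℝ) (q : R4) : ℝ := (1 / 2) * Sig a q * (epsChiBar a M q * trChiBar a M q)

/-- The modified Maxwell equations at the point with Kerr coordinates `q` (off the axis), for one-forms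
`α`, `α̲` and functions `ρ̂`, `σ̂` given in Kerr coordinates. -/
structure ModifiedMaxwellAt (a M : ℝ) (α αb : OneForm) (ρ σ : R4 → ℝ) (q : R4) : Prop where
  e3_sigma : fderiv ℝ σ q (e3 q)
    = Sig a q * coefD a M q * divH a M αb q - Sig a q * coefC a M q * curlH a M αb q
  e3_rho : fderiv ℝ ρ q (e3 q)
    = -(Sig a q * coefC a M q * divH a M αb q) - Sig a q * coefD a M q * curlH a M αb q
  e4_sigma : fderiv ℝ σ q (e4 a M q)
    = -(coefD a M q * divH a M (fun q' => Sig a q' • α q') q)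
      - coefC a M q * curlH a M (fun q' => Sig a q' • α q') q
  e4_rho : fderiv ℝ ρ q (e4 a M q)
    = coefC a M q * divH a M (fun q' => Sig a q' • α q') q
      - coefD a M q * curlH a M (fun q' => Sig a q' • α q') q
  eA_sigma : ∀ A : Fin 2, fderiv ℝ σ q (frame a A q)
    = -(coefD a M q * (fT a M α q A - fTBar a M αb q A))
      - coefC a M q * (hodge (fT a M α q) A + hodge (fTBar a M αb q) A)
  eA_rho : ∀ A : Fin 2, fderiv ℝ ρ q (frame a A q)
    = coefC a M q * (fT a M α q A - fTBar a M αb q A)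
      - coefD a M q * (hodge (fT a M α q) A + hodge (fTBar a M αb q) A)

/-- Smooth solutions of the modified Maxwell equations on the future of the initial hypersurface.
Smoothness on this closed region means smoothness on an open neighbourhood of it (in the global chart).
The horizontality conditions and the equations are imposed off the axis; they extend to the axis in the
frame-independent sense by continuity. -/
structure IsModifiedSolution (a M : ℝ) (ι ζ : ℝ → ℝ) (S : Fields) : Prop where
  smooth : ∃ U : Set R4, IsOpen U ∧ futureRegion a M ι ζ ⊆ U ∧ ContDiffOn ℝ ∞ S.al U ∧
    ContDiffOn ℝ ∞ S.alb U ∧ ContDiffOn ℝ ∞ S.rho U ∧ ContDiffOn ℝ ∞ S.sigma U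
  horizontal : ∀ q : R4, rPlus a M ≤ q 1 → 0 ≤ q 0 - height a M ι ζ (q 1) →
    q 2 ∈ Set.Ioo 0 Real.pi →
      pullback S.al q (e3 q) = 0 ∧ pullback S.al q (e4 a M q) = 0 ∧
      pullback S.alb q (e3 q) = 0 ∧ pullback S.alb q (e4 a M q) = 0
  maxwell : ∀ q : R4, rPlus a M ≤ q 1 → 0 ≤ q 0 - height a M ι ζ (q 1) →
    q 2 ∈ Set.Ioo 0 Real.pi →
      ModifiedMaxwellAt a M (pullback S.al) (pullback S.alb) (S.rho ∘ chart) (S.sigma ∘ chart) q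

/-! ## Seed initial data -/

/-- The part of the seed data that lives on the initial horizon sphere: `α`, `ρ̂` and `σ̂`. -/
structure HorizonSeed (a M : ℝ) (ι ζ : ℝ → ℝ) where
  al : initialSphere a M ι ζ → R4 →L[ℝ] ℝ
  rho : initialSphere a M ι ζ → ℝ
  sigma : initialSphere a M ι ζ → ℝ

/-- Seed data: `α`, `α̲` along `Σ₀` and `ρ̂`, `σ̂` on the initial horizon sphere. -/
structure SeedData (a M : ℝ) (ι ζ : ℝ → ℝ) where
  al : initialSurface a M ι ζ → R4 →L[ℝ] ℝ
  alb : initialSurface a M ι ζ → R4 →L[ℝ] ℝ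
  rho : initialSphere a M ι ζ → ℝ
  sigma : initialSphere a M ι ζ → ℝ

/-- The seed data of a quadruple of fields. -/
def Fields.seed (S : Fields) (a M : ℝ) (ι ζ : ℝ → ℝ) : SeedData a M ι ζ where
  al p := S.al p
  alb p := S.alb p
  rho p := S.rho p
  sigma p := S.sigma p

/-- The restriction of seed data to the initial horizon sphere. -/
def SeedData.onHorizon {a M : ℝ} {ι ζ : ℝ → ℝ} (D : SeedData a M ι ζ) : HorizonSeed a M ι ζ where
  al p := D.al ⟨p.1, p.2.1.ge, p.2.2⟩
  rho := D.rho
  sigma := D.sigma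

/-! ## The quantities in the statement -/

/-- `∫ ρ̂ dΩ` over the horizon sphere at time `τ`. -/
def rhoMode (a M : ℝ) (ι ζ : ℝ → ℝ) (S : Fields) (τ : ℝ) : ℝ :=
  sphereIntegral fun θ φ => S.rho (chart (horizonPoint a M ι ζ τ θ φ))

/-- `∫ σ̂ dΩ` over the horizon sphere at time `τ`. -/
def sigmaMode (a M : ℝ) (ι ζ : ℝ → ℝ) (S : Fields) (τ : ℝ) : ℝ :=
  sphereIntegral fun θ φ => S.sigma (chart (horizonPoint a M ι ζ τ θ φ))

/-- `∫ (|𝔗(α)|² + |𝔗̲(α̲)|²) dΩ` over the horizon sphere at time `τ`. -/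
def transversalL2Sq (a M : ℝ) (ι ζ : ℝ → ℝ) (S : Fields) (τ : ℝ) : ℝ :=
  sphereIntegral fun θ φ =>
    (∑ A : Fin 2, fT a M (pullback S.al) (horizonPoint a M ι ζ τ θ φ) A ^ 2)
      + ∑ A : Fin 2, fTBar a M (pullback S.alb) (horizonPoint a M ι ζ τ θ φ) A ^ 2

/-- The horizon energy flux of `r² α` between the times `τ₁` and `τ₂`. -/
def alphaFlux (a M : ℝ) (ι ζ : ℝ → ℝ) (S : Fields) (τ₁ : ℝ) (τ₂ : EReal) : ℝ≥0∞ :=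
  horizonFlux a M ι ζ (fun q => q 1 ^ 2 • pullback S.al q) τ₁ τ₂

/-- `I_{a,M}`, the integral of `(1 - γ² cos² θ) / (1 + γ² cos² θ)` over the sphere, `γ = a / r₊`. -/
def chargeConstant (a M : ℝ) : ℝ :=
  sphereIntegral fun θ _ =>
    (1 - (a / rPlus a M) ^ 2 * Real.cos θ ^ 2) / (1 + (a / rPlus a M) ^ 2 * Real.cos θ ^ 2)

end

end KerrMaxwell

/-!
On the horizon `Σ e₄ = 2 (r₊² + a²) ∂_τ + 2 a ∂_φ` is tangent to `ℋ⁺`, and the `φ`-derivative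
integrates to zero over the spheres. By the equations for `e₄ ρ̂` and `e₄ σ̂` the modes `∫ ρ̂ dΩ`
and `∫ σ̂ dΩ` therefore change along `ℋ⁺` at a rate whose square is bounded by the flux density of
`α`. Cauchy–Schwarz on dyadic intervals makes them Cauchy, with rate `(1 + τ) ^ (-p / 2)`.

The limit is visible on `Σ₀` because of a conservation law. Solved for `div (Σα)` and `curl (Σα)`,
the equations say that `(2 c e₄ρ̂ - 2 d e₄σ̂) / Σ`, up to a factor, is a divergence along the
horizon, so the integral of `(r₊² + a²) (2 c ρ̂ - 2 d σ̂) / Σ - a sin θ v` with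
`v = α(a sin θ ∂_t + (sin θ)⁻¹ ∂_φ)` does not depend on `τ`. Integrating by parts in `θ`, half of
this charge differs from `∫ ρ̂ dΩ` by terms in `∂_θ ρ̂`, `∂_θ σ̂` and `v`. The first two are
controlled by `𝔗(α)` and `𝔗̲(α̲)`, the last by the flux density of `α`, and all of them tend to
zero along a sequence of times; hence `∫ ρ̂ dΩ` converges to half the charge. The duality
`(ρ̂, σ̂) ↦ (σ̂, -ρ̂)`, `(u, v) ↦ (-v, u)` with `u = α(∂_θ)` gives the same for `σ̂`.
-/

namespace KerrMaxwell

open MeasureTheory Set Filter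
open scoped Real

/-! ## Integrals over the sphere -/

section SphereIntegral

variable {f g : ℝ → ℝ → ℝ}

theorem sphereIntegral_congr (h : ∀ θ ∈ Ioo 0 π, ∀ φ, f θ φ = g θ φ) :
    sphereIntegral f = sphereIntegral g := by
  refine intervalIntegral.integral_congr fun φ _ => intervalIntegral.integral_congr fun θ hθ => ?_
  rw [uIcc_of_le Real.pi_pos.le] at hθ
  rcases hθ.1.eq_or_lt with rfl | h0
  · simp
  rcases hθ.2.eq_or_lt with rfl | h1
  · simp
  simp only [h θ ⟨h0, h1⟩ φ]

theorem continuous_mul_sin_swap (hf : Continuous fun x : ℝ × ℝ => f x.1 x.2) :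
    Continuous fun x : ℝ × ℝ => f x.2 x.1 * Real.sin x.2 :=
  (hf.comp continuous_swap).mul (Real.continuous_sin.comp continuous_snd)

theorem intervalIntegrable_mul_sin (hf : Continuous fun x : ℝ × ℝ => f x.1 x.2) (φ : ℝ) :
    IntervalIntegrable (fun θ => f θ φ * Real.sin θ) volume 0 π :=
  ((continuous_mul_sin_swap hf).comp
    (continuous_const.prodMk continuous_id)).intervalIntegrable _ _

theorem intervalIntegrable_integral_mul_sin (hf : Continuous fun x : ℝ × ℝ => f x.1 x.2) :
    IntervalIntegrable (fun φ => ∫ θ in (0 : ℝ)..π, f θ φ * Real.sin θ) volume 0 (2 * π) :=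
  (intervalIntegral.continuous_parametric_intervalIntegral_of_continuous'
    (f := fun φ θ => f θ φ * Real.sin θ) (continuous_mul_sin_swap hf) _ _).intervalIntegrable _ _

theorem sphereIntegral_add (hf : Continuous fun x : ℝ × ℝ => f x.1 x.2)
    (hg : Continuous fun x : ℝ × ℝ => g x.1 x.2) :
    sphereIntegral (fun θ φ => f θ φ + g θ φ) = sphereIntegral f + sphereIntegral g := by
  unfold sphereIntegral
  rw [← intervalIntegral.integral_add (intervalIntegrable_integral_mul_sin hf)
    (intervalIntegrable_integral_mul_sin hg)]
  refine intervalIntegral.integral_congr fun φ _ => ?_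
  simp only [add_mul]
  exact intervalIntegral.integral_add (intervalIntegrable_mul_sin hf φ)
    (intervalIntegrable_mul_sin hg φ)

theorem sphereIntegral_const_mul (k : ℝ) (f : ℝ → ℝ → ℝ) :
    sphereIntegral (fun θ φ => k * f θ φ) = k * sphereIntegral f := by
  unfold sphereIntegral
  simp only [mul_assoc, intervalIntegral.integral_const_mul]

theorem sphereIntegral_sub (hf : Continuous fun x : ℝ × ℝ => f x.1 x.2)
    (hg : Continuous fun x : ℝ × ℝ => g x.1 x.2) :
    sphereIntegral (fun θ φ => f θ φ - g θ φ) = sphereIntegral f - sphereIntegral g := by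
  have hneg := sphereIntegral_const_mul (-1) g
  simp only [neg_one_mul] at hneg
  simp only [sub_eq_add_neg]
  rw [sphereIntegral_add hf hg.neg, hneg]

theorem sphereIntegral_const (k : ℝ) : sphereIntegral (fun _ _ => k) = 4 * π * k := by
  simp only [sphereIntegral, intervalIntegral.integral_const_mul, integral_sin,
    intervalIntegral.integral_const, Real.cos_zero, Real.cos_pi, smul_eq_mul]
  ring

theorem sphereIntegral_mono (hf : Continuous fun x : ℝ × ℝ => f x.1 x.2)
    (hg : Continuous fun x : ℝ × ℝ => g x.1 x.2)
    (h : ∀ θ ∈ Ioo 0 π, ∀ φ, f θ φ ≤ g θ φ) : sphereIntegral f ≤ sphereIntegral g := by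
  refine intervalIntegral.integral_mono_on (by positivity) (intervalIntegrable_integral_mul_sin hf)
    (intervalIntegrable_integral_mul_sin hg) fun φ _ => ?_
  refine intervalIntegral.integral_mono_on_of_le_Ioo Real.pi_pos.le
    (intervalIntegrable_mul_sin hf φ) (intervalIntegrable_mul_sin hg φ) fun θ hθ => ?_
  exact mul_le_mul_of_nonneg_right (h θ hθ φ) (Real.sin_nonneg_of_mem_Icc (Ioo_subset_Icc_self hθ))

theorem sphereIntegral_nonneg (h : ∀ θ φ, 0 ≤ f θ φ) : 0 ≤ sphereIntegral f :=
  intervalIntegral.integral_nonneg (by positivity) fun φ _ =>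
    intervalIntegral.integral_nonneg Real.pi_pos.le fun θ hθ =>
      mul_nonneg (h θ φ) (Real.sin_nonneg_of_mem_Icc hθ)

theorem sq_sphereIntegral_le (hf : Continuous fun x : ℝ × ℝ => f x.1 x.2) :
    sphereIntegral f ^ 2 ≤ 4 * π * sphereIntegral fun θ φ => f θ φ ^ 2 := by
  set m := sphereIntegral f / (4 * π) with hm
  have hvar : 0 ≤ sphereIntegral fun θ φ => (f θ φ - m) ^ 2 :=
    sphereIntegral_nonneg fun θ φ => sq_nonneg _
  have hexp : (fun θ φ => (f θ φ - m) ^ 2)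
      = fun θ φ => (f θ φ ^ 2 - 2 * m * f θ φ) + m ^ 2 := by ext θ φ; ring
  rw [hexp, sphereIntegral_add (by fun_prop) (by fun_prop), sphereIntegral_const,
    sphereIntegral_sub (by fun_prop) (by fun_prop), sphereIntegral_const_mul] at hvar
  have hf_eq : sphereIntegral f = m * (4 * π) := by rw [hm]; field_simp
  rw [hf_eq] at hvar ⊢
  nlinarith [Real.pi_pos]

end SphereIntegral

theorem integral_integral_swap_of_continuous {f : ℝ → ℝ → ℝ}
    (hf : Continuous fun x : ℝ × ℝ => f x.1 x.2) (a b c d : ℝ) :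
    ∫ x in a..b, ∫ y in c..d, f x y = ∫ y in c..d, ∫ x in a..b, f x y :=
  intervalIntegral_intervalIntegral_swap
    ((hf.continuousOn.integrableOn_compact (isCompact_uIcc.prod isCompact_uIcc)).mono_set
      (prod_mono uIoc_subset_uIcc uIoc_subset_uIcc))

theorem sphereIntegral_eq_zero_of_divergence {f Y Y' Z Z' : ℝ → ℝ → ℝ}
    (hY : ∀ θ φ, HasDerivAt (fun t => Y t φ) (Y' θ φ) θ)
    (hZ : ∀ θ φ, HasDerivAt (fun t => Z θ t) (Z' θ φ) φ)
    (hY' : Continuous fun x : ℝ × ℝ => Y' x.1 x.2) (hZ' : Continuous fun x : ℝ × ℝ => Z' x.1 x.2)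
    (hYπ : ∀ φ, Y π φ = Y 0 φ) (hZπ : ∀ θ, Z θ (2 * π) = Z θ 0)
    (h : ∀ θ ∈ Ioo 0 π, ∀ φ, f θ φ * Real.sin θ = Y' θ φ + Z' θ φ) :
    sphereIntegral f = 0 := by
  have hYi : ∀ φ, IntervalIntegrable (fun θ => Y' θ φ) volume 0 π := fun φ =>
    Continuous.intervalIntegrable (by fun_prop) _ _
  have hZθ : ∀ φ, IntervalIntegrable (fun θ => Z' θ φ) volume 0 π := fun φ =>
    Continuous.intervalIntegrable (by fun_prop) _ _
  have hZφ : ∀ θ, IntervalIntegrable (fun φ => Z' θ φ) volume 0 (2 * π) := fun θ =>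
    Continuous.intervalIntegrable (by fun_prop) _ _
  have intY : ∀ φ, ∫ θ in (0 : ℝ)..π, Y' θ φ = 0 := fun φ => by
    rw [intervalIntegral.integral_eq_sub_of_hasDerivAt (fun θ _ => hY θ φ) (hYi φ), hYπ, sub_self]
  have intZ : ∀ θ, ∫ φ in (0 : ℝ)..2 * π, Z' θ φ = 0 := fun θ => by
    rw [intervalIntegral.integral_eq_sub_of_hasDerivAt (fun φ _ => hZ θ φ) (hZφ θ), hZπ, sub_self]
  calc sphereIntegral f = ∫ φ in (0 : ℝ)..2 * π, ∫ θ in (0 : ℝ)..π, (Y' θ φ + Z' θ φ) := by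
        refine intervalIntegral.integral_congr fun φ _ => ?_
        simp only [intervalIntegral.integral_of_le Real.pi_pos.le, integral_Ioc_eq_integral_Ioo]
        exact setIntegral_congr_fun measurableSet_Ioo fun θ hθ => h θ hθ φ
    _ = ∫ φ in (0 : ℝ)..2 * π, ∫ θ in (0 : ℝ)..π, Z' θ φ := by
        simp only [intervalIntegral.integral_add (hYi _) (hZθ _), intY, zero_add]
    _ = ∫ θ in (0 : ℝ)..π, ∫ φ in (0 : ℝ)..2 * π, Z' θ φ :=
        integral_integral_swap_of_continuous (f := fun φ θ => Z' θ φ)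
          (hZ'.comp continuous_swap) _ _ _ _
    _ = 0 := by simp only [intZ, intervalIntegral.integral_zero]

theorem continuous_sphereIntegral {f : ℝ × ℝ × ℝ → ℝ} (hf : Continuous f) :
    Continuous fun s => sphereIntegral fun θ φ => f (s, θ, φ) := by
  refine intervalIntegral.continuous_parametric_intervalIntegral_of_continuous'
    (f := fun s φ => ∫ θ in (0 : ℝ)..π, f (s, θ, φ) * Real.sin θ) ?_ _ _
  exact intervalIntegral.continuous_parametric_intervalIntegral_of_continuous'
    (f := fun (x : ℝ × ℝ) θ => f (x.1, θ, x.2) * Real.sin θ)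
    (by dsimp only [Function.uncurry_def]; fun_prop) _ _

theorem intervalIntegral_sphereIntegral_swap {f : ℝ × ℝ × ℝ → ℝ} (hf : Continuous f) (τ T : ℝ) :
    ∫ s in τ..T, (sphereIntegral fun θ φ => f (s, θ, φ))
      = sphereIntegral fun θ φ => ∫ s in τ..T, f (s, θ, φ) := by
  unfold sphereIntegral
  rw [integral_integral_swap_of_continuous]
  · refine intervalIntegral.integral_congr fun φ _ => ?_
    simp only
    rw [integral_integral_swap_of_continuous (by fun_prop)]
    simp only [intervalIntegral.integral_mul_const]
  · exact intervalIntegral.continuous_parametric_intervalIntegral_of_continuous'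
      (f := fun (x : ℝ × ℝ) θ => f (x.1, θ, x.2) * Real.sin θ)
      (by dsimp only [Function.uncurry_def]; fun_prop) _ _

theorem continuous_slice {f : ℝ × ℝ × ℝ → ℝ} (hf : ContinuousOn f {x | 0 ≤ x.1}) {τ : ℝ}
    (hτ : 0 ≤ τ) : Continuous fun x : ℝ × ℝ => f (τ, x.1, x.2) :=
  hf.comp_continuous (f := fun x : ℝ × ℝ => (τ, x)) (by fun_prop) fun _ => hτ

theorem continuous_clamp {f : ℝ × ℝ × ℝ → ℝ} (hf : ContinuousOn f {x | 0 ≤ x.1}) :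
    Continuous fun x : ℝ × ℝ × ℝ => f (max x.1 0, x.2) :=
  hf.comp_continuous (by fun_prop) fun x => le_max_right x.1 0

theorem continuousOn_sphereIntegral {f : ℝ × ℝ × ℝ → ℝ} (hf : ContinuousOn f {x | 0 ≤ x.1}) :
    ContinuousOn (fun s => sphereIntegral fun θ φ => f (s, θ, φ)) (Ici 0) :=
  (continuous_sphereIntegral (continuous_clamp hf)).continuousOn.congr fun s hs => by
    simp only [max_eq_left (mem_Ici.1 hs)]

theorem sphereIntegral_sub_eq_intervalIntegral {f f' : ℝ × ℝ × ℝ → ℝ}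
    (hf : ContinuousOn f {x | 0 ≤ x.1}) (hf' : ContinuousOn f' {x | 0 ≤ x.1})
    (hderiv : ∀ t, 0 ≤ t → ∀ θ φ, HasDerivAt (fun s => f (s, θ, φ)) (f' (t, θ, φ)) t)
    {τ T : ℝ} (hτ : 0 ≤ τ) (hT : 0 ≤ T) :
    (sphereIntegral fun θ φ => f (T, θ, φ)) - (sphereIntegral fun θ φ => f (τ, θ, φ))
      = ∫ s in τ..T, sphereIntegral fun θ φ => f' (s, θ, φ) := by
  have hpos : ∀ s ∈ uIcc τ T, max s 0 = s := fun s hs => max_eq_left ((le_min hτ hT).trans hs.1)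
  have hclamp : ∫ s in τ..T, (sphereIntegral fun θ φ => f' (s, θ, φ))
      = ∫ s in τ..T, sphereIntegral fun θ φ => f' (max s 0, θ, φ) :=
    intervalIntegral.integral_congr fun s hs => by simp only [hpos s hs]
  rw [hclamp, intervalIntegral_sphereIntegral_swap (continuous_clamp hf'),
    ← sphereIntegral_sub (continuous_slice hf hT) (continuous_slice hf hτ)]
  refine sphereIntegral_congr fun θ _ φ => ?_
  refine (intervalIntegral.integral_eq_sub_of_hasDerivAt (f := fun s => f (s, θ, φ))
    (fun s hs => ?_) ?_).symm
  · rw [hpos s hs]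
    exact hderiv s (max_eq_left_iff.1 (hpos s hs)) θ φ
  · exact ((continuous_clamp hf').comp
      (by fun_prop : Continuous fun s : ℝ => (s, θ, φ))).intervalIntegrable _ _

/-! ## Decay of a function from decay of the energy flux of its derivative -/

theorem sq_intervalIntegral_le {u : ℝ → ℝ} {τ T : ℝ} (h : τ ≤ T) (hu : ContinuousOn u (Icc τ T)) :
    (∫ s in τ..T, u s) ^ 2 ≤ (T - τ) * ∫ s in τ..T, u s ^ 2 := by
  rcases h.eq_or_lt with rfl | h
  · simp
  have hpos : 0 < T - τ := sub_pos.2 h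
  rw [← uIcc_of_le h.le] at hu
  set m := (∫ s in τ..T, u s) / (T - τ) with hm
  have hvar : 0 ≤ ∫ s in τ..T, (u s ^ 2 - 2 * m * u s + m ^ 2) :=
    intervalIntegral.integral_nonneg h.le fun s _ => by nlinarith [sq_nonneg (u s - m)]
  rw [intervalIntegral.integral_add (ContinuousOn.intervalIntegrable (by fun_prop))
      (ContinuousOn.intervalIntegrable (by fun_prop)),
    intervalIntegral.integral_sub (ContinuousOn.intervalIntegrable (by fun_prop))
      (ContinuousOn.intervalIntegrable (by fun_prop)),
    intervalIntegral.integral_const_mul, intervalIntegral.integral_const, smul_eq_mul] at hvar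
  have hu_eq : ∫ s in τ..T, u s = m * (T - τ) := by rw [hm]; field_simp
  rw [hu_eq] at hvar ⊢
  nlinarith

theorem intervalIntegral_sq_le_of_flux_le {F u : ℝ → ℝ} {K B τ T : ℝ} (hK : 0 ≤ K) (hB : 0 ≤ B)
    (hT : τ ≤ T) (hu : ContinuousOn u (Icc τ T)) (huF : ∀ s, τ ≤ s → u s ^ 2 ≤ K * F s)
    (hF : ∫⁻ s in Ioi τ, ENNReal.ofReal (F s) ≤ ENNReal.ofReal B) :
    ∫ s in τ..T, u s ^ 2 ≤ K * B := by
  have hint : IntegrableOn (fun s => u s ^ 2) (Ioc τ T) :=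
    (hu.pow 2).integrableOn_Icc.mono_set Ioc_subset_Icc_self
  refine (ENNReal.ofReal_le_ofReal_iff (by positivity)).1 ?_
  rw [intervalIntegral.integral_of_le hT, ofReal_integral_eq_lintegral_ofReal hint
    (ae_of_all _ fun s => sq_nonneg _), ENNReal.ofReal_mul hK]
  calc ∫⁻ s in Ioc τ T, ENNReal.ofReal (u s ^ 2)
      ≤ ∫⁻ s in Ioc τ T, ENNReal.ofReal K * ENNReal.ofReal (F s) := by
        refine setLIntegral_mono' measurableSet_Ioc fun s hs => ?_
        rw [← ENNReal.ofReal_mul hK]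
        exact ENNReal.ofReal_le_ofReal (huF s hs.1.le)
    _ ≤ ∫⁻ s in Ioi τ, ENNReal.ofReal K * ENNReal.ofReal (F s) :=
        lintegral_mono_set Ioc_subset_Ioi_self
    _ = ENNReal.ofReal K * ∫⁻ s in Ioi τ, ENNReal.ofReal (F s) :=
        lintegral_const_mul' _ _ ENNReal.ofReal_ne_top
    _ ≤ ENNReal.ofReal K * ENNReal.ofReal B := mul_le_mul_right hF _

theorem exists_lt_of_lintegral_ne_top {F : ℝ → ℝ} {N ε : ℝ} (hε : 0 < ε)
    (hF : ∫⁻ s in Ioi N, ENNReal.ofReal (F s) ≠ ⊤) : ∃ s, N < s ∧ F s < ε := by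
  by_contra! hcon
  refine hF (top_le_iff.1 ?_)
  calc (⊤ : ℝ≥0∞) = ∫⁻ _ in Ioi N, ENNReal.ofReal ε := by
        rw [setLIntegral_const, Real.volume_Ioi,
          ENNReal.mul_top (ENNReal.ofReal_pos.2 hε).ne']
    _ ≤ _ := setLIntegral_mono' measurableSet_Ioi fun s hs =>
        ENNReal.ofReal_le_ofReal (hcon s hs)

/-- The dyadic step: `1 + τ` at most doubles over `[τ, T]`. -/
theorem abs_sub_le_of_energy_decay_of_le {m : ℝ → ℝ} {K p τ T : ℝ} (hK : 0 ≤ K) (hτ : 0 ≤ τ)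
    (hT : T ≤ 2 * τ + 1) (hm : (m T - m τ) ^ 2 ≤ (T - τ) * (K / (1 + τ) ^ (1 + p))) :
    |m T - m τ| ≤ √K * (1 + τ) ^ (-(p / 2)) := by
  have hpos : 0 < 1 + τ := by linarith
  have hsq : ((1 + τ) ^ (-(p / 2))) ^ 2 = (1 + τ) / (1 + τ) ^ (1 + p) := by
    rw [← Real.rpow_natCast, ← Real.rpow_mul hpos.le,
      show -(p / 2) * ((2 : ℕ) : ℝ) = 1 - (1 + p) by push_cast; ring, Real.rpow_sub hpos,
      Real.rpow_one]
  refine abs_le_of_sq_le_sq ?_ (by positivity)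
  calc (m T - m τ) ^ 2 ≤ (T - τ) * (K / (1 + τ) ^ (1 + p)) := hm
    _ ≤ (1 + τ) * (K / (1 + τ) ^ (1 + p)) := by gcongr; linarith
    _ = (√K * (1 + τ) ^ (-(p / 2))) ^ 2 := by rw [mul_pow, Real.sq_sqrt hK, hsq]; ring

/-- The sum of the geometric series `∑ 2 ^ (-(n p / 2))` over the dyadic steps. -/
noncomputable def dyadicConst (p : ℝ) : ℝ := (1 - 2 ^ (-(p / 2)))⁻¹

theorem one_add_dyadicConst_mul {p : ℝ} (hp : 0 < p) :
    1 + dyadicConst p * 2 ^ (-(p / 2)) = dyadicConst p := by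
  have : (2 : ℝ) ^ (-(p / 2)) < 1 :=
    Real.rpow_lt_one_of_one_lt_of_neg one_lt_two (by linarith)
  have : 1 - (2 : ℝ) ^ (-(p / 2)) ≠ 0 := by linarith
  rw [dyadicConst]
  field_simp
  ring

theorem one_le_dyadicConst {p : ℝ} (hp : 0 < p) : 1 ≤ dyadicConst p := by
  have hlt : (2 : ℝ) ^ (-(p / 2)) < 1 :=
    Real.rpow_lt_one_of_one_lt_of_neg one_lt_two (by linarith)
  exact one_le_inv_iff₀.2 ⟨sub_pos.2 hlt, by linarith [Real.rpow_pos_of_pos two_pos (-(p / 2))]⟩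

theorem abs_sub_le_of_energy_decay {m : ℝ → ℝ} {K p : ℝ} (hK : 0 ≤ K) (hp : 0 < p)
    (hm : ∀ τ T, 0 ≤ τ → τ ≤ T → (m T - m τ) ^ 2 ≤ (T - τ) * (K / (1 + τ) ^ (1 + p)))
    {τ T : ℝ} (hτ : 0 ≤ τ) (hT : τ ≤ T) :
    |m T - m τ| ≤ dyadicConst p * (√K * (1 + τ) ^ (-(p / 2))) := by
  suffices key : ∀ n : ℕ, ∀ τ, 0 ≤ τ → τ ≤ T → 1 + T ≤ 2 ^ n * (1 + τ) →
      |m T - m τ| ≤ dyadicConst p * (√K * (1 + τ) ^ (-(p / 2))) by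
    obtain ⟨n, hn⟩ := pow_unbounded_of_one_lt (1 + T) one_lt_two
    exact key n τ hτ hT (hn.le.trans (le_mul_of_one_le_right (by positivity) (by linarith)))
  have short : ∀ τ, 0 ≤ τ → τ ≤ T → T ≤ 2 * τ + 1 →
      |m T - m τ| ≤ dyadicConst p * (√K * (1 + τ) ^ (-(p / 2))) := fun τ h0 hT h1 =>
    (abs_sub_le_of_energy_decay_of_le hK h0 h1 (hm τ T h0 hT)).trans
      (le_mul_of_one_le_left (by positivity) (one_le_dyadicConst hp))
  intro n
  induction n with
  | zero => exact fun τ h0 hT h1 => short τ h0 hT (by linarith)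
  | succ n ih =>
    intro τ h0 hT h1
    rcases le_total T (2 * τ + 1) with h2 | h2
    · exact short τ h0 hT h2
    have first := abs_sub_le_of_energy_decay_of_le hK h0 le_rfl
      (hm τ (2 * τ + 1) h0 (by linarith))
    have rest := ih (2 * τ + 1) (by linarith) h2 (by rw [pow_succ] at h1; linarith)
    rw [show 1 + (2 * τ + 1) = 2 * (1 + τ) by ring,
      Real.mul_rpow two_pos.le (by linarith)] at rest
    calc |m T - m τ| ≤ |m T - m (2 * τ + 1)| + |m (2 * τ + 1) - m τ| := abs_sub_le _ _ _
      _ ≤ _ := add_le_add rest first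
      _ = (1 + dyadicConst p * 2 ^ (-(p / 2))) * (√K * (1 + τ) ^ (-(p / 2))) := by ring
      _ = _ := by rw [one_add_dyadicConst_mul hp]

theorem abs_sub_le_of_flux_decay {m u F : ℝ → ℝ} {K D p : ℝ} (hK : 0 ≤ K) (hD : 0 ≤ D) (hp : 0 < p)
    (hu : ContinuousOn u (Ici 0))
    (hmu : ∀ τ T, 0 ≤ τ → 0 ≤ T → m T - m τ = ∫ s in τ..T, u s)
    (huF : ∀ s, 0 ≤ s → u s ^ 2 ≤ K * F s)
    (hF : ∀ τ : ℝ, 0 ≤ τ → ∫⁻ s in Ioi τ, ENNReal.ofReal (F s)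
      ≤ ENNReal.ofReal (D / (1 + τ) ^ (1 + p)))
    {τ T : ℝ} (hτ : 0 ≤ τ) (hT : τ ≤ T) :
    |m T - m τ| ≤ dyadicConst p * (√(K * D) * (1 + τ) ^ (-(p / 2))) := by
  refine abs_sub_le_of_energy_decay (by positivity) hp (fun τ T hτ hT => ?_) hτ hT
  have : 0 < 1 + τ := by linarith
  have huI : ContinuousOn u (Icc τ T) := hu.mono fun s hs => hτ.trans hs.1
  have henergy := intervalIntegral_sq_le_of_flux_le hK (by positivity) hT huI
    (fun s hs => huF s (hτ.trans hs)) (hF τ hτ)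
  calc (m T - m τ) ^ 2 ≤ (T - τ) * ∫ s in τ..T, u s ^ 2 := by
        rw [hmu τ T hτ (hτ.trans hT)]; exact sq_intervalIntegral_le hT huI
    _ ≤ (T - τ) * (K * (D / (1 + τ) ^ (1 + p))) :=
        mul_le_mul_of_nonneg_left henergy (sub_nonneg.2 hT)
    _ = (T - τ) * (K * D / (1 + τ) ^ (1 + p)) := by ring

/-! ## The charge constant -/

theorem le_rPlus (a M : ℝ) : M ≤ rPlus a M := le_add_of_nonneg_right (Real.sqrt_nonneg _)

theorem sphereIntegral_of_hasDerivAt {g G : ℝ → ℝ} (hg : Continuous g)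
    (hG : ∀ θ, HasDerivAt G (g θ * Real.sin θ) θ) :
    sphereIntegral (fun θ _ => g θ) = 2 * π * (G π - G 0) := by
  simp only [sphereIntegral]
  rw [intervalIntegral.integral_eq_sub_of_hasDerivAt (fun θ _ => hG θ)
      (Continuous.intervalIntegrable (by fun_prop) _ _),
    intervalIntegral.integral_const, smul_eq_mul, sub_zero]

theorem chargeConstant_of_ne_zero {a M : ℝ} (hM : 0 < M) (ha : a ≠ 0) :
    chargeConstant a M = 4 * π * (2 * Real.arctan (a / rPlus a M) / (a / rPlus a M) - 1) := by
  unfold chargeConstant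
  set γ := a / rPlus a M
  have hγ : γ ≠ 0 := div_ne_zero ha (hM.trans_le (le_rPlus a M)).ne'
  have hpos : ∀ θ : ℝ, 1 + γ ^ 2 * Real.cos θ ^ 2 ≠ 0 := fun θ => by positivity
  rw [sphereIntegral_of_hasDerivAt
    (g := fun θ => (1 - γ ^ 2 * Real.cos θ ^ 2) / (1 + γ ^ 2 * Real.cos θ ^ 2))
    (G := fun θ => Real.cos θ - 2 * Real.arctan (γ * Real.cos θ) / γ)
    (Continuous.div (by fun_prop) (by fun_prop) hpos)]
  · simp only [Real.cos_pi, Real.cos_zero, mul_neg, mul_one, Real.arctan_neg]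
    ring
  · intro θ
    have harctan := ((Real.hasDerivAt_cos θ).const_mul γ).arctan
    refine ((Real.hasDerivAt_cos θ).sub ((harctan.const_mul 2).div_const γ)).congr_deriv ?_
    have := hpos θ
    rw [mul_pow]
    field_simp
    ring

theorem chargeConstant_zero (M : ℝ) : chargeConstant 0 M = 4 * π := by
  simpa [chargeConstant] using sphereIntegral_const 1

theorem lt_two_mul_arctan {x : ℝ} (hx : 0 < x) (hx1 : x ≤ 1) : x < 2 * Real.arctan x := by
  have hsin := Real.sin_lt (Real.arctan_pos.2 hx)
  rw [Real.sin_arctan] at hsin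
  have hsqrt : √(1 + x ^ 2) ≤ 2 := Real.sqrt_le_iff.2 ⟨two_pos.le, by nlinarith⟩
  have : x / 2 ≤ x / √(1 + x ^ 2) := by gcongr
  linarith

theorem one_lt_two_mul_arctan_div {x : ℝ} (hx : x ≠ 0) (hx1 : |x| ≤ 1) :
    1 < 2 * Real.arctan x / x := by
  rcases lt_or_gt_of_ne hx with h | h
  · have := lt_two_mul_arctan (neg_pos.2 h) (by rwa [← abs_of_neg h])
    rw [Real.arctan_neg] at this
    rw [one_lt_div_of_neg h]
    linarith
  · rw [one_lt_div h]
    exact lt_two_mul_arctan h (by rwa [← abs_of_pos h])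

theorem chargeConstant_ne_zero {a M : ℝ} (hM : 0 < M) (ha : |a| ≤ M) : chargeConstant a M ≠ 0 := by
  rcases eq_or_ne a 0 with rfl | ha0
  · rw [chargeConstant_zero]
    positivity
  have hr : 0 < rPlus a M := hM.trans_le (le_rPlus a M)
  have hγ : |a / rPlus a M| ≤ 1 := by
    rw [abs_div, abs_of_pos hr, div_le_one hr]
    exact ha.trans (le_rPlus a M)
  have := one_lt_two_mul_arctan_div (div_ne_zero ha0 hr.ne') hγ
  rw [chargeConstant_of_ne_zero hM ha0]
  have : 0 < 2 * Real.arctan (a / rPlus a M) / (a / rPlus a M) - 1 := by linarith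
  positivity

/-! ## The Kerr metric and the horizontal frame -/

theorem Del_eq {a M : ℝ} (ha : |a| ≤ M) (r : ℝ) : Del a M r = r ^ 2 - 2 * M * r + a ^ 2 := by
  have h : 0 ≤ M ^ 2 - a ^ 2 := sub_nonneg.2 (sq_le_sq.2 (ha.trans (le_abs_self M)))
  have hsqrt := Real.sq_sqrt h
  unfold Del rPlus rMinus
  linear_combination -hsqrt

theorem Del_rPlus (a M : ℝ) : Del a M (rPlus a M) = 0 := by simp [Del]

theorem Sig_pos {a : ℝ} {q : R4} (h : 0 < q 1) : 0 < Sig a q := by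
  unfold Sig; positivity

theorem Sig_eq (a : ℝ) (q : R4) : Sig a q = q 1 ^ 2 + a ^ 2 * (1 - Real.sin (q 2) ^ 2) := by
  rw [Sig, Real.cos_sq']

theorem differentiableAt_Sig {a : ℝ} {q : R4} : DifferentiableAt ℝ (Sig a) q := by
  unfold Sig; fun_prop

theorem kerrInner_eq_sum (a M : ℝ) (q u v : R4) :
    kerrInner a M q u v = ∑ i, ∑ j, u i * (kerrMetric a M q i j * v j) := by
  simp only [kerrInner, dotProduct, Matrix.mulVec, Finset.mul_sum]

theorem kerrMetric_symm (a M : ℝ) (q : R4) (i j : Fin 4) :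
    kerrMetric a M q i j = kerrMetric a M q j i := by
  fin_cases i <;> fin_cases j <;> rfl

theorem kerrInner_symm (a M : ℝ) (q u v : R4) : kerrInner a M q u v = kerrInner a M q v u := by
  rw [kerrInner_eq_sum, kerrInner_eq_sum, Finset.sum_comm]
  refine Finset.sum_congr rfl fun i _ => Finset.sum_congr rfl fun j _ => ?_
  rw [kerrMetric_symm a M q j i]
  ring

theorem kerrInner_zero_left (a M : ℝ) (q v : R4) : kerrInner a M q 0 v = 0 :=
  zero_dotProduct _

theorem kerrInner_sub_left (a M : ℝ) (q u u' v : R4) :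
    kerrInner a M q (u - u') v = kerrInner a M q u v - kerrInner a M q u' v :=
  sub_dotProduct _ _ _

theorem differentiableAt_kerrMetric {a M : ℝ} {q : R4} (hq : 0 < q 1) (i j : Fin 4) :
    DifferentiableAt ℝ (fun q' => kerrMetric a M q' i j) q := by
  have hSig : Sig a q ≠ 0 := (Sig_pos hq).ne'
  have hdSig : DifferentiableAt ℝ (Sig a) q := differentiableAt_Sig
  fin_cases i <;> fin_cases j <;>
    simp only [kerrMetric, Del, Matrix.of_apply, Matrix.cons_val', Fin.zero_eta, Fin.mk_one,
      Fin.reduceFinMk, Matrix.cons_val, Matrix.cons_val_fin_one] <;>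
    fun_prop (disch := assumption)

theorem differentiableAt_kerrInner {a M : ℝ} {q : R4} (hq : 0 < q 1) (u v : R4) :
    DifferentiableAt ℝ (fun q' => kerrInner a M q' u v) q := by
  simp only [kerrInner_eq_sum]
  have hg := fun i j => differentiableAt_kerrMetric (a := a) (M := M) hq i j
  fun_prop

/-- The one-form `dt - a sin² θ dφ` of Carter's coframe. -/
noncomputable def carterTime (a : ℝ) (q X : R4) : ℝ := X 0 - a * Real.sin (q 2) ^ 2 * X 3

/-- The one-form `a dt - (r² + a²) dφ` of Carter's coframe. -/
def carterAngle (a : ℝ) (q X : R4) : ℝ := a * X 0 - (q 1 ^ 2 + a ^ 2) * X 3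

theorem kerrInner_eq_carter {a M : ℝ} (ha : |a| ≤ M) {q u v : R4} (hq : 0 < q 1)
    (hu : u 1 = 0) (hv : v 1 = 0) :
    kerrInner a M q u v
      = -(Del a M (q 1) / Sig a q) * carterTime a q u * carterTime a q v
        + Real.sin (q 2) ^ 2 / Sig a q * carterAngle a q u * carterAngle a q v
        + Sig a q * u 2 * v 2 := by
  have h := (Sig_pos (a := a) hq).ne'
  simp only [kerrInner, kerrMetric, dotProduct, Matrix.mulVec, Fin.sum_univ_four, hu, hv,
    carterTime, carterAngle]
  simp only [Matrix.of_apply, Matrix.cons_val', Matrix.cons_val_zero, Matrix.cons_val_one,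
    Matrix.cons_val, Matrix.cons_val_fin_one, Del_eq ha]
  field_simp
  rw [Sig_eq]
  ring

theorem frame_zero (a : ℝ) (q : R4) : frame a 0 q =
    ![a ^ 2 * Real.sin (q 2) * Real.cos (q 2) / Sig a q, 0, q 1 / Sig a q,
      a * Real.cos (q 2) / (Sig a q * Real.sin (q 2))] := rfl

theorem frame_one (a : ℝ) (q : R4) : frame a 1 q =
    ![a * q 1 * Real.sin (q 2) / Sig a q, 0, -(a * Real.cos (q 2)) / Sig a q,
      q 1 / (Sig a q * Real.sin (q 2))] := rfl

theorem frame_apply_one (a : ℝ) (A : Fin 2) (q : R4) : frame a A q 1 = 0 := by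
  fin_cases A <;> rfl

theorem carterTime_frame (a : ℝ) (A : Fin 2) (q : R4) : carterTime a q (frame a A q) = 0 := by
  by_cases hs : Real.sin (q 2) = 0
  · fin_cases A <;> simp [carterTime, frame, hs]
  · fin_cases A <;>
      simp only [carterTime, Fin.zero_eta, Fin.mk_one, frame_zero, frame_one, Matrix.cons_val] <;>
      field_simp <;> ring

theorem carterAngle_frame_zero {a : ℝ} {q : R4} (hq : 0 < q 1) (hs : Real.sin (q 2) ≠ 0) :
    carterAngle a q (frame a 0 q) = -(a * Real.cos (q 2) / Real.sin (q 2)) := by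
  have h := (Sig_pos (a := a) hq).ne'
  simp only [carterAngle, frame_zero, Matrix.cons_val]
  field_simp
  rw [Sig_eq]
  ring

theorem carterAngle_frame_one {a : ℝ} {q : R4} (hq : 0 < q 1) (hs : Real.sin (q 2) ≠ 0) :
    carterAngle a q (frame a 1 q) = -(q 1 / Real.sin (q 2)) := by
  have h := (Sig_pos (a := a) hq).ne'
  simp only [carterAngle, frame_one, Matrix.cons_val]
  field_simp
  rw [Sig_eq]
  ring

theorem kerrInner_frame_right {a M : ℝ} (ha : |a| ≤ M) {q u : R4} (hq : 0 < q 1)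
    (hu : u 1 = 0) (B : Fin 2) :
    kerrInner a M q u (frame a B q)
      = Real.sin (q 2) ^ 2 / Sig a q * carterAngle a q u * carterAngle a q (frame a B q)
        + Sig a q * u 2 * frame a B q 2 := by
  rw [kerrInner_eq_carter ha hq hu (frame_apply_one a B q), carterTime_frame, mul_zero, zero_add]

theorem kerrInner_frame_frame {a M : ℝ} (ha : |a| ≤ M) {q : R4} (hq : 0 < q 1)
    (hs : Real.sin (q 2) ≠ 0) (A B : Fin 2) :
    kerrInner a M q (frame a A q) (frame a B q) = if A = B then 1 else 0 := by
  have h := (Sig_pos (a := a) hq).ne'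
  have hSig : Sig a q = q 1 ^ 2 + a ^ 2 * Real.cos (q 2) ^ 2 := rfl
  rw [kerrInner_frame_right ha hq (frame_apply_one a A q)]
  fin_cases A <;> fin_cases B <;>
    simp only [Fin.zero_eta, Fin.mk_one, carterAngle_frame_zero hq hs, carterAngle_frame_one hq hs,
      if_true, one_ne_zero, zero_ne_one, if_false] <;>
    simp only [frame_zero, frame_one, Matrix.cons_val] <;>
    field_simp
  · rw [hSig]; ring
  · ring
  · ring
  · rw [hSig]

theorem differentiableAt_frame {a : ℝ} {q : R4} (hq : 0 < q 1) (hs : Real.sin (q 2) ≠ 0)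
    (A : Fin 2) : DifferentiableAt ℝ (frame a A) q := by
  have hSig : Sig a q ≠ 0 := (Sig_pos hq).ne'
  have hSigs : Sig a q * Real.sin (q 2) ≠ 0 := mul_ne_zero hSig hs
  have hdSig : DifferentiableAt ℝ (Sig a) q := differentiableAt_Sig
  refine differentiableAt_pi.2 fun i => ?_
  fin_cases A <;> fin_cases i <;>
    simp only [Fin.zero_eta, Fin.mk_one, Fin.reduceFinMk, frame_zero, frame_one,
      Matrix.cons_val] <;>
    fun_prop (disch := assumption)

/-! ## The Levi-Civita connection in the frame -/

section Line

variable {E : Type*} [NormedAddCommGroup E] [NormedSpace ℝ E] {F : R4 → E} {q X : R4}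

theorem fderiv_eq_of_hasDerivAt_line {d : E} (hF : DifferentiableAt ℝ F q)
    (hd : HasDerivAt (fun s : ℝ => F (q + s • X)) d 0) : fderiv ℝ F q X = d :=
  (hF.hasFDerivAt.hasLineDerivAt X).unique hd

theorem hasDerivAt_line (hF : DifferentiableAt ℝ F q) (X : R4) :
    HasDerivAt (fun s : ℝ => F (q + s • X)) (fderiv ℝ F q X) 0 :=
  hF.hasFDerivAt.hasLineDerivAt X

theorem hasDerivAt_line_apply (q X : R4) (i : Fin 4) :
    HasDerivAt (fun s : ℝ => (q + s • X) i) (X i) 0 := by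
  simpa using ((hasDerivAt_id (0 : ℝ)).mul_const (X i)).const_add (q i)

end Line

theorem fderiv_kerrInner_const {a M : ℝ} {q : R4} (hq : 0 < q 1) (X u v : R4) :
    fderiv ℝ (fun q' => kerrInner a M q' u v) q X
      = ∑ i, ∑ j, u i * (fderiv ℝ (fun q' => kerrMetric a M q' i j) q X * v j) := by
  refine fderiv_eq_of_hasDerivAt_line (differentiableAt_kerrInner hq _ _) ?_
  simp only [kerrInner_eq_sum]
  exact HasDerivAt.fun_sum fun i _ => HasDerivAt.fun_sum fun j _ =>
    ((hasDerivAt_line (differentiableAt_kerrMetric hq i j) X).mul_const _).const_mul _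

theorem fderiv_kerrInner {a M : ℝ} {q : R4} (hq : 0 < q 1) (X : R4) {Y Z : R4 → R4}
    (hY : DifferentiableAt ℝ Y q) (hZ : DifferentiableAt ℝ Z q) :
    fderiv ℝ (fun q' => kerrInner a M q' (Y q') (Z q')) q X
      = kerrInner a M q (fderiv ℝ Y q X) (Z q) + kerrInner a M q (Y q) (fderiv ℝ Z q X)
        + fderiv ℝ (fun q' => kerrInner a M q' (Y q) (Z q)) q X := by
  have hg := fun i j => differentiableAt_kerrMetric (a := a) (M := M) hq i j
  rw [fderiv_kerrInner_const hq]
  simp only [kerrInner_eq_sum]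
  refine fderiv_eq_of_hasDerivAt_line (by fun_prop) ?_
  refine (HasDerivAt.fun_sum fun i _ => HasDerivAt.fun_sum fun j _ =>
      (hasDerivAt_pi.1 (hasDerivAt_line hY X) i).mul ((hasDerivAt_line (hg i j) X).mul
        (hasDerivAt_pi.1 (hasDerivAt_line hZ X) j))).congr_deriv ?_
  simp only [← Finset.sum_add_distrib]
  refine Finset.sum_congr rfl fun i _ => Finset.sum_congr rfl fun j _ => ?_
  simp only [Pi.mul_apply, zero_smul, add_zero]
  ring

theorem leviCivita_add_leviCivita {a M : ℝ} {q : R4} (hq : 0 < q 1) (X : R4) {Y Z : R4 → R4}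
    (hY : DifferentiableAt ℝ Y q) (hZ : DifferentiableAt ℝ Z q) :
    leviCivita a M q X Y (Z q) + leviCivita a M q X Z (Y q)
      = fderiv ℝ (fun q' => kerrInner a M q' (Y q') (Z q')) q X := by
  rw [fderiv_kerrInner hq X hY hZ]
  unfold leviCivita
  simp only [kerrInner_symm a M _ (Z q) (Y q), kerrInner_symm a M q (fderiv ℝ Z q X) (Y q)]
  ring

theorem leviCivita_sub_leviCivita {a M : ℝ} {q : R4} (X Y : R4 → R4) (Z : R4) :
    leviCivita a M q (X q) Y Z - leviCivita a M q (Y q) X Z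
      = kerrInner a M q (fderiv ℝ Y q (X q) - fderiv ℝ X q (Y q)) Z := by
  rw [kerrInner_sub_left]
  unfold leviCivita
  simp only [kerrInner_symm a M _ (Y q) (X q)]
  ring

theorem eventually_off_axis {q : R4} (hq : 0 < q 1) (hs : Real.sin (q 2) ≠ 0) :
    ∀ᶠ q' : R4 in 𝓝 q, 0 < q' 1 ∧ Real.sin (q' 2) ≠ 0 := by
  have hr : Continuous fun q' : R4 => q' 1 := by fun_prop
  have hsin : Continuous fun q' : R4 => Real.sin (q' 2) := by fun_prop
  exact (hr.continuousAt.eventually_const_lt hq).and (hsin.continuousAt.eventually_ne hs)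

theorem leviCivita_frame_antisymm {a M : ℝ} (ha : |a| ≤ M) {q : R4} (hq : 0 < q 1)
    (hs : Real.sin (q 2) ≠ 0) (X : R4) (A B : Fin 2) :
    leviCivita a M q X (frame a A) (frame a B q) + leviCivita a M q X (frame a B) (frame a A q)
      = 0 := by
  rw [leviCivita_add_leviCivita hq X (differentiableAt_frame hq hs A)
    (differentiableAt_frame hq hs B)]
  have hconst : (fun q' => kerrInner a M q' (frame a A q') (frame a B q'))
      =ᶠ[𝓝 q] fun _ => if A = B then 1 else 0 :=
    (eventually_off_axis hq hs).mono fun q' h => kerrInner_frame_frame ha h.1 h.2 A B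
  rw [hconst.fderiv_eq]
  simp

theorem leviCivita_frame_self {a M : ℝ} (ha : |a| ≤ M) {q : R4} (hq : 0 < q 1)
    (hs : Real.sin (q 2) ≠ 0) (X : R4) (A : Fin 2) :
    leviCivita a M q X (frame a A) (frame a A q) = 0 := by
  linarith [leviCivita_frame_antisymm ha hq hs X A A]

/-- The derivative of the frame in the direction `∂_θ`. The components of the frame depend only on
`r` and `θ`, so its derivative in every direction `X` tangent to the level sets of `r` is `X 2`
times this. -/
noncomputable def frameDeriv (a : ℝ) (A : Fin 2) (q : R4) : R4 :=
  if A = 0 then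
    ![a ^ 2 * (Real.cos (q 2) ^ 2 - Real.sin (q 2) ^ 2) / Sig a q
        + 2 * a ^ 4 * Real.sin (q 2) ^ 2 * Real.cos (q 2) ^ 2 / Sig a q ^ 2, 0,
      2 * a ^ 2 * q 1 * Real.sin (q 2) * Real.cos (q 2) / Sig a q ^ 2,
      -(a / Sig a q) + a * Real.cos (q 2) ^ 2
        * (2 * a ^ 2 * Real.sin (q 2) ^ 2 - Sig a q) / (Sig a q * Real.sin (q 2)) ^ 2]
  else
    ![a * q 1 * Real.cos (q 2) / Sig a q
        + 2 * a ^ 3 * q 1 * Real.sin (q 2) ^ 2 * Real.cos (q 2) / Sig a q ^ 2, 0,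
      a * Real.sin (q 2) / Sig a q
        - 2 * a ^ 3 * Real.sin (q 2) * Real.cos (q 2) ^ 2 / Sig a q ^ 2,
      q 1 * Real.cos (q 2) * (2 * a ^ 2 * Real.sin (q 2) ^ 2 - Sig a q)
        / (Sig a q * Real.sin (q 2)) ^ 2]

theorem hasDerivAt_Sig_line (a : ℝ) {q X : R4} (hX : X 1 = 0) :
    HasDerivAt (fun s : ℝ => Sig a (q + s • X))
      (X 2 * (-2 * a ^ 2 * Real.sin (q 2) * Real.cos (q 2))) 0 := by
  have h := (((hasDerivAt_line_apply q X 2).cos.pow 2).const_mul (a ^ 2)).const_add (q 1 ^ 2)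
  have hr (s : ℝ) : (q + s • X) 1 = q 1 := by simp [hX]
  simp only [Sig, hr]
  refine h.congr_deriv ?_
  simp only [zero_smul, add_zero]
  push_cast
  ring

theorem fderiv_frame {a : ℝ} {q X : R4} (hq : 0 < q 1) (hs : Real.sin (q 2) ≠ 0) (hX : X 1 = 0)
    (A : Fin 2) : fderiv ℝ (frame a A) q X = X 2 • frameDeriv a A q := by
  have h0 := (Sig_pos (a := a) hq).ne'
  refine fderiv_eq_of_hasDerivAt_line (differentiableAt_frame hq hs A) ?_
  have hθ := hasDerivAt_line_apply q X 2
  have hr (s : ℝ) : (q + s • X) 1 = q 1 := by simp [hX]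
  have hS := hasDerivAt_Sig_line a (q := q) hX
  have hS0 : Sig a (q + (0 : ℝ) • X) ≠ 0 := by simpa using h0
  have hSs0 : Sig a (q + (0 : ℝ) • X) * Real.sin ((q + (0 : ℝ) • X) 2) ≠ 0 := by
    simpa using And.intro h0 hs
  refine hasDerivAt_pi.2 fun i => ?_
  fin_cases A <;> fin_cases i <;>
    simp only [frame, frameDeriv, Fin.zero_eta, Fin.mk_one, Fin.reduceFinMk, if_true, one_ne_zero,
      if_false, Matrix.cons_val, hr, Pi.smul_apply, smul_eq_mul, mul_zero]
  · refine (((hθ.sin.const_mul (a ^ 2)).mul hθ.cos).div hS hS0).congr_deriv ?_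
    simp only [Pi.mul_apply, zero_smul, add_zero]; field_simp; ring
  · exact hasDerivAt_const _ _
  · refine ((hasDerivAt_const _ (q 1)).div hS hS0).congr_deriv ?_
    simp only [zero_smul, add_zero]; field_simp; ring
  · refine ((hθ.cos.const_mul a).div (hS.mul hθ.sin) hSs0).congr_deriv ?_
    simp only [Pi.mul_apply, zero_smul, add_zero]; field_simp; ring
  · refine ((hθ.sin.const_mul (a * q 1)).div hS hS0).congr_deriv ?_
    simp only [zero_smul, add_zero]; field_simp; ring
  · exact hasDerivAt_const _ _
  · refine ((hθ.cos.const_mul a).neg.div hS hS0).congr_deriv ?_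
    simp only [Pi.neg_apply, zero_smul, add_zero]; field_simp
  · refine ((hasDerivAt_const _ (q 1)).div (hS.mul hθ.sin) hSs0).congr_deriv ?_
    simp only [Pi.mul_apply, zero_smul, add_zero]; field_simp; ring

theorem kerrInner_frame_commutator {a M : ℝ} (ha : |a| ≤ M) {q : R4} (hq : 0 < q 1)
    (hs : Real.sin (q 2) ≠ 0) (B : Fin 2) :
    kerrInner a M q (fderiv ℝ (frame a 1) q (frame a 0 q) - fderiv ℝ (frame a 0) q (frame a 1 q))
        (frame a B q)
      = Real.sin (q 2) ^ 2 / Sig a q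
          * carterAngle a q (frame a 0 q 2 • frameDeriv a 1 q - frame a 1 q 2 • frameDeriv a 0 q)
          * carterAngle a q (frame a B q)
        + Sig a q * (frame a 0 q 2 * frameDeriv a 1 q 2 - frame a 1 q 2 * frameDeriv a 0 q 2)
          * frame a B q 2 := by
  rw [fderiv_frame hq hs (frame_apply_one a 0 q), fderiv_frame hq hs (frame_apply_one a 1 q),
    kerrInner_frame_right ha hq (by simp [frameDeriv])]
  simp only [Pi.sub_apply, Pi.smul_apply, smul_eq_mul]

/-- The connection coefficients `g(∇_A e₁, e₂)` of the horizontal frame. -/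
noncomputable def connCoeff (a : ℝ) (A : Fin 2) (q : R4) : ℝ :=
  if A = 0 then
    a / (Real.sin (q 2) * Sig a q ^ 2) * (Real.cos (q 2) ^ 2 * (q 1 ^ 2 + a ^ 2)
      - q 1 ^ 2 * Real.sin (q 2) ^ 2)
  else
    q 1 * Real.cos (q 2) / (Real.sin (q 2) * Sig a q ^ 2)
      * (a ^ 2 * Real.sin (q 2) ^ 2 + q 1 ^ 2 + a ^ 2)

/-- By metric compatibility and vanishing torsion, the connection coefficients are the components of
the commutator of the frame vectors. -/
theorem leviCivita_frame {a M : ℝ} (ha : |a| ≤ M) {q : R4} (hq : 0 < q 1)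
    (hs : Real.sin (q 2) ≠ 0) (A : Fin 2) :
    leviCivita a M q (frame a A q) (frame a 0) (frame a 1 q) = connCoeff a A q := by
  have h0 := (Sig_pos (a := a) hq).ne'
  have hSig : Sig a q = q 1 ^ 2 + a ^ 2 * Real.cos (q 2) ^ 2 := rfl
  have hsin : Real.sin (q 2) ^ 2 = 1 - Real.cos (q 2) ^ 2 := Real.sin_sq _
  have hcomm : leviCivita a M q (frame a A q) (frame a 0) (frame a 1 q)
      = -kerrInner a M q
          (fderiv ℝ (frame a 1) q (frame a 0 q) - fderiv ℝ (frame a 0) q (frame a 1 q))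
          (frame a A q) := by
    have htorsion := leviCivita_sub_leviCivita (a := a) (M := M) (q := q) (frame a 0) (frame a 1)
    have hself := leviCivita_frame_self ha hq hs
    fin_cases A
    · have hanti := leviCivita_frame_antisymm ha hq hs (frame a 0 q) 0 1
      simp only [Fin.zero_eta, Fin.isValue, ← htorsion, hself]
      linarith
    · simp only [Fin.mk_one, Fin.isValue, ← htorsion, hself]
      ring
  rw [hcomm, kerrInner_frame_commutator ha hq hs]
  fin_cases A <;>
    simp only [Fin.zero_eta, Fin.mk_one, Fin.isValue, carterAngle_frame_zero hq hs,
      carterAngle_frame_one hq hs] <;>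
    simp only [carterAngle, Pi.sub_apply, Pi.smul_apply, smul_eq_mul, frame_zero, frame_one,
      frameDeriv, connCoeff, if_true, one_ne_zero, if_false, Matrix.cons_val] <;>
    generalize Real.sin (q 2) = s at * <;>
    generalize Real.cos (q 2) = c at * <;>
    generalize Sig a q = S at * <;>
    generalize q 1 = r at * <;>
    field_simp <;>
    subst hSig <;>
    grind

theorem kerrInner_eq_zero_of_null {a M : ℝ} (ha : |a| ≤ M) {q u v : R4} (hq : 0 < q 1)
    (hΔ : Del a M (q 1) = 0) (hu₁ : u 1 = 0) (hu₂ : u 2 = 0) (hu : carterAngle a q u = 0)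
    (hv : v 1 = 0) : kerrInner a M q u v = 0 := by
  rw [kerrInner_eq_carter ha hq hu₁ hv, hΔ, hu, hu₂]
  ring

theorem e4_apply_one_of_horizon {a M : ℝ} {q : R4} (hr : q 1 = rPlus a M) : e4 a M q 1 = 0 := by
  simp [e4, hr, Del_rPlus]

theorem fderiv_kerrInner_e4_of_horizon {a M : ℝ} (ha : |a| ≤ M) {q X v : R4} (hq : 0 < q 1)
    (hr : q 1 = rPlus a M) (hX : X 1 = 0) (hv : v 1 = 0) :
    fderiv ℝ (fun q' => kerrInner a M q' (e4 a M q) v) q X = 0 := by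
  refine fderiv_eq_of_hasDerivAt_line (differentiableAt_kerrInner hq _ _) ?_
  have hline (s : ℝ) : (q + s • X) 1 = q 1 := by simp [hX]
  have hnull (s : ℝ) : carterAngle a (q + s • X) (e4 a M q) = 0 := by
    simp only [carterAngle, hline, e4, Matrix.cons_val]
    ring
  have hconst : (fun s : ℝ => kerrInner a M (q + s • X) (e4 a M q) v) = fun _ => 0 :=
    funext fun s => kerrInner_eq_zero_of_null ha (hline s ▸ hq) (by rw [hline, hr, Del_rPlus])
      (e4_apply_one_of_horizon hr) rfl (hnull s) hv
  rw [hconst]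
  exact hasDerivAt_const _ _

theorem leviCivita_e4_frame_of_horizon {a M : ℝ} (ha : |a| ≤ M) {q : R4} (hq : 0 < q 1)
    (hr : q 1 = rPlus a M) (hs : Real.sin (q 2) ≠ 0) :
    leviCivita a M q (e4 a M q) (frame a 0) (frame a 1 q) = 0 := by
  have h1 := e4_apply_one_of_horizon hr
  have h2 : e4 a M q 2 = 0 := rfl
  have hnull {X v : R4} (hX : X 1 = 0) (hv : v 1 = 0) :=
    fderiv_kerrInner_e4_of_horizon ha hq hr hX hv
  have hstationary :
      fderiv ℝ (fun q' => kerrInner a M q' (frame a 0 q) (frame a 1 q)) q (e4 a M q) = 0 := by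
    refine fderiv_eq_of_hasDerivAt_line (differentiableAt_kerrInner hq _ _) ?_
    have hconst : (fun s : ℝ => kerrInner a M (q + s • e4 a M q) (frame a 0 q) (frame a 1 q))
        = fun _ => kerrInner a M q (frame a 0 q) (frame a 1 q) := by
      ext s
      simp [kerrInner, kerrMetric, Sig, h1, h2]
    rw [hconst]
    exact hasDerivAt_const _ _
  unfold leviCivita
  rw [fderiv_frame hq hs h1, h2, zero_smul, kerrInner_zero_left, hstationary,
    hnull (frame_apply_one a 0 q) (frame_apply_one a 1 q),
    hnull (frame_apply_one a 1 q) (frame_apply_one a 0 q)]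
  ring

/-! ## The coefficients of the Maxwell equations -/

theorem kerrInner_e3_left (a M : ℝ) (q q' v : R4) :
    kerrInner a M q' (e3 q) v = -carterTime a q' v := by
  simp only [kerrInner, kerrMetric, e3, carterTime, dotProduct, Matrix.mulVec, Fin.sum_univ_four,
    Matrix.of_apply, Matrix.cons_val', Matrix.cons_val, Matrix.cons_val_fin_one]
  ring

theorem fderiv_e3 (q X : R4) : fderiv ℝ e3 q X = 0 := by
  have hconst : e3 = fun _ => ![0, -1, 0, 0] := rfl
  rw [hconst, fderiv_fun_const, Pi.zero_apply, zero_apply]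

theorem fderiv_kerrInner_e3_left {a M : ℝ} {q : R4} (hq : 0 < q 1) (X v : R4) :
    fderiv ℝ (fun q' => kerrInner a M q' (e3 q) v) q X
      = 2 * a * Real.sin (q 2) * Real.cos (q 2) * X 2 * v 3 := by
  refine fderiv_eq_of_hasDerivAt_line (differentiableAt_kerrInner hq _ _) ?_
  simp only [kerrInner_e3_left, carterTime]
  refine (((((hasDerivAt_line_apply q X 2).sin.pow 2).const_mul a).mul_const
    (v 3)).const_sub (v 0)).neg.congr_deriv ?_
  simp only [zero_smul, add_zero]
  push_cast
  ring

theorem fderiv_kerrInner_frame_self_e3 {a M : ℝ} (ha : |a| ≤ M) {q : R4} (hq : 0 < q 1)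
    (A : Fin 2) :
    fderiv ℝ (fun q' => kerrInner a M q' (frame a A q) (frame a A q)) q (e3 q)
      = -(Real.sin (q 2) ^ 2 * (-(2 * q 1 / Sig a q ^ 2) * carterAngle a q (frame a A q) ^ 2
          - 4 * q 1 / Sig a q * carterAngle a q (frame a A q) * frame a A q 3)
        + 2 * q 1 * frame a A q 2 ^ 2) := by
  have h0 := (Sig_pos (a := a) hq).ne'
  refine fderiv_eq_of_hasDerivAt_line (differentiableAt_kerrInner hq _ _) ?_
  set v := frame a A q
  have hline₁ := hasDerivAt_line_apply q (e3 q) 1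
  have hline₂ (s : ℝ) : (q + s • e3 q) 2 = q 2 := by simp [e3]
  have hSig : HasDerivAt (fun s : ℝ => Sig a (q + s • e3 q)) (-(2 * q 1)) 0 := by
    simp only [Sig, hline₂]
    refine ((hline₁.pow 2).add_const _).congr_deriv ?_
    simp [e3]
  have hangle : HasDerivAt (fun s : ℝ => carterAngle a (q + s • e3 q) v) (2 * q 1 * v 3) 0 := by
    refine ((((hline₁.pow 2).add_const _).mul_const _).const_sub _).congr_deriv ?_
    simp [e3]
  have hcarter : (fun s : ℝ => kerrInner a M (q + s • e3 q) v v) =ᶠ[𝓝 0]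
      fun s => Real.sin (q 2) ^ 2 / Sig a (q + s • e3 q) * carterAngle a (q + s • e3 q) v ^ 2
        + Sig a (q + s • e3 q) * v 2 ^ 2 := by
    have hpos : ∀ᶠ s : ℝ in 𝓝 0, 0 < (q + s • e3 q) 1 :=
      hline₁.continuousAt.eventually_const_lt (by simpa using hq)
    filter_upwards [hpos] with s hs
    have htime : carterTime a (q + s • e3 q) v = 0 := by
      rw [← carterTime_frame a A q, carterTime, carterTime, hline₂]
    rw [kerrInner_eq_carter ha hs (frame_apply_one a A q) (frame_apply_one a A q), htime, hline₂]
    ring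
  refine HasDerivAt.congr_of_eventuallyEq ?_ hcarter
  refine ((((hasDerivAt_const (0 : ℝ) (Real.sin (q 2) ^ 2)).div hSig (by simpa using h0)).mul
    (hangle.pow 2)).add (hSig.mul_const _)).congr_deriv ?_
  simp only [Pi.pow_apply, Pi.div_apply, zero_smul, add_zero]
  field_simp
  push_cast
  ring

theorem chiBar_frame_eq {a M : ℝ} {q : R4} (hq : 0 < q 1) (A B : Fin 2) :
    chiBar a M q A B = a * Real.sin (q 2) * Real.cos (q 2)
        * (frame a A q 2 * frame a B q 3 - frame a B q 2 * frame a A q 3)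
      + 1 / 2 * fderiv ℝ (fun q' => kerrInner a M q' (frame a A q) (frame a B q)) q (e3 q) := by
  unfold chiBar leviCivita
  simp only [fderiv_e3, kerrInner_zero_left, kerrInner_symm a M _ (frame a A q) (e3 q),
    fderiv_kerrInner_e3_left hq]
  ring

theorem trChiBar_eq {a M : ℝ} (ha : |a| ≤ M) {q : R4} (hq : 0 < q 1)
    (hs : Real.sin (q 2) ≠ 0) : trChiBar a M q = -(2 * q 1 / Sig a q) := by
  have h0 := (Sig_pos (a := a) hq).ne'
  have hSig : Sig a q = q 1 ^ 2 + a ^ 2 * Real.cos (q 2) ^ 2 := rfl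
  simp only [trChiBar, chiBar_frame_eq hq, fderiv_kerrInner_frame_self_e3 ha hq,
    carterAngle_frame_zero hq hs, carterAngle_frame_one hq hs]
  simp only [frame_zero, frame_one, Matrix.cons_val]
  field_simp
  rw [hSig]
  ring

theorem epsChiBar_eq {a M : ℝ} {q : R4} (hq : 0 < q 1)
    (hs : Real.sin (q 2) ≠ 0) : epsChiBar a M q = 2 * a * Real.cos (q 2) / Sig a q := by
  have h0 := (Sig_pos (a := a) hq).ne'
  have hSig : Sig a q = q 1 ^ 2 + a ^ 2 * Real.cos (q 2) ^ 2 := rfl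
  simp only [epsChiBar, chiBar_frame_eq hq, kerrInner_symm a M _ (frame a 1 q) (frame a 0 q)]
  simp only [frame_zero, frame_one, Matrix.cons_val]
  field_simp
  rw [hSig]
  ring

theorem coefC_eq {a M : ℝ} (ha : |a| ≤ M) {q : R4} (hq : 0 < q 1) (hs : Real.sin (q 2) ≠ 0) :
    coefC a M q = (q 1 ^ 2 - a ^ 2 * Real.cos (q 2) ^ 2) / Sig a q := by
  have h0 := (Sig_pos (a := a) hq).ne'
  rw [coefC, trChiBar_eq ha hq hs, epsChiBar_eq hq hs]
  field_simp
  ring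

theorem coefD_eq {a M : ℝ} (ha : |a| ≤ M) {q : R4} (hq : 0 < q 1) (hs : Real.sin (q 2) ≠ 0) :
    coefD a M q = -(2 * a * q 1 * Real.cos (q 2) / Sig a q) := by
  have h0 := (Sig_pos (a := a) hq).ne'
  rw [coefD, trChiBar_eq ha hq hs, epsChiBar_eq hq hs]
  field_simp

theorem coefC_sq_add_coefD_sq {a M : ℝ} (ha : |a| ≤ M) {q : R4} (hq : 0 < q 1)
    (hs : Real.sin (q 2) ≠ 0) : coefC a M q ^ 2 + coefD a M q ^ 2 = 1 := by
  have h0 := (Sig_pos (a := a) hq).ne'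
  have hSig : Sig a q = q 1 ^ 2 + a ^ 2 * Real.cos (q 2) ^ 2 := rfl
  rw [coefC_eq ha hq hs, coefD_eq ha hq hs]
  field_simp
  rw [hSig]
  ring

section HorizontalConnection

variable {a M : ℝ} {q : R4}

theorem nablaH_zero (ha : |a| ≤ M) (hq : 0 < q 1) (hs : Real.sin (q 2) ≠ 0) (ς : OneForm)
    (X : R4) :
    nablaH a M ς q X 0 = fderiv ℝ (comp a ς 0) q X
      - leviCivita a M q X (frame a 0) (frame a 1 q) * comp a ς 1 q := by
  simp only [nablaH, Fin.sum_univ_two, leviCivita_frame_self ha hq hs, zero_mul, zero_add]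

theorem nablaH_one (ha : |a| ≤ M) (hq : 0 < q 1) (hs : Real.sin (q 2) ≠ 0) (ς : OneForm)
    (X : R4) :
    nablaH a M ς q X 1 = fderiv ℝ (comp a ς 1) q X
      + leviCivita a M q X (frame a 0) (frame a 1 q) * comp a ς 0 q := by
  have h := eq_neg_of_add_eq_zero_right (leviCivita_frame_antisymm ha hq hs X 0 1)
  simp only [nablaH, Fin.sum_univ_two, leviCivita_frame_self ha hq hs, h, zero_mul, add_zero,
    neg_mul, sub_neg_eq_add]

theorem comp_smul (f : R4 → ℝ) (ς : OneForm) (B : Fin 2) (q : R4) :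
    comp a (fun q' => f q' • ς q') B q = f q * comp a ς B q := by
  simp only [comp, smul_apply, smul_eq_mul]

theorem nablaH_smul {ς : OneForm} {f : R4 → ℝ} {X : R4} {B : Fin 2}
    (hf : DifferentiableAt ℝ f q) (hς : DifferentiableAt ℝ (comp a ς B) q) :
    nablaH a M (fun q' => f q' • ς q') q X B
      = f q * nablaH a M ς q X B + fderiv ℝ f q X * comp a ς B q := by
  have hcomp : comp a (fun q' => f q' • ς q') B = fun q' => f q' * comp a ς B q' :=
    funext (comp_smul f ς B)
  simp only [nablaH, comp_smul, hcomp, fderiv_fun_mul hf hς, add_apply,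
    smul_apply, smul_eq_mul, Fin.sum_univ_two]
  ring

theorem nablaH_radius_sq_smul {ς : OneForm} {X : R4} (hX : X 1 = 0) {B : Fin 2}
    (hς : DifferentiableAt ℝ (comp a ς B) q) :
    nablaH a M (fun q' => q' 1 ^ 2 • ς q') q X B = q 1 ^ 2 * nablaH a M ς q X B := by
  have h : HasFDerivAt (fun q' : R4 => q' 1 ^ 2) _ q :=
    (ContinuousLinearMap.proj (R := ℝ) (φ := fun _ : Fin 4 => ℝ) 1).hasFDerivAt.pow 2
  rw [nablaH_smul h.differentiableAt hς, h.fderiv]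
  simp [hX]

theorem nablaH_Sig_smul {ς : OneForm} {X : R4} (hX : X 1 = 0) {B : Fin 2}
    (hς : DifferentiableAt ℝ (comp a ς B) q) :
    nablaH a M (fun q' => Sig a q' • ς q') q X B = Sig a q * nablaH a M ς q X B
      + X 2 * (-2 * a ^ 2 * Real.sin (q 2) * Real.cos (q 2)) * comp a ς B q := by
  rw [nablaH_smul differentiableAt_Sig hς,
    fderiv_eq_of_hasDerivAt_line differentiableAt_Sig (hasDerivAt_Sig_line a hX)]

theorem divH_Sig_smul {ς : OneForm} (hς : ∀ B, DifferentiableAt ℝ (comp a ς B) q) :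
    divH a M (fun q' => Sig a q' • ς q') q = Sig a q * divH a M ς q
      + -2 * a ^ 2 * Real.sin (q 2) * Real.cos (q 2)
        * (frame a 0 q 2 * comp a ς 0 q + frame a 1 q 2 * comp a ς 1 q) := by
  simp only [divH, Fin.sum_univ_two, nablaH_Sig_smul (frame_apply_one a _ q) (hς _)]
  ring

theorem curlH_Sig_smul {ς : OneForm} (hς : ∀ B, DifferentiableAt ℝ (comp a ς B) q) :
    curlH a M (fun q' => Sig a q' • ς q') q = Sig a q * curlH a M ς q
      + -2 * a ^ 2 * Real.sin (q 2) * Real.cos (q 2)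
        * (frame a 0 q 2 * comp a ς 1 q - frame a 1 q 2 * comp a ς 0 q) := by
  simp only [curlH, nablaH_Sig_smul (frame_apply_one a _ q) (hς _)]
  ring

theorem divH_sq_add_curlH_sq_le (ς : OneForm) :
    divH a M ς q ^ 2 + curlH a M ς q ^ 2 ≤ 2 * nablaNormSq a M ς q := by
  simp only [divH, curlH, nablaNormSq, Fin.sum_univ_two]
  generalize nablaH a M ς q (frame a 0 q) 0 = n₀₀, nablaH a M ς q (frame a 0 q) 1 = n₀₁,
    nablaH a M ς q (frame a 1 q) 0 = n₁₀, nablaH a M ς q (frame a 1 q) 1 = n₁₁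
  nlinarith only [sq_nonneg (n₀₀ - n₁₁), sq_nonneg (n₀₁ + n₁₀)]

theorem frame_apply_two_sq_add (hq : 0 < q 1) :
    frame a 0 q 2 ^ 2 + frame a 1 q 2 ^ 2 = 1 / Sig a q := by
  have h := (Sig_pos (a := a) hq).ne'
  simp only [frame_zero, frame_one, Matrix.cons_val]
  field_simp
  rw [Sig]

theorem normSq_radius_sq_smul (ς : OneForm) :
    normSq a (fun q' => q' 1 ^ 2 • ς q') q = q 1 ^ 4 * normSq a ς q := by
  simp only [normSq, comp_smul, Fin.sum_univ_two]
  ring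

theorem nablaNormSq_radius_sq_smul {ς : OneForm}
    (hς : ∀ B, DifferentiableAt ℝ (comp a ς B) q) :
    nablaNormSq a M (fun q' => q' 1 ^ 2 • ς q') q = q 1 ^ 4 * nablaNormSq a M ς q := by
  simp only [nablaNormSq, Fin.sum_univ_two, nablaH_radius_sq_smul (frame_apply_one a _ q) (hς _)]
  ring

theorem Sig_le (har : a ^ 2 ≤ q 1 ^ 2) : Sig a q ≤ 2 * q 1 ^ 2 := by
  have h : a ^ 2 * Real.cos (q 2) ^ 2 ≤ a ^ 2 :=
    mul_le_of_le_one_right (sq_nonneg a) (Real.cos_sq_le_one _)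
  rw [Sig]
  linarith

theorem sq_mul_sin_sq_le {r : ℝ} (har : a ^ 2 ≤ r ^ 2) (θ : ℝ) :
    (a ^ 2 * Real.sin θ) ^ 2 ≤ r ^ 4 := by
  calc (a ^ 2 * Real.sin θ) ^ 2 = (a ^ 2) ^ 2 * Real.sin θ ^ 2 := mul_pow _ _ _
    _ ≤ (r ^ 2) ^ 2 * 1 := by gcongr; exact Real.sin_sq_le_one _
    _ = r ^ 4 := by ring

theorem divH_sq_add_curlH_sq_Sig_smul_le_of_Sig (hq : 0 < q 1) {ς : OneForm}
    (hς : ∀ B, DifferentiableAt ℝ (comp a ς B) q) :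
    divH a M (fun q' => Sig a q' • ς q') q ^ 2 + curlH a M (fun q' => Sig a q' • ς q') q ^ 2
      ≤ 4 * Sig a q ^ 2 * nablaNormSq a M ς q
        + 2 * (a ^ 2 * Real.sin (2 * q 2)) ^ 2 / Sig a q * normSq a ς q := by
  have hdc := mul_le_mul_of_nonneg_left (divH_sq_add_curlH_sq_le (a := a) (M := M) (q := q) ς)
    (sq_nonneg (Sig a q))
  have hα : 2 * (a ^ 2 * Real.sin (2 * q 2)) ^ 2 / Sig a q * normSq a ς q
      = 2 * (a ^ 2 * Real.sin (2 * q 2)) ^ 2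
        * ((frame a 0 q 2 ^ 2 + frame a 1 q 2 ^ 2) * normSq a ς q) := by
    rw [frame_apply_two_sq_add hq]; ring
  rw [divH_Sig_smul hς, curlH_Sig_smul hς, hα, Real.sin_two_mul, normSq, Fin.sum_univ_two]
  set s := -2 * a ^ 2 * Real.sin (q 2) * Real.cos (q 2)
  set x₀ := frame a 0 q 2
  set x₁ := frame a 1 q 2
  set α₀ := comp a ς 0 q
  set α₁ := comp a ς 1 q
  linarith [add_sq_le (a := Sig a q * divH a M ς q) (b := s * (x₀ * α₀ + x₁ * α₁)),
    add_sq_le (a := Sig a q * curlH a M ς q) (b := s * (x₀ * α₁ - x₁ * α₀))]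

theorem divH_sq_add_curlH_sq_Sig_smul_le (hM : 0 < M) (har : a ^ 2 ≤ q 1 ^ 2) (hr : M ≤ q 1)
    {ς : OneForm} (hς : ∀ B, DifferentiableAt ℝ (comp a ς B) q) :
    divH a M (fun q' => Sig a q' • ς q') q ^ 2 + curlH a M (fun q' => Sig a q' • ς q') q ^ 2
      ≤ 16 * (1 + 1 / M ^ 2) * (normSq a (fun q' => q' 1 ^ 2 • ς q') q
        + nablaNormSq a M (fun q' => q' 1 ^ 2 • ς q') q) := by
  have hq : 0 < q 1 := hM.trans_le hr
  have hSig : M ^ 2 ≤ Sig a q := by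
    have : M ^ 2 ≤ q 1 ^ 2 := by gcongr
    rw [Sig]
    nlinarith only [this, sq_nonneg (a * Real.cos (q 2))]
  have hα : 0 ≤ normSq a ς q := Finset.sum_nonneg fun _ _ => sq_nonneg _
  have hn : 0 ≤ nablaNormSq a M ς q :=
    Finset.sum_nonneg fun _ _ => Finset.sum_nonneg fun _ _ => sq_nonneg _
  rw [normSq_radius_sq_smul, nablaNormSq_radius_sq_smul hς]
  calc divH a M (fun q' => Sig a q' • ς q') q ^ 2
        + curlH a M (fun q' => Sig a q' • ς q') q ^ 2
    _ ≤ 4 * Sig a q ^ 2 * nablaNormSq a M ς q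
        + 2 * (a ^ 2 * Real.sin (2 * q 2)) ^ 2 / Sig a q * normSq a ς q :=
      divH_sq_add_curlH_sq_Sig_smul_le_of_Sig hq hς
    _ ≤ 4 * (2 * q 1 ^ 2) ^ 2 * nablaNormSq a M ς q + 2 * q 1 ^ 4 / M ^ 2 * normSq a ς q := by
      gcongr
      · exact (Sig_pos hq).le
      · exact Sig_le har
      · exact sq_mul_sin_sq_le har _
    _ ≤ 16 * (1 + 1 / M ^ 2) * (q 1 ^ 4 * normSq a ς q + q 1 ^ 4 * nablaNormSq a M ς q) := by
      have h₁ : 0 ≤ q 1 ^ 4 * normSq a ς q := by positivity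
      have h₂ : 0 ≤ q 1 ^ 4 * nablaNormSq a M ς q / M ^ 2 := by positivity
      have h₃ : 0 ≤ q 1 ^ 4 * normSq a ς q / M ^ 2 := by positivity
      linear_combination 16 * h₁ + 16 * h₂ + 14 * h₃

end HorizontalConnection

/-! ## Functions of the horizon coordinates `(τ, θ, φ)` -/

/-- `∂_τ f`. -/
noncomputable def dTime (f : ℝ × ℝ × ℝ → ℝ) (x : ℝ × ℝ × ℝ) : ℝ := fderiv ℝ f x (1, 0, 0)

/-- `∂_θ f`. -/
noncomputable def dTheta (f : ℝ × ℝ × ℝ → ℝ) (x : ℝ × ℝ × ℝ) : ℝ := fderiv ℝ f x (0, 1, 0)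

/-- `∂_φ f`. -/
noncomputable def dPhi (f : ℝ × ℝ × ℝ → ℝ) (x : ℝ × ℝ × ℝ) : ℝ := fderiv ℝ f x (0, 0, 1)

/-- Continuous differentiability on `τ ≥ 0`, in the sense of a `C¹` extension to a neighbourhood,
so that the two-sided derivatives at `τ = 0` make sense. -/
def ContDiffFuture (f : ℝ × ℝ × ℝ → ℝ) : Prop := ∀ x, 0 ≤ x.1 → ContDiffAt ℝ 1 f x

theorem fderiv_eq_partials (f : ℝ × ℝ × ℝ → ℝ) (x w : ℝ × ℝ × ℝ) :
    fderiv ℝ f x w = w.1 * dTime f x + w.2.1 * dTheta f x + w.2.2 * dPhi f x := by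
  have hw : w = w.1 • ((1 : ℝ), (0 : ℝ), (0 : ℝ)) + w.2.1 • ((0 : ℝ), (1 : ℝ), (0 : ℝ))
      + w.2.2 • ((0 : ℝ), (0 : ℝ), (1 : ℝ)) := by
    ext <;> simp
  conv_lhs => rw [hw]
  simp only [map_add, map_smul, smul_eq_mul, dTime, dTheta, dPhi]

namespace ContDiffFuture

variable {f g : ℝ × ℝ × ℝ → ℝ} {x : ℝ × ℝ × ℝ}

theorem differentiableAt (hf : ContDiffFuture f) (hx : 0 ≤ x.1) : DifferentiableAt ℝ f x :=
  (hf x hx).differentiableAt one_ne_zero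

theorem continuousOn (hf : ContDiffFuture f) : ContinuousOn f {x | 0 ≤ x.1} := fun x hx =>
  (hf x hx).continuousAt.continuousWithinAt

theorem continuousOn_fderiv_apply (hf : ContDiffFuture f) (w : ℝ × ℝ × ℝ) :
    ContinuousOn (fun x => fderiv ℝ f x w) {x | 0 ≤ x.1} := fun x hx =>
  (((hf x hx).fderiv_right (m := 0) (by simp)).continuousAt.clm_apply
    continuousAt_const).continuousWithinAt

theorem continuousOn_dTime (hf : ContDiffFuture f) : ContinuousOn (dTime f) {x | 0 ≤ x.1} :=
  hf.continuousOn_fderiv_apply _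

theorem continuousOn_dTheta (hf : ContDiffFuture f) : ContinuousOn (dTheta f) {x | 0 ≤ x.1} :=
  hf.continuousOn_fderiv_apply _

theorem continuousOn_dPhi (hf : ContDiffFuture f) : ContinuousOn (dPhi f) {x | 0 ≤ x.1} :=
  hf.continuousOn_fderiv_apply _

theorem hasDerivAt_time (hf : ContDiffFuture f) {τ : ℝ} (hτ : 0 ≤ τ) (θ φ : ℝ) :
    HasDerivAt (fun t => f (t, θ, φ)) (dTime f (τ, θ, φ)) τ :=
  (hf.differentiableAt hτ).hasFDerivAt.comp_hasDerivAt τ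
    ((hasDerivAt_id τ).prodMk (hasDerivAt_const τ (θ, φ)))

theorem hasDerivAt_theta (hf : ContDiffFuture f) {τ : ℝ} (hτ : 0 ≤ τ) (θ φ : ℝ) :
    HasDerivAt (fun t => f (τ, t, φ)) (dTheta f (τ, θ, φ)) θ :=
  (hf.differentiableAt hτ).hasFDerivAt.comp_hasDerivAt θ
    ((hasDerivAt_const θ τ).prodMk ((hasDerivAt_id θ).prodMk (hasDerivAt_const θ φ)))

theorem hasDerivAt_phi (hf : ContDiffFuture f) {τ : ℝ} (hτ : 0 ≤ τ) (θ φ : ℝ) :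
    HasDerivAt (fun t => f (τ, θ, t)) (dPhi f (τ, θ, φ)) φ :=
  (hf.differentiableAt hτ).hasFDerivAt.comp_hasDerivAt φ
    ((hasDerivAt_const φ τ).prodMk ((hasDerivAt_const φ θ).prodMk (hasDerivAt_id φ)))

theorem theta_mul_add {c d : ℝ → ℝ} (hc : ContDiff ℝ 1 c) (hd : ContDiff ℝ 1 d)
    (hf : ContDiffFuture f) (hg : ContDiffFuture g) :
    ContDiffFuture fun x => c x.2.1 * f x + d x.2.1 * g x := fun x hx =>
  have hθ : ContDiffAt ℝ 1 (fun x : ℝ × ℝ × ℝ => x.2.1) x := contDiffAt_snd.fst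
  ((hc.contDiffAt.comp x hθ).mul (hf x hx)).add ((hd.contDiffAt.comp x hθ).mul (hg x hx))

theorem fderiv_theta_mul_add {c d : ℝ → ℝ} {c' d' : ℝ} (hc : HasDerivAt c c' x.2.1)
    (hd : HasDerivAt d d' x.2.1) (hf : ContDiffFuture f) (hg : ContDiffFuture g) (hx : 0 ≤ x.1)
    (w : ℝ × ℝ × ℝ) :
    fderiv ℝ (fun x => c x.2.1 * f x + d x.2.1 * g x) x w
      = c x.2.1 * fderiv ℝ f x w + d x.2.1 * fderiv ℝ g x w
        + w.2.1 * (c' * f x + d' * g x) := by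
  have hθ : HasFDerivAt (fun x : ℝ × ℝ × ℝ => x.2.1) _ x :=
    ((ContinuousLinearMap.fst ℝ ℝ ℝ).comp (ContinuousLinearMap.snd ℝ ℝ (ℝ × ℝ))).hasFDerivAt
  have h := ((hc.comp_hasFDerivAt x hθ).mul (hf.differentiableAt hx).hasFDerivAt).add
    ((hd.comp_hasFDerivAt x hθ).mul (hg.differentiableAt hx).hasFDerivAt)
  refine (congrArg (· w) h.fderiv).trans ?_
  simp only [add_apply, smul_apply, smul_eq_mul, Function.comp_apply,
    ContinuousLinearMap.comp_apply, ContinuousLinearMap.coe_fst', ContinuousLinearMap.coe_snd']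
  ring

theorem dPhi_theta_mul_add {c d : ℝ → ℝ} (hc : ContDiff ℝ 1 c) (hd : ContDiff ℝ 1 d)
    (hf : ContDiffFuture f) (hg : ContDiffFuture g) (hx : 0 ≤ x.1) :
    dPhi (fun x => c x.2.1 * f x + d x.2.1 * g x) x
      = c x.2.1 * dPhi f x + d x.2.1 * dPhi g x := by
  have h := fderiv_theta_mul_add (hc.differentiable one_ne_zero _).hasDerivAt
    (hd.differentiable one_ne_zero _).hasDerivAt hf hg hx (0, 0, 1)
  rwa [zero_mul, add_zero] at h

end ContDiffFuture

/-- Agreement off the axis, on `τ ≥ 0`, with a function that is continuous across the axis. -/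
def AxisRegular (f : ℝ × ℝ × ℝ → ℝ) : Prop :=
  ∃ g, ContinuousOn g {x | 0 ≤ x.1} ∧ ∀ x, 0 ≤ x.1 → x.2.1 ∈ Ioo 0 π → f x = g x

namespace AxisRegular

variable {f g : ℝ × ℝ × ℝ → ℝ}

theorem of_continuousOn (hf : ContinuousOn f {x | 0 ≤ x.1}) : AxisRegular f :=
  ⟨f, hf, fun _ _ _ => rfl⟩

theorem congr (hg : AxisRegular g)
    (h : ∀ x : ℝ × ℝ × ℝ, 0 ≤ x.1 → x.2.1 ∈ Ioo 0 π → f x = g x) : AxisRegular f := by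
  obtain ⟨g', hg', hgg'⟩ := hg
  exact ⟨g', hg', fun x hx hs => (h x hx hs).trans (hgg' x hx hs)⟩

theorem add (hf : AxisRegular f) (hg : AxisRegular g) : AxisRegular fun x => f x + g x := by
  obtain ⟨f', hf', hff'⟩ := hf
  obtain ⟨g', hg', hgg'⟩ := hg
  exact ⟨_, hf'.add hg', fun x hx hs => congrArg₂ _ (hff' x hx hs) (hgg' x hx hs)⟩

theorem mul (hf : AxisRegular f) (hg : AxisRegular g) : AxisRegular fun x => f x * g x := by
  obtain ⟨f', hf', hff'⟩ := hf
  obtain ⟨g', hg', hgg'⟩ := hg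
  exact ⟨_, hf'.mul hg', fun x hx hs => congrArg₂ _ (hff' x hx hs) (hgg' x hx hs)⟩

theorem theta_mul {c : ℝ → ℝ} (hc : Continuous c) (hf : AxisRegular f) :
    AxisRegular fun x => c x.2.1 * f x :=
  (of_continuousOn (hc.comp (continuous_fst.comp continuous_snd)).continuousOn).mul hf

theorem sq (hf : AxisRegular f) : AxisRegular fun x => f x ^ 2 :=
  (hf.mul hf).congr fun x _ _ => _root_.sq (f x)

end AxisRegular

theorem ContDiffFuture.axisRegular {f : ℝ × ℝ × ℝ → ℝ} (hf : ContDiffFuture f) : AxisRegular f :=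
  .of_continuousOn hf.continuousOn

theorem ContDiffFuture.axisRegular_dTime {f : ℝ × ℝ × ℝ → ℝ} (hf : ContDiffFuture f) :
    AxisRegular (dTime f) :=
  .of_continuousOn hf.continuousOn_dTime

theorem ContDiffFuture.axisRegular_dTheta {f : ℝ × ℝ × ℝ → ℝ} (hf : ContDiffFuture f) :
    AxisRegular (dTheta f) :=
  .of_continuousOn hf.continuousOn_dTheta

theorem ContDiffFuture.axisRegular_dPhi {f : ℝ × ℝ × ℝ → ℝ} (hf : ContDiffFuture f) :
    AxisRegular (dPhi f) :=
  .of_continuousOn hf.continuousOn_dPhi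

/-! ## The horizon in the global chart -/

/-- Kerr coordinates of the point `(τ, θ, φ)` of the cylinder of radius `r`, with `k` the value of
the height function there. -/
def cylinder (k r : ℝ) (x : ℝ × ℝ × ℝ) : R4 := ![x.1 + k, r, x.2.1, x.2.2]

/-- `∂_t`, in the global chart. -/
def chartTime : R4 := ![1, 0, 0, 0]

/-- `∂_θ`, in the global chart. -/
noncomputable def chartTheta (q : R4) : R4 :=
  ![0, q 1 * Real.cos (q 2) * Real.cos (q 3), q 1 * Real.cos (q 2) * Real.sin (q 3),
    -(q 1 * Real.sin (q 2))]

/-- `(sin θ)⁻¹ ∂_φ`, in the global chart. -/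
noncomputable def chartPhi (q : R4) : R4 :=
  ![0, -(q 1 * Real.sin (q 3)), q 1 * Real.cos (q 3), 0]

/-- `r ∂_r`, in the global chart. -/
noncomputable def chartRadial (q : R4) : R4 :=
  ![0, q 1 * Real.sin (q 2) * Real.cos (q 3), q 1 * Real.sin (q 2) * Real.sin (q 3),
    q 1 * Real.cos (q 2)]

theorem contDiff_chart : ContDiff ℝ ∞ chart := by
  refine contDiff_pi.2 fun i => ?_
  fin_cases i <;>
    simp only [chart, Fin.zero_eta, Fin.mk_one, Fin.reduceFinMk, Matrix.cons_val] <;> fun_prop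

theorem contDiff_chartTheta : ContDiff ℝ ∞ chartTheta := by
  refine contDiff_pi.2 fun i => ?_
  fin_cases i <;>
    simp only [chartTheta, Fin.zero_eta, Fin.mk_one, Fin.reduceFinMk, Matrix.cons_val] <;> fun_prop

theorem contDiff_chartPhi : ContDiff ℝ ∞ chartPhi := by
  refine contDiff_pi.2 fun i => ?_
  fin_cases i <;>
    simp only [chartPhi, Fin.zero_eta, Fin.mk_one, Fin.reduceFinMk, Matrix.cons_val] <;> fun_prop

theorem contDiff_chartRadial : ContDiff ℝ ∞ chartRadial := by
  refine contDiff_pi.2 fun i => ?_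
  fin_cases i <;>
    simp only [chartRadial, Fin.zero_eta, Fin.mk_one, Fin.reduceFinMk, Matrix.cons_val] <;> fun_prop

theorem contDiff_cylinder (k r : ℝ) : ContDiff ℝ ∞ (cylinder k r) := by
  refine contDiff_pi.2 fun i => ?_
  fin_cases i <;>
    simp only [cylinder, Fin.zero_eta, Fin.mk_one, Fin.reduceFinMk, Matrix.cons_val] <;> fun_prop

theorem fderiv_cylinder (k r : ℝ) (x w : ℝ × ℝ × ℝ) :
    fderiv ℝ (cylinder k r) x w = ![w.1, 0, w.2.1, w.2.2] := by
  have h : HasFDerivAt (cylinder k r)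
      (ContinuousLinearMap.pi ![ContinuousLinearMap.fst ℝ ℝ (ℝ × ℝ), 0,
        (ContinuousLinearMap.fst ℝ ℝ ℝ).comp (ContinuousLinearMap.snd ℝ ℝ (ℝ × ℝ)),
        (ContinuousLinearMap.snd ℝ ℝ ℝ).comp (ContinuousLinearMap.snd ℝ ℝ (ℝ × ℝ))]) x := by
    refine hasFDerivAt_pi.2 fun i => ?_
    fin_cases i
    · exact hasFDerivAt_fst.add_const k
    · exact hasFDerivAt_const r x
    · exact hasFDerivAt_snd.fst
    · exact hasFDerivAt_snd.snd
  rw [h.fderiv]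
  ext i
  fin_cases i <;> rfl

theorem fderiv_comp_cylinder {E : Type*} [NormedAddCommGroup E] [NormedSpace ℝ E] {F : R4 → E}
    {k r : ℝ} {x : ℝ × ℝ × ℝ} (hF : DifferentiableAt ℝ F (cylinder k r x)) {X : R4}
    (hX : X 1 = 0) :
    fderiv ℝ F (cylinder k r x) X = fderiv ℝ (F ∘ cylinder k r) x (X 0, X 2, X 3) := by
  rw [fderiv_comp x hF ((contDiff_cylinder k r).contDiffAt.differentiableAt (by simp)),
    ContinuousLinearMap.comp_apply, fderiv_cylinder]
  congr 1
  ext i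
  fin_cases i <;> simp [hX]

theorem fderiv_chart {q X : R4} (hX : X 1 = 0) :
    fderiv ℝ chart q X
      = X 0 • chartTime + X 2 • chartTheta q + (X 3 * Real.sin (q 2)) • chartPhi q := by
  refine fderiv_eq_of_hasDerivAt_line (contDiff_chart.contDiffAt.differentiableAt (by simp)) ?_
  have h := hasDerivAt_line_apply q X
  refine hasDerivAt_pi.2 fun i => ?_
  fin_cases i
  · exact (h 0).congr_deriv (by simp [chartTime, chartTheta, chartPhi])
  · refine (((h 1).mul (h 2).sin).mul (h 3).cos).congr_deriv ?_
    simp only [chartTime, chartTheta, chartPhi, hX, zero_mul, add_zero, Pi.add_apply,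
      Pi.smul_apply, Pi.mul_apply, smul_eq_mul, Fin.mk_one, Matrix.cons_val]
    ring
  · refine (((h 1).mul (h 2).sin).mul (h 3).sin).congr_deriv ?_
    simp only [chartTime, chartTheta, chartPhi, hX, zero_mul, add_zero, Pi.add_apply,
      Pi.smul_apply, Pi.mul_apply, smul_eq_mul, Fin.reduceFinMk, Matrix.cons_val]
    ring
  · refine ((h 1).mul (h 2).cos).congr_deriv ?_
    simp only [chartTime, chartTheta, chartPhi, hX, zero_mul, add_zero, Pi.add_apply,
      Pi.smul_apply, smul_eq_mul, Fin.reduceFinMk, Matrix.cons_val]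
    ring

/-! ## Covector fields along the horizon -/

/-- `a sin θ ∂_t + (sin θ)⁻¹ ∂_φ`, in the global chart. -/
noncomputable def chartAxial (a : ℝ) (q : R4) : R4 :=
  ![a * Real.sin (q 2), -(q 1 * Real.sin (q 3)), q 1 * Real.cos (q 3), 0]

theorem chartAxial_eq (a : ℝ) (q : R4) :
    chartAxial a q = (a * Real.sin (q 2)) • chartTime + chartPhi q := by
  ext i
  fin_cases i <;> simp [chartAxial, chartTime, chartPhi]

/-- The component `ς(∂_θ)` on the cylinder. -/
noncomputable def thetaComp (k r : ℝ) (ς : OneForm) (x : ℝ × ℝ × ℝ) : ℝ :=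
  ς (chart (cylinder k r x)) (chartTheta (cylinder k r x))

/-- The component `ς(a sin θ ∂_t + (sin θ)⁻¹ ∂_φ)` on the cylinder. -/
noncomputable def axialComp (a k r : ℝ) (ς : OneForm) (x : ℝ × ℝ × ℝ) : ℝ :=
  ς (chart (cylinder k r x)) (chartAxial a (cylinder k r x))

/-- The behaviour at the axis of the components `u = ς(∂_θ)`, `v = ς(a sin θ ∂_t + (sin θ)⁻¹ ∂_φ)`
of a covector: they are continuous, but their `φ`-derivatives are divisible by `sin θ` only after
subtracting the rotation of the frame. -/
structure IsPolarPair (u v : ℝ × ℝ × ℝ → ℝ) : Prop where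
  contDiffFuture_fst : ContDiffFuture u
  contDiffFuture_snd : ContDiffFuture v
  axisRegular_fst : AxisRegular fun x => (dPhi u x - Real.cos x.2.1 * v x) / Real.sin x.2.1
  axisRegular_snd : AxisRegular fun x => (dPhi v x + Real.cos x.2.1 * u x) / Real.sin x.2.1

theorem contDiff_chartAxial (a : ℝ) : ContDiff ℝ ∞ (chartAxial a) := by
  refine contDiff_pi.2 fun i => ?_
  fin_cases i <;>
    simp only [chartAxial, Fin.zero_eta, Fin.mk_one, Fin.reduceFinMk, Matrix.cons_val] <;> fun_prop

theorem fderiv_chartTheta_phi (q : R4) :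
    fderiv ℝ chartTheta q ![0, 0, 0, 1] = Real.cos (q 2) • chartPhi q := by
  refine fderiv_eq_of_hasDerivAt_line (contDiff_chartTheta.contDiffAt.differentiableAt (by simp))
    (hasDerivAt_pi.2 fun i => ?_)
  have h := hasDerivAt_line_apply q ![0, 0, 0, 1]
  fin_cases i
  · exact (hasDerivAt_const _ _).congr_deriv (by simp [chartPhi])
  · refine (((h 1).mul (h 2).cos).mul (h 3).cos).congr_deriv ?_
    simp only [chartPhi, zero_smul, add_zero, Pi.smul_apply, Pi.mul_apply, smul_eq_mul, Fin.mk_one,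
      Matrix.cons_val]
    ring
  · refine (((h 1).mul (h 2).cos).mul (h 3).sin).congr_deriv ?_
    simp only [chartPhi, zero_smul, add_zero, Pi.smul_apply, Pi.mul_apply, smul_eq_mul,
      Fin.reduceFinMk, Matrix.cons_val]
    ring
  · refine ((h 1).mul (h 2).sin).neg.congr_deriv ?_
    simp [chartPhi]

theorem fderiv_chartAxial_phi (a : ℝ) (q : R4) :
    fderiv ℝ (chartAxial a) q ![0, 0, 0, 1]
      = -(Real.cos (q 2) • chartTheta q) - Real.sin (q 2) • chartRadial q := by
  refine fderiv_eq_of_hasDerivAt_line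
    ((contDiff_chartAxial a).contDiffAt.differentiableAt (by simp)) (hasDerivAt_pi.2 fun i => ?_)
  have h := hasDerivAt_line_apply q ![0, 0, 0, 1]
  have hsc := Real.sin_sq_add_cos_sq (q 2)
  fin_cases i
  · refine ((h 2).sin.const_mul a).congr_deriv ?_
    simp [chartTheta, chartRadial]
  · refine ((h 1).mul (h 3).sin).neg.congr_deriv ?_
    simp only [chartTheta, chartRadial, zero_smul, add_zero, Pi.sub_apply, Pi.neg_apply,
      Pi.smul_apply, smul_eq_mul, Fin.mk_one, Matrix.cons_val]
    linear_combination (q 1 * Real.cos (q 3)) * hsc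
  · refine ((h 1).mul (h 3).cos).congr_deriv ?_
    simp only [chartTheta, chartRadial, zero_smul, add_zero, Pi.sub_apply, Pi.neg_apply,
      Pi.smul_apply, smul_eq_mul, Fin.reduceFinMk, Matrix.cons_val]
    linear_combination (q 1 * Real.sin (q 3)) * hsc
  · refine (hasDerivAt_const _ _).congr_deriv ?_
    simp only [chartTheta, chartRadial, Pi.sub_apply, Pi.neg_apply, Pi.smul_apply, smul_eq_mul,
      Fin.reduceFinMk, Matrix.cons_val]
    ring

section Covector

variable {a k r : ℝ} {ς : OneForm}

theorem contDiffFuture_apply {V : R4 → R4} (hV : ContDiff ℝ ∞ V)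
    (hς : ∀ x, 0 ≤ x.1 → ContDiffAt ℝ ∞ ς (chart (cylinder k r x))) :
    ContDiffFuture fun x => ς (chart (cylinder k r x)) (V (cylinder k r x)) := fun x hx =>
  have h := contDiff_cylinder k r
  (((hς x hx).comp x (contDiff_chart.comp h).contDiffAt).clm_apply
    (hV.comp h).contDiffAt).of_le (by simp)

theorem continuousOn_fderiv_apply_apply {V W : R4 → R4} (hV : Continuous V) (hW : Continuous W)
    (hς : ∀ x, 0 ≤ x.1 → ContDiffAt ℝ ∞ ς (chart (cylinder k r x))) :
    ContinuousOn (fun x => fderiv ℝ ς (chart (cylinder k r x)) (V (cylinder k r x))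
      (W (cylinder k r x))) {x | 0 ≤ x.1} := fun x hx => by
  have hc := (contDiff_cylinder k r).continuous
  have hD : ContinuousAt (fderiv ℝ ς) (chart (cylinder k r x)) :=
    ((hς x hx).fderiv_right (m := 0) (by simp)).continuousAt
  exact (((hD.comp (f := fun x => chart (cylinder k r x))
    (contDiff_chart.continuous.comp hc).continuousAt).clm_apply
    (hV.comp hc).continuousAt).clm_apply (hW.comp hc).continuousAt).continuousWithinAt

theorem dPhi_apply {V : R4 → R4} (hV : ContDiff ℝ ∞ V) {x : ℝ × ℝ × ℝ}
    (hς : DifferentiableAt ℝ ς (chart (cylinder k r x))) :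
    dPhi (fun x => ς (chart (cylinder k r x)) (V (cylinder k r x))) x
      = Real.sin x.2.1 * fderiv ℝ ς (chart (cylinder k r x)) (chartPhi (cylinder k r x))
          (V (cylinder k r x))
        + ς (chart (cylinder k r x)) (fderiv ℝ V (cylinder k r x) ![0, 0, 0, 1]) := by
  set q := cylinder k r x
  have hchart : DifferentiableAt ℝ chart q := contDiff_chart.contDiffAt.differentiableAt (by simp)
  have hVq : DifferentiableAt ℝ V q := hV.contDiffAt.differentiableAt (by simp)
  have hcomp : DifferentiableAt ℝ (ς ∘ chart) q := hς.comp q hchart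
  have h := fderiv_comp_cylinder (F := fun q => (ς ∘ chart) q (V q)) (hcomp.clm_apply hVq)
    (X := ![0, 0, 0, 1]) rfl
  rw [fderiv_clm_apply hcomp hVq, fderiv_comp q hς hchart] at h
  have hθ : Real.sin (q 2) = Real.sin x.2.1 := rfl
  rw [dPhi]
  refine h.symm.trans ((add_comm _ _).trans ?_)
  simp [fderiv_chart (show (![0, 0, 0, 1] : R4) 1 = 0 from rfl), hθ]

theorem isPolarPair_comps (a : ℝ)
    (hς : ∀ x, 0 ≤ x.1 → ContDiffAt ℝ ∞ ς (chart (cylinder k r x))) :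
    IsPolarPair (thetaComp k r ς) (axialComp a k r ς) where
  contDiffFuture_fst := contDiffFuture_apply contDiff_chartTheta hς
  contDiffFuture_snd := contDiffFuture_apply (contDiff_chartAxial a) hς
  axisRegular_fst := by
    have hT := (contDiffFuture_apply (contDiff_const (c := chartTime)) hς).continuousOn
    refine ⟨_, (continuousOn_fderiv_apply_apply contDiff_chartPhi.continuous
      contDiff_chartTheta.continuous hς).sub ((by fun_prop :
        Continuous fun x : ℝ × ℝ × ℝ => a * Real.cos x.2.1).continuousOn.mul hT),
      fun x hx hθ => ?_⟩
    have hs := (Real.sin_pos_of_mem_Ioo hθ).ne'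
    have hq : cylinder k r x 2 = x.2.1 := rfl
    have hu : dPhi (thetaComp k r ς) x = _ :=
      dPhi_apply contDiff_chartTheta ((hς x hx).differentiableAt (by simp))
    simp only [fderiv_chartTheta_phi, map_smul, smul_eq_mul] at hu
    refine (div_eq_iff hs).2 ?_
    simp only [hu, axialComp, chartAxial_eq, map_add, map_smul, smul_eq_mul, hq, Pi.sub_apply,
      Pi.mul_apply]
    ring
  axisRegular_snd := by
    have hR := (contDiffFuture_apply contDiff_chartRadial hς).continuousOn
    refine ⟨_, (continuousOn_fderiv_apply_apply contDiff_chartPhi.continuous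
      (contDiff_chartAxial a).continuous hς).sub hR, fun x hx hθ => ?_⟩
    have hs := (Real.sin_pos_of_mem_Ioo hθ).ne'
    have hq : cylinder k r x 2 = x.2.1 := rfl
    have hv : dPhi (axialComp a k r ς) x = _ :=
      dPhi_apply (contDiff_chartAxial a) ((hς x hx).differentiableAt (by simp))
    simp only [fderiv_chartAxial_phi, map_sub, map_neg, map_smul, smul_eq_mul] at hv
    refine (div_eq_iff hs).2 ?_
    simp only [hv, thetaComp, hq, Pi.sub_apply]
    ring

end Covector

/-! ## The horizontal connection along the horizon -/

/-- `Σ` on the sphere of radius `r`. -/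
noncomputable def horizonSig (a r θ : ℝ) : ℝ := r ^ 2 + a ^ 2 * Real.cos θ ^ 2

/-- The coefficients of `e_A` with respect to `∂_θ`; those with respect to
`a sin θ ∂_t + (sin θ)⁻¹ ∂_φ` are `frameAxial`. -/
noncomputable def frameTheta (a r θ : ℝ) : Fin 2 → ℝ :=
  ![r / horizonSig a r θ, -(a * Real.cos θ / horizonSig a r θ)]

/-- The coefficients of `e_A` with respect to `a sin θ ∂_t + (sin θ)⁻¹ ∂_φ`. -/
noncomputable def frameAxial (a r θ : ℝ) : Fin 2 → ℝ :=
  ![a * Real.cos θ / horizonSig a r θ, r / horizonSig a r θ]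

/-- The components `ς(e_A)` on the cylinder, continued across the axis. -/
noncomputable def frameComp (a k r : ℝ) (ς : OneForm) (A : Fin 2) (x : ℝ × ℝ × ℝ) : ℝ :=
  frameTheta a r x.2.1 A * thetaComp k r ς x + frameAxial a r x.2.1 A * axialComp a k r ς x

theorem cylinder_apply_one (k r : ℝ) (x : ℝ × ℝ × ℝ) : cylinder k r x 1 = r := rfl

theorem cylinder_apply_two (k r : ℝ) (x : ℝ × ℝ × ℝ) : cylinder k r x 2 = x.2.1 := rfl

theorem Sig_cylinder (a k r : ℝ) (x : ℝ × ℝ × ℝ) :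
    Sig a (cylinder k r x) = horizonSig a r x.2.1 := rfl

theorem horizonSig_pos {a r : ℝ} (hr : 0 < r) (θ : ℝ) : 0 < horizonSig a r θ := by
  unfold horizonSig
  positivity

theorem contDiff_frameTheta {a r : ℝ} (hr : 0 < r) (A : Fin 2) :
    ContDiff ℝ 1 fun θ => frameTheta a r θ A := by
  have hS : ContDiff ℝ 1 (horizonSig a r) := by unfold horizonSig; fun_prop
  have hS0 (θ : ℝ) : horizonSig a r θ ≠ 0 := (horizonSig_pos hr θ).ne'
  fin_cases A
  · exact contDiff_const.div hS hS0
  · exact (ContDiff.div (by fun_prop) hS hS0).neg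

theorem contDiff_frameAxial {a r : ℝ} (hr : 0 < r) (A : Fin 2) :
    ContDiff ℝ 1 fun θ => frameAxial a r θ A := by
  have hS : ContDiff ℝ 1 (horizonSig a r) := by unfold horizonSig; fun_prop
  have hS0 (θ : ℝ) : horizonSig a r θ ≠ 0 := (horizonSig_pos hr θ).ne'
  fin_cases A
  · exact ContDiff.div (by fun_prop) hS hS0
  · exact contDiff_const.div hS hS0

/-- Rotations and dilations depending only on `θ` commute with `∂_φ`. -/
theorem IsPolarPair.rotate {u v : ℝ × ℝ × ℝ → ℝ} {f g : ℝ → ℝ} (h : IsPolarPair u v)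
    (hf : ContDiff ℝ 1 f) (hg : ContDiff ℝ 1 g) :
    IsPolarPair (fun x => f x.2.1 * u x + g x.2.1 * v x)
      (fun x => -g x.2.1 * u x + f x.2.1 * v x) where
  contDiffFuture_fst := h.contDiffFuture_fst.theta_mul_add hf hg h.contDiffFuture_snd
  contDiffFuture_snd := h.contDiffFuture_fst.theta_mul_add hg.neg hf h.contDiffFuture_snd
  axisRegular_fst := by
    refine ((h.axisRegular_fst.theta_mul hf.continuous).add
      (h.axisRegular_snd.theta_mul hg.continuous)).congr fun x hx _ => ?_
    rw [ContDiffFuture.dPhi_theta_mul_add hf hg h.contDiffFuture_fst h.contDiffFuture_snd hx]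
    ring
  axisRegular_snd := by
    refine ((h.axisRegular_fst.theta_mul hg.neg.continuous).add
      (h.axisRegular_snd.theta_mul hf.continuous)).congr fun x hx _ => ?_
    rw [ContDiffFuture.dPhi_theta_mul_add hg.neg hf h.contDiffFuture_fst h.contDiffFuture_snd hx]
    ring

section FrameComp

variable {a M k r : ℝ} {ς : OneForm} {x : ℝ × ℝ × ℝ}

theorem isPolarPair_frameComp (hr : 0 < r)
    (hς : ∀ x, 0 ≤ x.1 → ContDiffAt ℝ ∞ ς (chart (cylinder k r x))) :
    IsPolarPair (frameComp a k r ς 0) (frameComp a k r ς 1) :=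
  (isPolarPair_comps a hς).rotate (contDiff_frameTheta hr 0) (contDiff_frameAxial hr 0)

theorem contDiffFuture_frameComp (hr : 0 < r)
    (hς : ∀ x, 0 ≤ x.1 → ContDiffAt ℝ ∞ ς (chart (cylinder k r x))) :
    ∀ A, ContDiffFuture (frameComp a k r ς A)
  | 0 => (isPolarPair_frameComp hr hς).contDiffFuture_fst
  | 1 => (isPolarPair_frameComp hr hς).contDiffFuture_snd

theorem frame_cylinder_zero (A : Fin 2) :
    frame a A (cylinder k r x) 0 = frameAxial a r x.2.1 A * (a * Real.sin x.2.1) := by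
  match A with
  | 0 =>
    rw [frame_zero, frameAxial, Sig_cylinder, cylinder_apply_two]
    simp only [Matrix.cons_val]; ring
  | 1 =>
    rw [frame_one, frameAxial, Sig_cylinder, cylinder_apply_one, cylinder_apply_two]
    simp only [Matrix.cons_val]; ring

theorem frame_cylinder_two (A : Fin 2) :
    frame a A (cylinder k r x) 2 = frameTheta a r x.2.1 A := by
  match A with
  | 0 => rw [frame_zero]; rfl
  | 1 => rw [frame_one]; exact neg_div _ _

theorem frame_cylinder_three (A : Fin 2) :
    frame a A (cylinder k r x) 3 = frameAxial a r x.2.1 A / Real.sin x.2.1 := by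
  match A with
  | 0 => rw [frame_zero]; exact (div_div _ _ _).symm
  | 1 => rw [frame_one]; exact (div_div _ _ _).symm

theorem comp_pullback_cylinder (ς : OneForm) (A : Fin 2) (hs : Real.sin x.2.1 ≠ 0) :
    comp a (pullback ς) A (cylinder k r x) = frameComp a k r ς A x := by
  rw [comp, pullback, ContinuousLinearMap.comp_apply, fderiv_chart (frame_apply_one a A _),
    frame_cylinder_zero, frame_cylinder_two, frame_cylinder_three, cylinder_apply_two,
    div_mul_cancel₀ _ hs, frameComp, thetaComp, axialComp, chartAxial_eq, cylinder_apply_two]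
  simp only [map_add, map_smul, smul_eq_mul]
  ring

theorem differentiableAt_comp_pullback {q : R4} (hq : 0 < q 1) (hs : Real.sin (q 2) ≠ 0)
    (hς : DifferentiableAt ℝ ς (chart q)) (A : Fin 2) :
    DifferentiableAt ℝ (comp a (pullback ς) A) q := by
  have hchart : DifferentiableAt ℝ chart q := contDiff_chart.contDiffAt.differentiableAt (by simp)
  have hchart' : DifferentiableAt ℝ (fderiv ℝ chart) q :=
    (contDiff_infty_iff_fderiv.1 contDiff_chart).2.contDiffAt.differentiableAt (by simp)
  exact (hς.comp q hchart).clm_apply (hchart'.clm_apply (differentiableAt_frame hq hs A))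

theorem fderiv_comp_pullback (hr : 0 < r) (hs : Real.sin x.2.1 ≠ 0)
    (hς : DifferentiableAt ℝ ς (chart (cylinder k r x))) (A : Fin 2) {X : R4} (hX : X 1 = 0) :
    fderiv ℝ (comp a (pullback ς) A) (cylinder k r x) X
      = X 0 * dTime (frameComp a k r ς A) x + X 2 * dTheta (frameComp a k r ς A) x
        + X 3 * dPhi (frameComp a k r ς A) x := by
  have hev : comp a (pullback ς) A ∘ cylinder k r =ᶠ[𝓝 x] frameComp a k r ς A := by
    have hsin : Continuous fun x : ℝ × ℝ × ℝ => Real.sin x.2.1 := by fun_prop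
    exact (hsin.continuousAt.eventually_ne hs).mono fun y hy => comp_pullback_cylinder ς A hy
  have hd := differentiableAt_comp_pullback (a := a) (q := cylinder k r x) hr hs hς A
  rw [fderiv_comp_cylinder hd hX, hev.fderiv_eq, fderiv_eq_partials]

/-- `frameAxial A · cot θ - g(∇_A e₁, e₂)`, divided by `sin θ`. -/
noncomputable def axisDefect (a r θ : ℝ) : Fin 2 → ℝ :=
  ![a * (r ^ 2 - a ^ 2 * Real.cos θ ^ 2) / horizonSig a r θ ^ 2,
    -(2 * a ^ 2 * r * Real.cos θ / horizonSig a r θ ^ 2)]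

theorem continuous_axisDefect (hr : 0 < r) (A : Fin 2) :
    Continuous fun θ => axisDefect a r θ A := by
  have hS : Continuous fun θ => horizonSig a r θ ^ 2 := by unfold horizonSig; fun_prop
  have hS0 (θ : ℝ) : horizonSig a r θ ^ 2 ≠ 0 := (pow_pos (horizonSig_pos hr θ) 2).ne'
  fin_cases A
  · exact Continuous.div (by fun_prop) hS hS0
  · exact (Continuous.div (by fun_prop) hS hS0).neg

theorem connCoeff_cylinder (hr : 0 < r) (hs : Real.sin x.2.1 ≠ 0) (A : Fin 2) :
    connCoeff a A (cylinder k r x) = frameAxial a r x.2.1 A * Real.cos x.2.1 / Real.sin x.2.1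
      - Real.sin x.2.1 * axisDefect a r x.2.1 A := by
  have hS := (horizonSig_pos (a := a) hr x.2.1).ne'
  have hsc := Real.sin_sq x.2.1
  rw [connCoeff, Sig_cylinder, cylinder_apply_one, cylinder_apply_two]
  match A with
  | 0 =>
    simp only [↓reduceIte, frameAxial, axisDefect, Matrix.cons_val]
    field_simp
    rw [horizonSig, hsc]
    ring
  | 1 =>
    simp only [one_ne_zero, ↓reduceIte, frameAxial, axisDefect, Matrix.cons_val]
    field_simp
    rw [horizonSig, hsc]
    ring

theorem nablaH_frame_zero (ha : |a| ≤ M) (hr : 0 < r) (hs : Real.sin x.2.1 ≠ 0)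
    (hς : DifferentiableAt ℝ ς (chart (cylinder k r x))) (A : Fin 2) :
    nablaH a M (pullback ς) (cylinder k r x) (frame a A (cylinder k r x)) 0
      = frameTheta a r x.2.1 A * dTheta (frameComp a k r ς 0) x
        + frameAxial a r x.2.1 A * (a * Real.sin x.2.1 * dTime (frameComp a k r ς 0) x)
        + frameAxial a r x.2.1 A * ((dPhi (frameComp a k r ς 0) x
            - Real.cos x.2.1 * frameComp a k r ς 1 x) / Real.sin x.2.1)
        + Real.sin x.2.1 * axisDefect a r x.2.1 A * frameComp a k r ς 1 x := by
  have hq : 0 < cylinder k r x 1 := hr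
  rw [nablaH_zero ha hq hs, leviCivita_frame ha hq hs, fderiv_comp_pullback hr hs hς 0
    (frame_apply_one a A _), comp_pullback_cylinder ς 1 hs, connCoeff_cylinder hr hs,
    frame_cylinder_zero, frame_cylinder_two, frame_cylinder_three]
  field_simp
  ring

theorem nablaH_frame_one (ha : |a| ≤ M) (hr : 0 < r) (hs : Real.sin x.2.1 ≠ 0)
    (hς : DifferentiableAt ℝ ς (chart (cylinder k r x))) (A : Fin 2) :
    nablaH a M (pullback ς) (cylinder k r x) (frame a A (cylinder k r x)) 1
      = frameTheta a r x.2.1 A * dTheta (frameComp a k r ς 1) x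
        + frameAxial a r x.2.1 A * (a * Real.sin x.2.1 * dTime (frameComp a k r ς 1) x)
        + frameAxial a r x.2.1 A * ((dPhi (frameComp a k r ς 1) x
            + Real.cos x.2.1 * frameComp a k r ς 0 x) / Real.sin x.2.1)
        - Real.sin x.2.1 * axisDefect a r x.2.1 A * frameComp a k r ς 0 x := by
  have hq : 0 < cylinder k r x 1 := hr
  rw [nablaH_one ha hq hs, leviCivita_frame ha hq hs, fderiv_comp_pullback hr hs hς 1
    (frame_apply_one a A _), comp_pullback_cylinder ς 0 hs, connCoeff_cylinder hr hs,
    frame_cylinder_zero, frame_cylinder_two, frame_cylinder_three]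
  field_simp
  ring

theorem axisRegular_nablaH_frame (ha : |a| ≤ M) (hr : 0 < r)
    (hς : ∀ x, 0 ≤ x.1 → ContDiffAt ℝ ∞ ς (chart (cylinder k r x))) (A B : Fin 2) :
    AxisRegular fun x =>
      nablaH a M (pullback ς) (cylinder k r x) (frame a A (cylinder k r x)) B := by
  have hd := contDiffFuture_frameComp (a := a) hr hς
  have hXY := isPolarPair_frameComp (a := a) hr hς
  have hX := (contDiff_frameTheta (a := a) hr A).continuous
  have hY := (contDiff_frameAxial (a := a) hr A).continuous
  have hYt : Continuous fun θ => frameAxial a r θ A * (a * Real.sin θ) := hY.mul (by fun_prop)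
  have hμ : Continuous fun θ => Real.sin θ * axisDefect a r θ A :=
    Real.continuous_sin.mul (continuous_axisDefect hr A)
  match B with
  | 0 =>
    refine (((((hd 0).axisRegular_dTheta.theta_mul hX).add
      ((hd 0).axisRegular_dTime.theta_mul hYt)).add (hXY.axisRegular_fst.theta_mul hY)).add
      ((hd 1).axisRegular.theta_mul hμ)).congr fun x hx hθ => ?_
    rw [nablaH_frame_zero ha hr (Real.sin_pos_of_mem_Ioo hθ).ne'
      ((hς x hx).differentiableAt (by simp))]
    ring
  | 1 =>
    refine (((((hd 1).axisRegular_dTheta.theta_mul hX).add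
      ((hd 1).axisRegular_dTime.theta_mul hYt)).add (hXY.axisRegular_snd.theta_mul hY)).add
      ((hd 0).axisRegular.theta_mul hμ.neg)).congr fun x hx hθ => ?_
    rw [nablaH_frame_one ha hr (Real.sin_pos_of_mem_Ioo hθ).ne'
      ((hς x hx).differentiableAt (by simp)), Pi.neg_apply]
    ring

theorem axisRegular_nablaH_e4 (ha : |a| ≤ M) (hr : 0 < rPlus a M)
    (hς : ∀ x, 0 ≤ x.1 → ContDiffAt ℝ ∞ ς (chart (cylinder k (rPlus a M) x))) (B : Fin 2) :
    AxisRegular fun x => nablaH a M (pullback ς) (cylinder k (rPlus a M) x)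
      (e4 a M (cylinder k (rPlus a M) x)) B := by
  set r := rPlus a M with hr'
  have hd := contDiffFuture_frameComp (a := a) hr hς B
  have hS (θ : ℝ) : horizonSig a r θ ≠ 0 := (horizonSig_pos hr θ).ne'
  have hSc : Continuous (horizonSig a r) := by unfold horizonSig; fun_prop
  refine ((hd.axisRegular_dTime.theta_mul ((continuous_const (y := 2 * (r ^ 2 + a ^ 2))).div hSc
    hS)).add (hd.axisRegular_dPhi.theta_mul ((continuous_const (y := 2 * a)).div hSc hS))).congr
    fun x hx hθ => ?_
  have hs := (Real.sin_pos_of_mem_Ioo hθ).ne'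
  have hq : 0 < cylinder k r x 1 := hr
  have hX := e4_apply_one_of_horizon (q := cylinder k r x) hr'
  have hΓ : leviCivita a M (cylinder k r x) (e4 a M (cylinder k r x)) (frame a 0)
      (frame a 1 (cylinder k r x)) = 0 :=
    leviCivita_e4_frame_of_horizon ha hq hr' hs
  have hn : nablaH a M (pullback ς) (cylinder k r x) (e4 a M (cylinder k r x)) B
      = fderiv ℝ (comp a (pullback ς) B) (cylinder k r x) (e4 a M (cylinder k r x)) := by
    match B with
    | 0 => rw [nablaH_zero ha hq hs, hΓ, zero_mul, sub_zero]
    | 1 => rw [nablaH_one ha hq hs, hΓ, zero_mul, add_zero]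
  rw [hn, fderiv_comp_pullback hr hs ((hς x hx).differentiableAt (by simp)) B hX]
  have h₂ : e4 a M (cylinder k r x) 2 = 0 := rfl
  rw [h₂, zero_mul, add_zero]
  rfl

end FrameComp

/-- The integrand of the horizon flux. -/
noncomputable def fluxDensity (a M : ℝ) (ς : OneForm) (q : R4) : ℝ :=
  normSq a ς q + nablaNormSq a M ς q + nabla4NormSq a M ς q

section FluxDensity

variable {a M k : ℝ} {ς : OneForm}

theorem normSq_add_nablaNormSq_le_fluxDensity (ς : OneForm) (q : R4) :
    normSq a ς q + nablaNormSq a M ς q ≤ fluxDensity a M ς q :=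
  le_add_of_nonneg_right (Finset.sum_nonneg fun _ _ => sq_nonneg _)

theorem axisRegular_fluxDensity (ha : |a| ≤ M) (hr : 0 < rPlus a M)
    (hς : ∀ x, 0 ≤ x.1 → ContDiffAt ℝ ∞ ς (chart (cylinder k (rPlus a M) x))) :
    AxisRegular fun x => fluxDensity a M (fun q => q 1 ^ 2 • pullback ς q)
      (cylinder k (rPlus a M) x) := by
  have hA (B : Fin 2) : AxisRegular fun x => frameComp a k (rPlus a M) ς B x ^ 2 :=
    (contDiffFuture_frameComp hr hς B).axisRegular.sq
  have hN (A B : Fin 2) := (axisRegular_nablaH_frame ha hr hς A B).sq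
  have h4 (B : Fin 2) := (axisRegular_nablaH_e4 ha hr hς B).sq
  refine (((((hA 0).add (hA 1)).add (((hN 0 0).add (hN 0 1)).add ((hN 1 0).add (hN 1 1)))).add
    ((h4 0).add (h4 1))).theta_mul
      (continuous_const (y := rPlus a M ^ 4))).congr fun x hx hθ => ?_
  have hs := (Real.sin_pos_of_mem_Ioo hθ).ne'
  have hd (B : Fin 2) : DifferentiableAt ℝ (comp a (pullback ς) B) (cylinder k (rPlus a M) x) :=
    differentiableAt_comp_pullback (q := cylinder k (rPlus a M) x) hr hs
      ((hς x hx).differentiableAt (by simp)) B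
  have hq : cylinder k (rPlus a M) x 1 = rPlus a M := rfl
  rw [fluxDensity, normSq_radius_sq_smul, nablaNormSq_radius_sq_smul hd]
  simp only [normSq, nablaNormSq, nabla4NormSq, Fin.sum_univ_two, comp_pullback_cylinder ς _ hs, hq,
    nablaH_radius_sq_smul (e4_apply_one_of_horizon hq) (hd _)]
  ring

end FluxDensity

/-! ## Divergence and curl along the horizon -/

/-- `sin θ div(Σς)` on the horizon, in terms of `u = ς(∂_θ)` and
`v = ς(a sin θ ∂_t + (sin θ)⁻¹ ∂_φ)`. -/
noncomputable def sinDiv (a : ℝ) (u v : ℝ × ℝ × ℝ → ℝ) (x : ℝ × ℝ × ℝ) : ℝ :=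
  Real.sin x.2.1 * dTheta u x + Real.cos x.2.1 * u x + dPhi v x
    + a * Real.sin x.2.1 ^ 2 * dTime v x

/-- `sin θ curl(Σς)` on the horizon, in terms of `u = ς(∂_θ)` and
`v = ς(a sin θ ∂_t + (sin θ)⁻¹ ∂_φ)`. -/
noncomputable def sinCurl (a : ℝ) (u v : ℝ × ℝ × ℝ → ℝ) (x : ℝ × ℝ × ℝ) : ℝ :=
  Real.sin x.2.1 * dTheta v x + Real.cos x.2.1 * v x - dPhi u x
    - a * Real.sin x.2.1 ^ 2 * dTime u x

section DivCurl

variable {a M k r : ℝ} {ς : OneForm} {x : ℝ × ℝ × ℝ}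

theorem hasDerivAt_horizonSig (a r θ : ℝ) :
    HasDerivAt (horizonSig a r) (-(2 * a ^ 2 * Real.sin θ * Real.cos θ)) θ := by
  refine ((((Real.hasDerivAt_cos θ).pow 2).const_mul (a ^ 2)).const_add (r ^ 2)).congr_deriv ?_
  ring

theorem hasDerivAt_frameTheta_zero (hr : 0 < r) (θ : ℝ) :
    HasDerivAt (fun θ => frameTheta a r θ 0)
      (2 * a ^ 2 * r * Real.sin θ * Real.cos θ / horizonSig a r θ ^ 2) θ := by
  refine ((hasDerivAt_const θ r).div (hasDerivAt_horizonSig a r θ)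
    (horizonSig_pos hr θ).ne').congr_deriv ?_
  ring

theorem hasDerivAt_frameAxial_zero (hr : 0 < r) (θ : ℝ) :
    HasDerivAt (fun θ => frameAxial a r θ 0)
      (-(a * Real.sin θ * (r ^ 2 - a ^ 2 * Real.cos θ ^ 2) / horizonSig a r θ ^ 2)) θ := by
  have hS := (horizonSig_pos (a := a) hr θ).ne'
  refine (((Real.hasDerivAt_cos θ).const_mul a).div (hasDerivAt_horizonSig a r θ)
    hS).congr_deriv ?_
  rw [← neg_div]
  congr 1
  rw [horizonSig]
  ring

theorem fderiv_frameComp_zero (hr : 0 < r)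
    (hς : ∀ x, 0 ≤ x.1 → ContDiffAt ℝ ∞ ς (chart (cylinder k r x))) (hx : 0 ≤ x.1)
    (w : ℝ × ℝ × ℝ) :
    fderiv ℝ (frameComp a k r ς 0) x w
      = (r * fderiv ℝ (thetaComp k r ς) x w
          + a * Real.cos x.2.1 * fderiv ℝ (axialComp a k r ς) x w) / horizonSig a r x.2.1
        + w.2.1 * (2 * a ^ 2 * r * Real.sin x.2.1 * Real.cos x.2.1 * thetaComp k r ς x
          - a * Real.sin x.2.1 * (r ^ 2 - a ^ 2 * Real.cos x.2.1 ^ 2) * axialComp a k r ς x)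
            / horizonSig a r x.2.1 ^ 2 := by
  have h := isPolarPair_comps a hς
  refine (ContDiffFuture.fderiv_theta_mul_add (hasDerivAt_frameTheta_zero hr _)
    (hasDerivAt_frameAxial_zero hr _) h.contDiffFuture_fst h.contDiffFuture_snd hx w).trans ?_
  simp only [frameTheta, frameAxial, Matrix.cons_val]
  ring

theorem fderiv_frameComp_one (hr : 0 < r)
    (hς : ∀ x, 0 ≤ x.1 → ContDiffAt ℝ ∞ ς (chart (cylinder k r x))) (hx : 0 ≤ x.1)
    (w : ℝ × ℝ × ℝ) :
    fderiv ℝ (frameComp a k r ς 1) x w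
      = (r * fderiv ℝ (axialComp a k r ς) x w
          - a * Real.cos x.2.1 * fderiv ℝ (thetaComp k r ς) x w) / horizonSig a r x.2.1
        + w.2.1 * (2 * a ^ 2 * r * Real.sin x.2.1 * Real.cos x.2.1 * axialComp a k r ς x
          + a * Real.sin x.2.1 * (r ^ 2 - a ^ 2 * Real.cos x.2.1 ^ 2) * thetaComp k r ς x)
            / horizonSig a r x.2.1 ^ 2 := by
  have h := isPolarPair_comps a hς
  refine (ContDiffFuture.fderiv_theta_mul_add (hasDerivAt_frameAxial_zero hr _).neg
    (hasDerivAt_frameTheta_zero hr _) h.contDiffFuture_fst h.contDiffFuture_snd hx w).trans ?_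
  simp only [frameTheta, frameAxial, Matrix.cons_val, Pi.neg_apply]
  ring

theorem sin_mul_divH_Sig_smul (ha : |a| ≤ M) (hr : 0 < r)
    (hς : ∀ x, 0 ≤ x.1 → ContDiffAt ℝ ∞ ς (chart (cylinder k r x))) (hx : 0 ≤ x.1)
    (hs : Real.sin x.2.1 ≠ 0) :
    Real.sin x.2.1 * divH a M (fun q' => Sig a q' • pullback ς q') (cylinder k r x)
      = sinDiv a (thetaComp k r ς) (axialComp a k r ς) x := by
  have hd : DifferentiableAt ℝ ς (chart (cylinder k r x)) :=
    (hς x hx).differentiableAt (by simp)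
  have hS := (horizonSig_pos (a := a) hr x.2.1).ne'
  rw [divH_Sig_smul fun A => differentiableAt_comp_pullback (q := cylinder k r x) hr hs hd A]
  rw [divH, Fin.sum_univ_two, nablaH_frame_zero ha hr hs hd, nablaH_frame_one ha hr hs hd]
  simp only [comp_pullback_cylinder ς _ hs, frame_cylinder_two, Sig_cylinder, cylinder_apply_two,
    sinDiv, dTheta, dTime, dPhi, fderiv_frameComp_zero hr hς hx, fderiv_frameComp_one hr hς hx,
    frameComp, frameTheta, frameAxial, axisDefect, Matrix.cons_val]
  field_simp
  rw [horizonSig]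
  ring

theorem sin_mul_curlH_Sig_smul (ha : |a| ≤ M) (hr : 0 < r)
    (hς : ∀ x, 0 ≤ x.1 → ContDiffAt ℝ ∞ ς (chart (cylinder k r x))) (hx : 0 ≤ x.1)
    (hs : Real.sin x.2.1 ≠ 0) :
    Real.sin x.2.1 * curlH a M (fun q' => Sig a q' • pullback ς q') (cylinder k r x)
      = sinCurl a (thetaComp k r ς) (axialComp a k r ς) x := by
  have hd : DifferentiableAt ℝ ς (chart (cylinder k r x)) :=
    (hς x hx).differentiableAt (by simp)
  have hS := (horizonSig_pos (a := a) hr x.2.1).ne'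
  rw [curlH_Sig_smul fun A => differentiableAt_comp_pullback (q := cylinder k r x) hr hs hd A]
  rw [curlH, nablaH_frame_zero ha hr hs hd, nablaH_frame_one ha hr hs hd]
  simp only [comp_pullback_cylinder ς _ hs, frame_cylinder_two, Sig_cylinder, cylinder_apply_two,
    sinCurl, dTheta, dTime, dPhi, fderiv_frameComp_zero hr hς hx, fderiv_frameComp_one hr hς hx,
    frameComp, frameTheta, frameAxial, axisDefect, Matrix.cons_val]
  field_simp
  rw [horizonSig]
  ring

end DivCurl

/-! ## Functions along the horizon -/

/-- The restriction of a function to the cylinder. -/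
noncomputable def onCylinder (k r : ℝ) (f : R4 → ℝ) (x : ℝ × ℝ × ℝ) : ℝ :=
  f (chart (cylinder k r x))

section Scalar

variable {a k r : ℝ} {f : R4 → ℝ} {x : ℝ × ℝ × ℝ}

theorem contDiffFuture_onCylinder
    (hf : ∀ x, 0 ≤ x.1 → ContDiffAt ℝ ∞ f (chart (cylinder k r x))) :
    ContDiffFuture (onCylinder k r f) := fun x hx =>
  ((hf x hx).comp x (contDiff_chart.comp (contDiff_cylinder k r)).contDiffAt).of_le (by simp)

theorem onCylinder_two_pi (k r : ℝ) (f : R4 → ℝ) (τ θ : ℝ) :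
    onCylinder k r f (τ, θ, 2 * π) = onCylinder k r f (τ, θ, 0) := by
  simp [onCylinder, chart, cylinder]

theorem fderiv_comp_chart (hf : DifferentiableAt ℝ f (chart (cylinder k r x))) {X : R4}
    (hX : X 1 = 0) :
    fderiv ℝ (f ∘ chart) (cylinder k r x) X = X 0 * dTime (onCylinder k r f) x
      + X 2 * dTheta (onCylinder k r f) x + X 3 * dPhi (onCylinder k r f) x := by
  have hchart : DifferentiableAt ℝ chart (cylinder k r x) :=
    contDiff_chart.contDiffAt.differentiableAt (by simp)
  rw [fderiv_comp_cylinder (hf.comp _ hchart) hX, fderiv_eq_partials]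
  rfl

theorem thetaComp_fderiv (hf : DifferentiableAt ℝ f (chart (cylinder k r x))) :
    thetaComp k r (fderiv ℝ f) x = dTheta (onCylinder k r f) x := by
  have hchart : DifferentiableAt ℝ chart (cylinder k r x) :=
    contDiff_chart.contDiffAt.differentiableAt (by simp)
  have hX : (![0, 0, 1, 0] : R4) 1 = 0 := rfl
  have h := fderiv_comp_chart hf hX
  rw [fderiv_comp _ hf hchart, ContinuousLinearMap.comp_apply, fderiv_chart hX] at h
  simpa [thetaComp] using h

theorem fderiv_comp_chart_frame (hf : DifferentiableAt ℝ f (chart (cylinder k r x)))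
    (hs : Real.sin x.2.1 ≠ 0) (A : Fin 2) :
    fderiv ℝ (f ∘ chart) (cylinder k r x) (frame a A (cylinder k r x))
      = frameComp a k r (fderiv ℝ f) A x := by
  rw [fderiv_comp _ hf (contDiff_chart.contDiffAt.differentiableAt (by simp))]
  exact comp_pullback_cylinder _ A hs

theorem thetaComp_sq_add_axialComp_sq (hr : 0 < r) (ς : OneForm) (x : ℝ × ℝ × ℝ) :
    thetaComp k r ς x ^ 2 + axialComp a k r ς x ^ 2
      = horizonSig a r x.2.1 * (frameComp a k r ς 0 x ^ 2 + frameComp a k r ς 1 x ^ 2) := by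
  have hS := (horizonSig_pos (a := a) hr x.2.1).ne'
  simp only [frameComp, frameTheta, frameAxial, Matrix.cons_val]
  field_simp
  rw [horizonSig]
  ring

end Scalar

/-! ## Maxwell fields along the horizon generators -/

/-- The integral of `f` over the horizon sphere at time `τ`. -/
noncomputable def sliceIntegral (f : ℝ × ℝ × ℝ → ℝ) (τ : ℝ) : ℝ :=
  sphereIntegral fun θ φ => f (τ, θ, φ)

/-- `(r² + a²) ∂_τ f + a ∂_φ f`; on the horizon this is `½ Σ e₄(f)`. -/
noncomputable def generator (a r : ℝ) (f : ℝ × ℝ × ℝ → ℝ) (x : ℝ × ℝ × ℝ) : ℝ :=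
  (r ^ 2 + a ^ 2) * dTime f x + a * dPhi f x

/-- `2 c / Σ` on the horizon, the weight of `ρ̂` in the conserved charge. -/
noncomputable def weightRe (a r θ : ℝ) : ℝ :=
  2 * (r ^ 2 - a ^ 2 * Real.cos θ ^ 2) / horizonSig a r θ ^ 2

/-- `-2 d / Σ` on the horizon, the weight of `σ̂` in the conserved charge. -/
noncomputable def weightIm (a r θ : ℝ) : ℝ :=
  4 * a * r * Real.cos θ / horizonSig a r θ ^ 2

/-- The modified Maxwell equations tangential to the horizon, for `ρ̂`, `σ̂` and the components
`u = α(∂_θ)`, `v = α(a sin θ ∂_t + (sin θ)⁻¹ ∂_φ)`, solved for the divergence and the curl of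
`Σα`. -/
structure HorizonMaxwell (a r : ℝ) (ρ σ u v : ℝ × ℝ × ℝ → ℝ) : Prop where
  contDiff_rho : ContDiffFuture ρ
  contDiff_sigma : ContDiffFuture σ
  contDiff_u : ContDiffFuture u
  contDiff_v : ContDiffFuture v
  rho_two_pi : ∀ τ θ, ρ (τ, θ, 2 * π) = ρ (τ, θ, 0)
  sigma_two_pi : ∀ τ θ, σ (τ, θ, 2 * π) = σ (τ, θ, 0)
  u_two_pi : ∀ τ θ, u (τ, θ, 2 * π) = u (τ, θ, 0)
  v_two_pi : ∀ τ θ, v (τ, θ, 2 * π) = v (τ, θ, 0)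
  div_eq : ∀ x : ℝ × ℝ × ℝ, 0 ≤ x.1 → x.2.1 ∈ Ioo 0 π → sinDiv a u v x = Real.sin x.2.1 *
    (weightRe a r x.2.1 * generator a r ρ x + weightIm a r x.2.1 * generator a r σ x)
  curl_eq : ∀ x : ℝ × ℝ × ℝ, 0 ≤ x.1 → x.2.1 ∈ Ioo 0 π → sinCurl a u v x = Real.sin x.2.1 *
    (weightIm a r x.2.1 * generator a r ρ x - weightRe a r x.2.1 * generator a r σ x)

/-- Decay of a Maxwell field along the horizon, in terms of an energy flux density `Φ` that controls
`α` and the derivatives of `ρ̂`, `σ̂` along the generators, and of a density `Ψ` that controls the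
angular derivatives of `ρ̂`, `σ̂`. -/
structure HorizonDecay (a r K p D : ℝ) (ρ σ u v Φ Ψ : ℝ × ℝ × ℝ → ℝ) : Prop where
  axisRegular_flux : AxisRegular Φ
  axisRegular_transversal : AxisRegular Ψ
  generator_sq_le : ∀ x : ℝ × ℝ × ℝ, 0 ≤ x.1 → x.2.1 ∈ Ioo 0 π →
    generator a r ρ x ^ 2 + generator a r σ x ^ 2 ≤ K * (r ^ 2 + a ^ 2) ^ 2 * Φ x
  field_sq_le : ∀ x : ℝ × ℝ × ℝ, 0 ≤ x.1 → x.2.1 ∈ Ioo 0 π →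
    a ^ 2 * (u x ^ 2 + v x ^ 2) ≤ 2 * Φ x
  dTheta_sq_le : ∀ x : ℝ × ℝ × ℝ, 0 ≤ x.1 → x.2.1 ∈ Ioo 0 π →
    dTheta ρ x ^ 2 + dTheta σ x ^ 2 ≤ 4 * r ^ 2 * Ψ x
  flux_le : ∀ τ : ℝ, 0 ≤ τ → ∫⁻ s in Ioi τ, ENNReal.ofReal (sliceIntegral Φ s)
    ≤ ENNReal.ofReal (D / (1 + τ) ^ (1 + p))
  tendsto_transversal : Tendsto (sliceIntegral Ψ) atTop (𝓝 0)

section SliceIntegral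

variable {f g : ℝ × ℝ × ℝ → ℝ} {τ : ℝ}

theorem sliceIntegral_const_mul (k : ℝ) (f : ℝ × ℝ × ℝ → ℝ) (τ : ℝ) :
    sliceIntegral (fun x => k * f x) τ = k * sliceIntegral f τ :=
  sphereIntegral_const_mul k _

theorem AxisRegular.exists_continuous_slice (hf : AxisRegular f) (hτ : 0 ≤ τ) :
    ∃ F : ℝ → ℝ → ℝ, (Continuous fun x : ℝ × ℝ => F x.1 x.2) ∧
      ∀ θ ∈ Ioo 0 π, ∀ φ, f (τ, θ, φ) = F θ φ := by
  obtain ⟨F, hF, hfF⟩ := hf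
  exact ⟨fun θ φ => F (τ, θ, φ), continuous_slice hF hτ, fun θ hθ φ => hfF _ hτ hθ⟩

theorem AxisRegular.sliceIntegral_add (hf : AxisRegular f) (hg : AxisRegular g) (hτ : 0 ≤ τ) :
    sliceIntegral (fun x => f x + g x) τ = sliceIntegral f τ + sliceIntegral g τ := by
  obtain ⟨F, hF, hfF⟩ := hf.exists_continuous_slice hτ
  obtain ⟨G, hG, hgG⟩ := hg.exists_continuous_slice hτ
  unfold sliceIntegral
  rw [sphereIntegral_congr hfF, sphereIntegral_congr hgG, ← sphereIntegral_add hF hG]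
  exact sphereIntegral_congr fun θ hθ φ => congrArg₂ _ (hfF θ hθ φ) (hgG θ hθ φ)

theorem AxisRegular.sliceIntegral_mono (hf : AxisRegular f) (hg : AxisRegular g) (hτ : 0 ≤ τ)
    (h : ∀ x : ℝ × ℝ × ℝ, 0 ≤ x.1 → x.2.1 ∈ Ioo 0 π → f x ≤ g x) :
    sliceIntegral f τ ≤ sliceIntegral g τ := by
  obtain ⟨F, hF, hfF⟩ := hf.exists_continuous_slice hτ
  obtain ⟨G, hG, hgG⟩ := hg.exists_continuous_slice hτ
  unfold sliceIntegral
  rw [sphereIntegral_congr hfF, sphereIntegral_congr hgG]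
  exact sphereIntegral_mono hF hG fun θ hθ φ => hfF θ hθ φ ▸ hgG θ hθ φ ▸ h _ hτ hθ

theorem AxisRegular.sq_sliceIntegral_le (hf : AxisRegular f) (hτ : 0 ≤ τ) :
    sliceIntegral f τ ^ 2 ≤ 4 * π * sliceIntegral (fun x => f x ^ 2) τ := by
  obtain ⟨F, hF, hfF⟩ := hf.exists_continuous_slice hτ
  unfold sliceIntegral
  rw [sphereIntegral_congr hfF,
    sphereIntegral_congr fun θ hθ φ => congrArg (· ^ 2) (hfF θ hθ φ)]
  exact sq_sphereIntegral_le hF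

theorem ContDiffFuture.sliceIntegral_dPhi (hf : ContDiffFuture f)
    (hper : ∀ τ θ, f (τ, θ, 2 * π) = f (τ, θ, 0)) (hτ : 0 ≤ τ) :
    sliceIntegral (dPhi f) τ = 0 := by
  refine sphereIntegral_eq_zero_of_divergence (Y := fun _ _ => 0) (Y' := fun _ _ => 0)
    (Z := fun θ φ => Real.sin θ * f (τ, θ, φ)) (fun _ _ => hasDerivAt_const _ _)
    (fun θ φ => (hf.hasDerivAt_phi hτ θ φ).const_mul (Real.sin θ)) continuous_const
    ((Real.continuous_sin.comp continuous_fst).mul (continuous_slice hf.continuousOn_dPhi hτ))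
    (fun _ => rfl) (fun θ => by rw [hper]) fun θ _ φ => ?_
  ring

theorem ContDiffFuture.sliceIntegral_generator (hf : ContDiffFuture f)
    (hper : ∀ τ θ, f (τ, θ, 2 * π) = f (τ, θ, 0)) (a r : ℝ) (hτ : 0 ≤ τ) :
    sliceIntegral (generator a r f) τ = (r ^ 2 + a ^ 2) * sliceIntegral (dTime f) τ := by
  have h := (hf.axisRegular_dTime.theta_mul (continuous_const (y := r ^ 2 + a ^ 2)))
    |>.sliceIntegral_add (hf.axisRegular_dPhi.theta_mul (continuous_const (y := a))) hτ
  rwa [sliceIntegral_const_mul, sliceIntegral_const_mul, hf.sliceIntegral_dPhi hper hτ, mul_zero,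
    add_zero] at h

theorem ContDiffFuture.axisRegular_generator (hf : ContDiffFuture f) (a r : ℝ) :
    AxisRegular (generator a r f) :=
  (hf.axisRegular_dTime.theta_mul (continuous_const (y := r ^ 2 + a ^ 2))).add
    (hf.axisRegular_dPhi.theta_mul (continuous_const (y := a)))

end SliceIntegral

section Duality

variable {a r K p D : ℝ} {ρ σ u v Φ Ψ : ℝ × ℝ × ℝ → ℝ}

theorem dTime_neg (f : ℝ × ℝ × ℝ → ℝ) (x : ℝ × ℝ × ℝ) : dTime (-f) x = -dTime f x := by
  rw [dTime, fderiv_neg, neg_apply, dTime]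

theorem dTheta_neg (f : ℝ × ℝ × ℝ → ℝ) (x : ℝ × ℝ × ℝ) : dTheta (-f) x = -dTheta f x := by
  rw [dTheta, fderiv_neg, neg_apply, dTheta]

theorem dPhi_neg (f : ℝ × ℝ × ℝ → ℝ) (x : ℝ × ℝ × ℝ) : dPhi (-f) x = -dPhi f x := by
  rw [dPhi, fderiv_neg, neg_apply, dPhi]

theorem generator_neg (a r : ℝ) (f : ℝ × ℝ × ℝ → ℝ) (x : ℝ × ℝ × ℝ) :
    generator a r (-f) x = -generator a r f x := by
  rw [generator, dTime_neg, dPhi_neg, generator]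
  ring

theorem ContDiffFuture.neg {f : ℝ × ℝ × ℝ → ℝ} (hf : ContDiffFuture f) : ContDiffFuture (-f) :=
  fun x hx => (hf x hx).neg

theorem HorizonMaxwell.dual (h : HorizonMaxwell a r ρ σ u v) :
    HorizonMaxwell a r σ (-ρ) (-v) u where
  contDiff_rho := h.contDiff_sigma
  contDiff_sigma := h.contDiff_rho.neg
  contDiff_u := h.contDiff_v.neg
  contDiff_v := h.contDiff_u
  rho_two_pi := h.sigma_two_pi
  sigma_two_pi τ θ := congrArg Neg.neg (h.rho_two_pi τ θ)
  u_two_pi τ θ := congrArg Neg.neg (h.v_two_pi τ θ)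
  v_two_pi := h.u_two_pi
  div_eq x hx hs := by
    have hc := h.curl_eq x hx hs
    rw [sinCurl] at hc
    rw [sinDiv, dTheta_neg, Pi.neg_apply, generator_neg]
    linear_combination -hc
  curl_eq x hx hs := by
    have hd := h.div_eq x hx hs
    rw [sinDiv] at hd
    rw [sinCurl, dPhi_neg, dTime_neg, generator_neg]
    linear_combination hd

theorem HorizonDecay.dual (h : HorizonDecay a r K p D ρ σ u v Φ Ψ) :
    HorizonDecay a r K p D σ (-ρ) (-v) u Φ Ψ where
  axisRegular_flux := h.axisRegular_flux
  axisRegular_transversal := h.axisRegular_transversal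
  generator_sq_le x hx hs := by
    rw [generator_neg, neg_sq, add_comm]
    exact h.generator_sq_le x hx hs
  field_sq_le x hx hs := by
    rw [Pi.neg_apply, neg_sq, add_comm]
    exact h.field_sq_le x hx hs
  dTheta_sq_le x hx hs := by
    rw [dTheta_neg, neg_sq, add_comm]
    exact h.dTheta_sq_le x hx hs
  flux_le := h.flux_le
  tendsto_transversal := h.tendsto_transversal

end Duality

/-- The density of the charge `∫ ((r² + a²) (2c ρ̂ - 2d σ̂) / Σ - a sin θ v) dΩ`, conserved along
the horizon, where `v = α(a sin θ ∂_t + (sin θ)⁻¹ ∂_φ)`; for a stationary field it equals `2 ρ̂` up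
to an angular divergence. -/
noncomputable def chargeDensity (a r : ℝ) (ρ σ v : ℝ × ℝ × ℝ → ℝ) (x : ℝ × ℝ × ℝ) : ℝ :=
  (r ^ 2 + a ^ 2) * (weightRe a r x.2.1 * ρ x + weightIm a r x.2.1 * σ x)
    - a * Real.sin x.2.1 * v x

/-- `½ chargeDensity - ρ̂` up to an angular divergence. Its integral tends to zero along a
sequence of times. -/
noncomputable def chargeDefect (a r : ℝ) (ρ σ v : ℝ × ℝ × ℝ → ℝ) (x : ℝ × ℝ × ℝ) : ℝ :=
  a ^ 2 * Real.cos x.2.1 * Real.sin x.2.1 / horizonSig a r x.2.1 * dTheta ρ x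
    - a * r * Real.sin x.2.1 / horizonSig a r x.2.1 * dTheta σ x
    - a / 2 * Real.sin x.2.1 * v x

section Weights

variable {a r : ℝ}

theorem continuous_horizonSig (a r : ℝ) : Continuous (horizonSig a r) := by
  unfold horizonSig
  fun_prop

theorem continuous_weightRe (hr : 0 < r) : Continuous (weightRe a r) :=
  Continuous.div (by fun_prop) ((continuous_horizonSig a r).pow 2) fun θ =>
    (pow_pos (horizonSig_pos hr θ) 2).ne'

theorem continuous_weightIm (hr : 0 < r) : Continuous (weightIm a r) :=
  Continuous.div (by fun_prop) ((continuous_horizonSig a r).pow 2) fun θ =>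
    (pow_pos (horizonSig_pos hr θ) 2).ne'

theorem hasDerivAt_sin_sq_div_horizonSig (hr : 0 < r) (θ : ℝ) :
    HasDerivAt (fun θ => Real.sin θ ^ 2 / horizonSig a r θ)
      (2 * (r ^ 2 + a ^ 2) * Real.sin θ * Real.cos θ / horizonSig a r θ ^ 2) θ := by
  refine (((Real.hasDerivAt_sin θ).pow 2).div (hasDerivAt_horizonSig a r θ)
    (horizonSig_pos hr θ).ne').congr_deriv ?_
  congr 1
  simp only [horizonSig, Real.cos_sq', Pi.pow_apply, Nat.cast_ofNat, Nat.add_one_sub_one, pow_one]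
  ring

theorem hasDerivAt_sigmaPotential (hr : 0 < r) (θ : ℝ) :
    HasDerivAt (fun θ => a * r * (Real.sin θ ^ 2 / horizonSig a r θ))
      ((r ^ 2 + a ^ 2) / 2 * weightIm a r θ * Real.sin θ) θ := by
  refine ((hasDerivAt_sin_sq_div_horizonSig hr θ).const_mul (a * r)).congr_deriv ?_
  rw [weightIm]
  ring

theorem hasDerivAt_rhoPotential (hr : 0 < r) (θ : ℝ) :
    HasDerivAt (fun θ => a ^ 2 * Real.cos θ * (Real.sin θ ^ 2 / horizonSig a r θ))
      ((1 - (r ^ 2 + a ^ 2) / 2 * weightRe a r θ) * Real.sin θ) θ := by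
  have hS := (horizonSig_pos (a := a) hr θ).ne'
  refine (((Real.hasDerivAt_cos θ).const_mul (a ^ 2)).mul
    (hasDerivAt_sin_sq_div_horizonSig hr θ)).congr_deriv ?_
  rw [weightRe]
  field_simp
  rw [horizonSig, Real.cos_sq']
  ring

end Weights

section HorizonCharge

variable {a r K p D τ : ℝ} {ρ σ u v Φ Ψ : ℝ × ℝ × ℝ → ℝ}

theorem continuousOn_theta_mul {c : ℝ → ℝ} {f : ℝ × ℝ × ℝ → ℝ} (hc : Continuous c)
    (hf : ContinuousOn f {x | 0 ≤ x.1}) :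
    ContinuousOn (fun x : ℝ × ℝ × ℝ => c x.2.1 * f x) {x | 0 ≤ x.1} :=
  (hc.comp (continuous_fst.comp continuous_snd)).continuousOn.mul hf

theorem continuousOn_chargeDensity (hr : 0 < r) (hρ : ContinuousOn ρ {x | 0 ≤ x.1})
    (hσ : ContinuousOn σ {x | 0 ≤ x.1}) (hv : ContinuousOn v {x | 0 ≤ x.1}) :
    ContinuousOn (chargeDensity a r ρ σ v) {x | 0 ≤ x.1} :=
  (continuousOn_const.mul ((continuousOn_theta_mul (continuous_weightRe hr) hρ).add
    (continuousOn_theta_mul (continuous_weightIm hr) hσ))).sub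
    (continuousOn_theta_mul (c := fun θ => a * Real.sin θ) (by fun_prop) hv)

theorem continuousOn_chargeDefect (hr : 0 < r) (hρ : ContDiffFuture ρ) (hσ : ContDiffFuture σ)
    (hv : ContDiffFuture v) : ContinuousOn (chargeDefect a r ρ σ v) {x | 0 ≤ x.1} := by
  have hS : ∀ θ, horizonSig a r θ ≠ 0 := fun θ => (horizonSig_pos hr θ).ne'
  exact ((continuousOn_theta_mul (c := fun θ => a ^ 2 * Real.cos θ * Real.sin θ / horizonSig a r θ)
      (Continuous.div (by fun_prop) (continuous_horizonSig a r) hS) hρ.continuousOn_dTheta).sub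
    (continuousOn_theta_mul (c := fun θ => a * r * Real.sin θ / horizonSig a r θ)
      (Continuous.div (by fun_prop) (continuous_horizonSig a r) hS) hσ.continuousOn_dTheta)).sub
    (continuousOn_theta_mul (c := fun θ => a / 2 * Real.sin θ) (by fun_prop) hv.continuousOn)

/-- By `div_eq`, `∂_τ` of the charge density is the divergence of
`(u, (sin θ)⁻¹ v - a (weightRe ρ + weightIm σ))`. -/
theorem HorizonMaxwell.sliceIntegral_chargeDensity_dTime (h : HorizonMaxwell a r ρ σ u v)
    (hr : 0 < r) (hτ : 0 ≤ τ) :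
    sliceIntegral (chargeDensity a r (dTime ρ) (dTime σ) (dTime v)) τ = 0 := by
  refine sphereIntegral_eq_zero_of_divergence (Y := fun θ φ => Real.sin θ * u (τ, θ, φ))
    (Z := fun θ φ => v (τ, θ, φ) - a * Real.sin θ *
      (weightRe a r θ * ρ (τ, θ, φ) + weightIm a r θ * σ (τ, θ, φ)))
    (fun θ φ => (Real.hasDerivAt_sin θ).mul (h.contDiff_u.hasDerivAt_theta hτ θ φ))
    (fun θ φ => (h.contDiff_v.hasDerivAt_phi hτ θ φ).sub
      (((h.contDiff_rho.hasDerivAt_phi hτ θ φ).const_mul (weightRe a r θ)).add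
        ((h.contDiff_sigma.hasDerivAt_phi hτ θ φ).const_mul (weightIm a r θ)) |>.const_mul
          (a * Real.sin θ)))
    ?_ ?_ (fun φ => by simp) (fun θ => ?_) fun θ hθ φ => ?_
  · have hu := continuous_slice h.contDiff_u.continuousOn hτ
    have hu' := continuous_slice h.contDiff_u.continuousOn_dTheta hτ
    exact (Continuous.mul (by fun_prop) hu).add (Continuous.mul (by fun_prop) hu')
  · have hρ' := continuous_slice h.contDiff_rho.continuousOn_dPhi hτ
    have hσ' := continuous_slice h.contDiff_sigma.continuousOn_dPhi hτ
    have hv' := continuous_slice h.contDiff_v.continuousOn_dPhi hτ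
    have hwR := continuous_weightRe (a := a) hr
    have hwI := continuous_weightIm (a := a) hr
    fun_prop
  · rw [h.rho_two_pi, h.sigma_two_pi, h.v_two_pi]
  · have hdiv := h.div_eq (τ, θ, φ) hτ hθ
    simp only [sinDiv, generator] at hdiv
    simp only [chargeDensity]
    linear_combination -hdiv

theorem HorizonMaxwell.sliceIntegral_chargeDensity (h : HorizonMaxwell a r ρ σ u v) (hr : 0 < r)
    (hτ : 0 ≤ τ) : sliceIntegral (chargeDensity a r ρ σ v) τ
      = sliceIntegral (chargeDensity a r ρ σ v) 0 := by
  have hint := sphereIntegral_sub_eq_intervalIntegral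
    (continuousOn_chargeDensity (a := a) hr h.contDiff_rho.continuousOn
      h.contDiff_sigma.continuousOn h.contDiff_v.continuousOn)
    (continuousOn_chargeDensity hr h.contDiff_rho.continuousOn_dTime
      h.contDiff_sigma.continuousOn_dTime h.contDiff_v.continuousOn_dTime)
    (fun t ht θ φ =>
      ((((h.contDiff_rho.hasDerivAt_time ht θ φ).const_mul (weightRe a r θ)).add
        ((h.contDiff_sigma.hasDerivAt_time ht θ φ).const_mul (weightIm a r θ))).const_mul
          (r ^ 2 + a ^ 2)).sub
        ((h.contDiff_v.hasDerivAt_time ht θ φ).const_mul (a * Real.sin θ)))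
    le_rfl hτ
  refine sub_eq_zero.1 (hint.trans ?_)
  exact intervalIntegral.integral_zero_ae <| .of_forall fun s hs =>
    h.sliceIntegral_chargeDensity_dTime hr (uIoc_of_le hτ ▸ hs).1.le

theorem half_sliceIntegral_chargeDensity_sub (hr : 0 < r) (hρ : ContDiffFuture ρ)
    (hσ : ContDiffFuture σ) (hv : ContDiffFuture v) (hτ : 0 ≤ τ) :
    1 / 2 * sliceIntegral (chargeDensity a r ρ σ v) τ - sliceIntegral ρ τ
      = sliceIntegral (chargeDefect a r ρ σ v) τ := by
  have hq := continuous_slice (continuousOn_chargeDensity (a := a) hr hρ.continuousOn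
    hσ.continuousOn hv.continuousOn) hτ
  have hW := continuous_slice (continuousOn_chargeDefect (a := a) hr hρ hσ hv) hτ
  have hρ0 := continuous_slice hρ.continuousOn hτ
  rw [← sliceIntegral_const_mul, ← sub_eq_zero, sliceIntegral, sliceIntegral, sliceIntegral,
    ← sphereIntegral_sub (hq.const_mul _) hρ0, ← sphereIntegral_sub ((hq.const_mul _).sub hρ0) hW]
  refine sphereIntegral_eq_zero_of_divergence
    (Y := fun θ φ => a * r * (Real.sin θ ^ 2 / horizonSig a r θ) * σ (τ, θ, φ)
      - a ^ 2 * Real.cos θ * (Real.sin θ ^ 2 / horizonSig a r θ) * ρ (τ, θ, φ))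
    (Z := fun _ _ => 0) (Z' := fun _ _ => 0)
    (fun θ φ => ((hasDerivAt_sigmaPotential hr θ).mul (hσ.hasDerivAt_theta hτ θ φ)).sub
      ((hasDerivAt_rhoPotential hr θ).mul (hρ.hasDerivAt_theta hτ θ φ)))
    (fun _ _ => hasDerivAt_const _ _) ?_ continuous_const (fun φ => by simp) (fun _ => rfl)
    fun θ _ φ => ?_
  · have hρ' := continuous_slice hρ.continuousOn_dTheta hτ
    have hσ0 := continuous_slice hσ.continuousOn hτ
    have hσ' := continuous_slice hσ.continuousOn_dTheta hτ
    have hwR := continuous_weightRe (a := a) hr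
    have hwI := continuous_weightIm (a := a) hr
    have hS : Continuous fun x : ℝ × ℝ => Real.sin x.1 ^ 2 / horizonSig a r x.1 :=
      Continuous.div (by fun_prop) ((continuous_horizonSig a r).comp continuous_fst)
        fun x => (horizonSig_pos hr x.1).ne'
    exact ((Continuous.mul (by fun_prop) hσ0).add (Continuous.mul (by fun_prop) hσ')).sub
      ((Continuous.mul (by fun_prop) hρ0).add (Continuous.mul (by fun_prop) hρ'))
  · simp only [chargeDensity, chargeDefect]
    ring

theorem sq_chargeDefect_le (hr : 0 < r) (har : a ^ 2 ≤ r ^ 2) (x : ℝ × ℝ × ℝ) :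
    chargeDefect a r ρ σ v x ^ 2
      ≤ 2 * (dTheta ρ x ^ 2 + dTheta σ x ^ 2) + a ^ 2 / 2 * v x ^ 2 := by
  set X := a * Real.cos x.2.1 * dTheta ρ x - r * dTheta σ x with hX
  have hS := horizonSig_pos (a := a) hr x.2.1
  have hsin := Real.sin_sq_le_one x.2.1
  have hW : chargeDefect a r ρ σ v x = a * Real.sin x.2.1 / horizonSig a r x.2.1 * X
      - a / 2 * Real.sin x.2.1 * v x := by
    rw [chargeDefect, hX]
    ring
  have hX2 : X ^ 2 ≤ horizonSig a r x.2.1 * (dTheta ρ x ^ 2 + dTheta σ x ^ 2) := by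
    rw [hX, horizonSig]
    nlinarith [sq_nonneg (a * Real.cos x.2.1 * dTheta σ x + r * dTheta ρ x)]
  have haS : a ^ 2 * Real.sin x.2.1 ^ 2 ≤ horizonSig a r x.2.1 := by
    unfold horizonSig
    nlinarith [sq_nonneg (a * Real.cos x.2.1), sq_nonneg a]
  have hmain : (a * Real.sin x.2.1 / horizonSig a r x.2.1 * X) ^ 2
      ≤ dTheta ρ x ^ 2 + dTheta σ x ^ 2 := by
    rw [mul_pow, div_pow, div_mul_eq_mul_div, div_le_iff₀ (by positivity), mul_pow]
    calc a ^ 2 * Real.sin x.2.1 ^ 2 * X ^ 2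
        ≤ horizonSig a r x.2.1 * (horizonSig a r x.2.1 * (dTheta ρ x ^ 2 + dTheta σ x ^ 2)) := by
          gcongr
      _ = _ := by ring
  have hv : (a / 2 * Real.sin x.2.1 * v x) ^ 2 ≤ a ^ 2 / 4 * v x ^ 2 := by
    calc _ = Real.sin x.2.1 ^ 2 * (a ^ 2 / 4 * v x ^ 2) := by ring
      _ ≤ _ := mul_le_of_le_one_left (by positivity) hsin
  rw [hW]
  linarith [add_sq_le (a := a * Real.sin x.2.1 / horizonSig a r x.2.1 * X)
    (b := -(a / 2 * Real.sin x.2.1 * v x))]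

end HorizonCharge

section HorizonDecay

variable {a r K p D τ T : ℝ} {ρ σ u v Φ Ψ : ℝ × ℝ × ℝ → ℝ}

theorem HorizonDecay.sq_sliceIntegral_dTime_le (hd : HorizonDecay a r K p D ρ σ u v Φ Ψ)
    (h : HorizonMaxwell a r ρ σ u v) (hr : 0 < r) (hτ : 0 ≤ τ) :
    sliceIntegral (dTime ρ) τ ^ 2 ≤ 4 * π * K * sliceIntegral Φ τ := by
  have hL := h.contDiff_rho.axisRegular_generator a r
  have hmono := hL.sq.sliceIntegral_mono
    (hd.axisRegular_flux.theta_mul (continuous_const (y := K * (r ^ 2 + a ^ 2) ^ 2))) hτ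
    fun x hx hs => (le_add_of_nonneg_right (sq_nonneg _)).trans (hd.generator_sq_le x hx hs)
  rw [sliceIntegral_const_mul] at hmono
  have hsq := hL.sq_sliceIntegral_le hτ
  rw [h.contDiff_rho.sliceIntegral_generator h.rho_two_pi a r hτ, mul_pow] at hsq
  have hA : 0 < (r ^ 2 + a ^ 2) ^ 2 := by positivity
  refine le_of_mul_le_mul_left ?_ hA
  calc _ ≤ 4 * π * sliceIntegral (fun x => generator a r ρ x ^ 2) τ := hsq
    _ ≤ 4 * π * (K * (r ^ 2 + a ^ 2) ^ 2 * sliceIntegral Φ τ) := by gcongr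
    _ = _ := by ring

theorem HorizonDecay.abs_sliceIntegral_sub_le (hd : HorizonDecay a r K p D ρ σ u v Φ Ψ)
    (h : HorizonMaxwell a r ρ σ u v) (hr : 0 < r) (hK : 0 ≤ K) (hD : 0 ≤ D) (hp : 0 < p)
    (hτ : 0 ≤ τ) (hT : τ ≤ T) :
    |sliceIntegral ρ T - sliceIntegral ρ τ|
      ≤ dyadicConst p * (√(4 * π * K * D) * (1 + τ) ^ (-(p / 2))) :=
  abs_sub_le_of_flux_decay (by positivity) hD hp
    (continuousOn_sphereIntegral h.contDiff_rho.continuousOn_dTime)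
    (fun _ _ hτ hT => sphereIntegral_sub_eq_intervalIntegral h.contDiff_rho.continuousOn
      h.contDiff_rho.continuousOn_dTime (fun _ => h.contDiff_rho.hasDerivAt_time) hτ hT)
    (fun _ => hd.sq_sliceIntegral_dTime_le h hr) hd.flux_le hτ hT

theorem HorizonDecay.sq_half_charge_sub_le (hd : HorizonDecay a r K p D ρ σ u v Φ Ψ)
    (h : HorizonMaxwell a r ρ σ u v) (hr : 0 < r) (har : a ^ 2 ≤ r ^ 2) (hτ : 0 ≤ τ) :
    (1 / 2 * sliceIntegral (chargeDensity a r ρ σ v) 0 - sliceIntegral ρ τ) ^ 2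
      ≤ 4 * π * (8 * r ^ 2 * sliceIntegral Ψ τ + sliceIntegral Φ τ) := by
  have hW := AxisRegular.of_continuousOn (continuousOn_chargeDefect (a := a) hr h.contDiff_rho
    h.contDiff_sigma h.contDiff_v)
  have hΨ := hd.axisRegular_transversal.theta_mul (continuous_const (y := 8 * r ^ 2))
  have hmono := hW.sq.sliceIntegral_mono (hΨ.add hd.axisRegular_flux) hτ fun x hx hs => by
    have hu : 0 ≤ a ^ 2 * u x ^ 2 := by positivity
    linarith [sq_chargeDefect_le (ρ := ρ) (σ := σ) (v := v) hr har x, hd.field_sq_le x hx hs,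
      hd.dTheta_sq_le x hx hs]
  rw [hΨ.sliceIntegral_add hd.axisRegular_flux hτ, sliceIntegral_const_mul] at hmono
  rw [← h.sliceIntegral_chargeDensity hr hτ,
    half_sliceIntegral_chargeDensity_sub hr h.contDiff_rho h.contDiff_sigma h.contDiff_v hτ]
  exact (hW.sq_sliceIntegral_le hτ).trans (by gcongr)

theorem HorizonDecay.exists_abs_sub_half_charge_le (hd : HorizonDecay a r K p D ρ σ u v Φ Ψ)
    (h : HorizonMaxwell a r ρ σ u v) (hr : 0 < r) (har : a ^ 2 ≤ r ^ 2) (hτ : 0 ≤ τ) {ε : ℝ}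
    (hε : 0 < ε) :
    ∃ T, τ ≤ T ∧ |sliceIntegral ρ T - 1 / 2 * sliceIntegral (chargeDensity a r ρ σ v) 0| ≤ ε := by
  set δ := ε ^ 2 / (4 * π * (8 * r ^ 2 + 1)) with hδ
  have hδ0 : 0 < δ := by positivity
  obtain ⟨N, hN⟩ := eventually_atTop.1 (hd.tendsto_transversal.eventually_lt_const hδ0)
  obtain ⟨T, hT, hFT⟩ := exists_lt_of_lintegral_ne_top hδ0
    ((hd.flux_le (max τ N) (hτ.trans (le_max_left _ _))).trans_lt ENNReal.ofReal_lt_top).ne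
  have hτT : τ ≤ T := (le_max_left _ _).trans hT.le
  refine ⟨T, hτT, abs_sub_comm (sliceIntegral ρ T) _ ▸ abs_le_of_sq_le_sq ?_ hε.le⟩
  calc _ ≤ 4 * π * (8 * r ^ 2 * sliceIntegral Ψ T + sliceIntegral Φ T) :=
        hd.sq_half_charge_sub_le h hr har (hτ.trans hτT)
    _ ≤ 4 * π * (8 * r ^ 2 * δ + δ) := by
        gcongr
        exact (hN T ((le_max_right _ _).trans hT.le)).le
    _ = ε ^ 2 := by
        rw [hδ]
        field_simp

theorem HorizonDecay.abs_sliceIntegral_sub_half_charge_le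
    (hd : HorizonDecay a r K p D ρ σ u v Φ Ψ) (h : HorizonMaxwell a r ρ σ u v) (hr : 0 < r)
    (har : a ^ 2 ≤ r ^ 2) (hK : 0 ≤ K) (hD : 0 ≤ D) (hp : 0 < p) (hτ : 0 ≤ τ) :
    |sliceIntegral ρ τ - 1 / 2 * sliceIntegral (chargeDensity a r ρ σ v) 0|
      ≤ dyadicConst p * (√(4 * π * K * D) * (1 + τ) ^ (-(p / 2))) := by
  refine le_of_forall_pos_le_add fun ε hε => ?_
  obtain ⟨T, hT, hTε⟩ := hd.exists_abs_sub_half_charge_le h hr har hτ hε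
  have hmτ := hd.abs_sliceIntegral_sub_le h hr hK hD hp hτ hT
  rw [abs_sub_comm] at hmτ
  exact (abs_sub_le _ (sliceIntegral ρ T) _).trans (add_le_add hmτ hTε)

end HorizonDecay

/-! ## The modified Maxwell equations on the horizon -/

/-- The integrand of the transversal norm. -/
noncomputable def transversalDensity (a M : ℝ) (S : Fields) (q : R4) : ℝ :=
  (∑ A : Fin 2, fT a M (pullback S.al) q A ^ 2) + ∑ A : Fin 2, fTBar a M (pullback S.alb) q A ^ 2

section Pointwise

variable {a M : ℝ} {α αb : OneForm} {ρ σ : R4 → ℝ} {q : R4}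

theorem ModifiedMaxwellAt.divH_eq (h : ModifiedMaxwellAt a M α αb ρ σ q) (ha : |a| ≤ M)
    (hq : 0 < q 1) (hs : Real.sin (q 2) ≠ 0) :
    divH a M (fun q' => Sig a q' • α q') q
      = coefC a M q * fderiv ℝ ρ q (e4 a M q) - coefD a M q * fderiv ℝ σ q (e4 a M q) := by
  rw [h.e4_rho, h.e4_sigma]
  linear_combination
    -(divH a M (fun q' => Sig a q' • α q') q) * coefC_sq_add_coefD_sq ha hq hs

theorem ModifiedMaxwellAt.curlH_eq (h : ModifiedMaxwellAt a M α αb ρ σ q) (ha : |a| ≤ M)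
    (hq : 0 < q 1) (hs : Real.sin (q 2) ≠ 0) :
    curlH a M (fun q' => Sig a q' • α q') q
      = -(coefD a M q * fderiv ℝ ρ q (e4 a M q)) - coefC a M q * fderiv ℝ σ q (e4 a M q) := by
  rw [h.e4_rho, h.e4_sigma]
  linear_combination
    -(curlH a M (fun q' => Sig a q' • α q') q) * coefC_sq_add_coefD_sq ha hq hs

theorem ModifiedMaxwellAt.e4_sq_add (h : ModifiedMaxwellAt a M α αb ρ σ q) (ha : |a| ≤ M)
    (hq : 0 < q 1) (hs : Real.sin (q 2) ≠ 0) :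
    fderiv ℝ ρ q (e4 a M q) ^ 2 + fderiv ℝ σ q (e4 a M q) ^ 2
      = divH a M (fun q' => Sig a q' • α q') q ^ 2
        + curlH a M (fun q' => Sig a q' • α q') q ^ 2 := by
  rw [h.e4_rho, h.e4_sigma]
  linear_combination (divH a M (fun q' => Sig a q' • α q') q ^ 2
    + curlH a M (fun q' => Sig a q' • α q') q ^ 2) * coefC_sq_add_coefD_sq ha hq hs

theorem ModifiedMaxwellAt.fT_sq_add_fTBar_sq (h : ModifiedMaxwellAt a M α αb ρ σ q)
    (ha : |a| ≤ M) (hq : 0 < q 1) (hs : Real.sin (q 2) ≠ 0) :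
    (∑ A : Fin 2, fT a M α q A ^ 2) + ∑ A : Fin 2, fTBar a M αb q A ^ 2
      = 1 / 2 * ∑ A : Fin 2,
        (fderiv ℝ ρ q (frame a A q) ^ 2 + fderiv ℝ σ q (frame a A q) ^ 2) := by
  simp only [h.eA_rho, h.eA_sigma, hodge, Fin.sum_univ_two, Matrix.cons_val]
  linear_combination -(fT a M α q 0 ^ 2 + fT a M α q 1 ^ 2 + fTBar a M αb q 0 ^ 2
    + fTBar a M αb q 1 ^ 2) * coefC_sq_add_coefD_sq ha hq hs

end Pointwise

theorem sq_le_sq_rPlus {a M : ℝ} (ha : |a| ≤ M) : a ^ 2 ≤ rPlus a M ^ 2 :=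
  sq_le_sq.2 ((ha.trans (le_rPlus a M)).trans (le_abs_self _))

section Cylinder

variable {a M k : ℝ} {x : ℝ × ℝ × ℝ}

theorem fderiv_comp_chart_e4 {f : R4 → ℝ}
    (hf : DifferentiableAt ℝ f (chart (cylinder k (rPlus a M) x))) :
    fderiv ℝ (f ∘ chart) (cylinder k (rPlus a M) x) (e4 a M (cylinder k (rPlus a M) x))
      = 2 / horizonSig a (rPlus a M) x.2.1
        * generator a (rPlus a M) (onCylinder k (rPlus a M) f) x := by
  rw [fderiv_comp_chart hf (e4_apply_one_of_horizon (cylinder_apply_one k _ x))]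
  simp only [e4, Matrix.cons_val, cylinder_apply_one, Sig_cylinder, generator]
  ring

theorem two_mul_coefC_div_horizonSig {r : ℝ} (ha : |a| ≤ M) (hr : 0 < r)
    (hs : Real.sin x.2.1 ≠ 0) :
    2 * coefC a M (cylinder k r x) / horizonSig a r x.2.1 = weightRe a r x.2.1 := by
  have hq : 0 < cylinder k r x 1 := hr
  rw [coefC_eq ha hq hs, weightRe, cylinder_apply_one, cylinder_apply_two, Sig_cylinder]
  ring

theorem neg_two_mul_coefD_div_horizonSig {r : ℝ} (ha : |a| ≤ M) (hr : 0 < r)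
    (hs : Real.sin x.2.1 ≠ 0) :
    -2 * coefD a M (cylinder k r x) / horizonSig a r x.2.1 = weightIm a r x.2.1 := by
  have hq : 0 < cylinder k r x 1 := hr
  rw [coefD_eq ha hq hs, weightIm, cylinder_apply_one, cylinder_apply_two, Sig_cylinder]
  ring

theorem radius_chart_cylinder {r : ℝ} (hr : 0 ≤ r) (x : ℝ × ℝ × ℝ) :
    radius (chart (cylinder k r x)) = r := by
  rw [radius, Real.sqrt_eq_iff_eq_sq (by positivity) hr]
  simp only [chart, cylinder, Matrix.cons_val]
  linear_combination r ^ 2 * Real.sin x.2.1 ^ 2 * Real.sin_sq_add_cos_sq x.2.2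
    + r ^ 2 * Real.sin_sq_add_cos_sq x.2.1

theorem chart_cylinder_mem_futureRegion {ι ζ : ℝ → ℝ} (hr : 0 < rPlus a M) (hx : 0 ≤ x.1) :
    chart (cylinder (height a M ι ζ (rPlus a M)) (rPlus a M) x) ∈ futureRegion a M ι ζ := by
  simp only [futureRegion, mem_ofPred_eq, radius_chart_cylinder hr.le]
  simpa [chart, cylinder] using hx

theorem field_sq_le_fluxDensity {r : ℝ} (hr : 0 < r) (har : a ^ 2 ≤ r ^ 2) (ς : OneForm)
    (hs : Real.sin x.2.1 ≠ 0) :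
    a ^ 2 * (thetaComp k r ς x ^ 2 + axialComp a k r ς x ^ 2)
      ≤ 2 * fluxDensity a M (fun q => q 1 ^ 2 • pullback ς q) (cylinder k r x) := by
  set N := frameComp a k r ς 0 x ^ 2 + frameComp a k r ς 1 x ^ 2
  have hN : normSq a (fun q => q 1 ^ 2 • pullback ς q) (cylinder k r x) = r ^ 4 * N := by
    rw [normSq_radius_sq_smul, normSq, Fin.sum_univ_two, comp_pullback_cylinder ς _ hs,
      comp_pullback_cylinder ς _ hs, cylinder_apply_one]
  have hflux := normSq_add_nablaNormSq_le_fluxDensity (a := a) (M := M)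
    (fun q => q 1 ^ 2 • pullback ς q) (cylinder k r x)
  have hnabla : 0 ≤ nablaNormSq a M (fun q => q 1 ^ 2 • pullback ς q) (cylinder k r x) :=
    Finset.sum_nonneg fun _ _ => Finset.sum_nonneg fun _ _ => sq_nonneg _
  calc a ^ 2 * (thetaComp k r ς x ^ 2 + axialComp a k r ς x ^ 2)
    _ = a ^ 2 * horizonSig a r x.2.1 * N := by
      rw [thetaComp_sq_add_axialComp_sq hr, mul_assoc]
    _ ≤ r ^ 2 * (2 * r ^ 2) * N := by
      gcongr
      · exact (horizonSig_pos hr _).le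
      · exact Sig_le (q := cylinder k r x) har
    _ = 2 * (r ^ 4 * N) := by ring
    _ ≤ 2 * fluxDensity a M (fun q => q 1 ^ 2 • pullback ς q) (cylinder k r x) := by
      linarith only [hN, hflux, hnabla]

end Cylinder

namespace IsModifiedSolution

variable {a M : ℝ} {ι ζ : ℝ → ℝ} {S : Fields} {x : ℝ × ℝ × ℝ}

local notation "r₊" => rPlus a M

local notation "h₊" => height a M ι ζ (rPlus a M)

theorem contDiffAt_cylinder (hS : IsModifiedSolution a M ι ζ S) (hr : 0 < r₊) (hx : 0 ≤ x.1) :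
    ContDiffAt ℝ ∞ S.al (chart (cylinder h₊ r₊ x)) ∧
    ContDiffAt ℝ ∞ S.rho (chart (cylinder h₊ r₊ x)) ∧
    ContDiffAt ℝ ∞ S.sigma (chart (cylinder h₊ r₊ x)) := by
  obtain ⟨U, hU, hsub, hal, -, hrho, hsigma⟩ := hS.smooth
  have hmem := hU.mem_nhds (hsub (chart_cylinder_mem_futureRegion hr hx))
  exact ⟨hal.contDiffAt hmem, hrho.contDiffAt hmem, hsigma.contDiffAt hmem⟩

theorem maxwell_cylinder (hS : IsModifiedSolution a M ι ζ S) (hx : 0 ≤ x.1)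
    (hθ : x.2.1 ∈ Ioo 0 π) :
    ModifiedMaxwellAt a M (pullback S.al) (pullback S.alb) (S.rho ∘ chart) (S.sigma ∘ chart)
      (cylinder h₊ r₊ x) :=
  hS.maxwell _ le_rfl (by simpa [cylinder] using hx) hθ

theorem horizonMaxwell (hS : IsModifiedSolution a M ι ζ S) (ha : |a| ≤ M) (hr : 0 < r₊) :
    HorizonMaxwell a r₊ (onCylinder h₊ r₊ S.rho) (onCylinder h₊ r₊ S.sigma)
      (thetaComp h₊ r₊ S.al) (axialComp a h₊ r₊ S.al) := by
  have hal := fun x hx => (hS.contDiffAt_cylinder (x := x) hr hx).1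
  have hrho := fun x hx => (hS.contDiffAt_cylinder (x := x) hr hx).2.1
  have hsigma := fun x hx => (hS.contDiffAt_cylinder (x := x) hr hx).2.2
  have hpair := isPolarPair_comps a hal
  refine ⟨contDiffFuture_onCylinder hrho, contDiffFuture_onCylinder hsigma,
    hpair.contDiffFuture_fst, hpair.contDiffFuture_snd, onCylinder_two_pi _ _ _,
    onCylinder_two_pi _ _ _, fun τ θ => ?_, fun τ θ => ?_, fun x hx hθ => ?_, fun x hx hθ => ?_⟩
  · simp [thetaComp, chart, chartTheta, cylinder]
  · simp [axialComp, chart, chartAxial, cylinder]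
  all_goals
    have hs := (Real.sin_pos_of_mem_Ioo hθ).ne'
    rw [← two_mul_coefC_div_horizonSig (k := h₊) ha hr hs,
      ← neg_two_mul_coefD_div_horizonSig (k := h₊) ha hr hs]
    have hq := hS.maxwell_cylinder hx hθ
  · rw [← sin_mul_divH_Sig_smul ha hr hal hx hs, hq.divH_eq ha hr hs,
      fderiv_comp_chart_e4 ((hrho x hx).differentiableAt (by simp)),
      fderiv_comp_chart_e4 ((hsigma x hx).differentiableAt (by simp))]
    ring
  · rw [← sin_mul_curlH_Sig_smul ha hr hal hx hs, hq.curlH_eq ha hr hs,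
      fderiv_comp_chart_e4 ((hrho x hx).differentiableAt (by simp)),
      fderiv_comp_chart_e4 ((hsigma x hx).differentiableAt (by simp))]
    ring

theorem transversalDensity_eq (hS : IsModifiedSolution a M ι ζ S) (ha : |a| ≤ M)
    (hr : 0 < r₊) (hx : 0 ≤ x.1) (hθ : x.2.1 ∈ Ioo 0 π) :
    transversalDensity a M S (cylinder h₊ r₊ x)
      = 1 / 2 * ∑ A : Fin 2,
        (frameComp a h₊ r₊ (fderiv ℝ S.rho) A x ^ 2
          + frameComp a h₊ r₊ (fderiv ℝ S.sigma) A x ^ 2) := by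
  have hs := (Real.sin_pos_of_mem_Ioo hθ).ne'
  obtain ⟨-, hrho, hsigma⟩ := hS.contDiffAt_cylinder hr hx
  simp only [← fderiv_comp_chart_frame (hrho.differentiableAt (by simp)) hs,
    ← fderiv_comp_chart_frame (hsigma.differentiableAt (by simp)) hs]
  exact (hS.maxwell_cylinder hx hθ).fT_sq_add_fTBar_sq ha hr hs

theorem axisRegular_transversalDensity (hS : IsModifiedSolution a M ι ζ S) (ha : |a| ≤ M)
    (hr : 0 < r₊) : AxisRegular fun x => transversalDensity a M S (cylinder h₊ r₊ x) := by
  have hfderiv {f : R4 → ℝ} {p : R4} (hf : ContDiffAt ℝ ∞ f p) : ContDiffAt ℝ ∞ (fderiv ℝ f) p :=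
    hf.fderiv_right (by simp)
  have hrho (A : Fin 2) := (contDiffFuture_frameComp (a := a) hr
    (fun x hx => hfderiv (hS.contDiffAt_cylinder (x := x) hr hx).2.1) A).axisRegular.sq
  have hsigma (A : Fin 2) := (contDiffFuture_frameComp (a := a) hr
    (fun x hx => hfderiv (hS.contDiffAt_cylinder (x := x) hr hx).2.2) A).axisRegular.sq
  refine ((((hrho 0).add (hsigma 0)).add ((hrho 1).add (hsigma 1))).theta_mul
    (continuous_const (y := 1 / 2))).congr fun x hx hθ => ?_
  rw [hS.transversalDensity_eq ha hr hx hθ, Fin.sum_univ_two]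

theorem dTheta_sq_le (hS : IsModifiedSolution a M ι ζ S) (ha : |a| ≤ M) (hr : 0 < r₊)
    (hx : 0 ≤ x.1) (hθ : x.2.1 ∈ Ioo 0 π) :
    dTheta (onCylinder h₊ r₊ S.rho) x ^ 2 + dTheta (onCylinder h₊ r₊ S.sigma) x ^ 2
      ≤ 4 * r₊ ^ 2 * transversalDensity a M S (cylinder h₊ r₊ x) := by
  obtain ⟨-, hrho, hsigma⟩ := hS.contDiffAt_cylinder hr hx
  have hgrad (f : R4 → ℝ) (hf : ContDiffAt ℝ ∞ f (chart (cylinder h₊ r₊ x))) :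
      dTheta (onCylinder h₊ r₊ f) x ^ 2 ≤ 2 * r₊ ^ 2
        * (frameComp a h₊ r₊ (fderiv ℝ f) 0 x ^ 2 + frameComp a h₊ r₊ (fderiv ℝ f) 1 x ^ 2) := by
    rw [← thetaComp_fderiv (hf.differentiableAt (by simp))]
    calc thetaComp h₊ r₊ (fderiv ℝ f) x ^ 2
      _ ≤ thetaComp h₊ r₊ (fderiv ℝ f) x ^ 2 + axialComp a h₊ r₊ (fderiv ℝ f) x ^ 2 :=
        le_add_of_nonneg_right (sq_nonneg _)
      _ = _ := thetaComp_sq_add_axialComp_sq hr _ x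
      _ ≤ _ := mul_le_mul_of_nonneg_right (Sig_le (q := cylinder h₊ r₊ x) (sq_le_sq_rPlus ha))
        (by positivity)
  rw [hS.transversalDensity_eq ha hr hx hθ, Fin.sum_univ_two]
  linarith [hgrad S.rho hrho, hgrad S.sigma hsigma]

theorem generator_sq_le (hS : IsModifiedSolution a M ι ζ S) (ha : |a| ≤ M) (hM : 0 < M)
    (hx : 0 ≤ x.1) (hθ : x.2.1 ∈ Ioo 0 π) :
    generator a r₊ (onCylinder h₊ r₊ S.rho) x ^ 2 + generator a r₊ (onCylinder h₊ r₊ S.sigma) x ^ 2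
      ≤ 4 * (1 + 1 / M ^ 2) * (r₊ ^ 2 + a ^ 2) ^ 2
        * fluxDensity a M (fun q => q 1 ^ 2 • pullback S.al q) (cylinder h₊ r₊ x) := by
  have hMr := le_rPlus a M
  have hr := hM.trans_le hMr
  have hs := (Real.sin_pos_of_mem_Ioo hθ).ne'
  obtain ⟨hal, hrho, hsigma⟩ := hS.contDiffAt_cylinder hr hx
  have har : a ^ 2 ≤ r₊ ^ 2 := sq_le_sq_rPlus ha
  have hS₀ : 0 < horizonSig a r₊ x.2.1 := horizonSig_pos hr _
  have hSle : horizonSig a r₊ x.2.1 ≤ r₊ ^ 2 + a ^ 2 :=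
    add_le_add_right (mul_le_of_le_one_right (sq_nonneg a) (Real.cos_sq_le_one _)) _
  have hdiv := divH_sq_add_curlH_sq_Sig_smul_le (q := cylinder h₊ r₊ x) hM har hMr fun A =>
    differentiableAt_comp_pullback (a := a) (q := cylinder h₊ r₊ x) hr hs
      (hal.differentiableAt (by simp)) A
  rw [← (hS.maxwell_cylinder hx hθ).e4_sq_add ha hr hs,
    fderiv_comp_chart_e4 (hrho.differentiableAt (by simp)),
    fderiv_comp_chart_e4 (hsigma.differentiableAt (by simp))] at hdiv
  set Lρ := generator a r₊ (onCylinder h₊ r₊ S.rho) x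
  set Lσ := generator a r₊ (onCylinder h₊ r₊ S.sigma) x
  set Φ := fluxDensity a M (fun q => q 1 ^ 2 • pullback S.al q) (cylinder h₊ r₊ x)
  have hΦ := hdiv.trans <| mul_le_mul_of_nonneg_left
    (normSq_add_nablaNormSq_le_fluxDensity (a := a) (M := M)
      (fun q => q 1 ^ 2 • pullback S.al q) (cylinder h₊ r₊ x)) (by positivity)
  calc Lρ ^ 2 + Lσ ^ 2
    _ = horizonSig a r₊ x.2.1 ^ 2 / 4 * ((2 / horizonSig a r₊ x.2.1 * Lρ) ^ 2
        + (2 / horizonSig a r₊ x.2.1 * Lσ) ^ 2) := by field_simp; ring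
    _ ≤ (r₊ ^ 2 + a ^ 2) ^ 2 / 4 * (16 * (1 + 1 / M ^ 2) * Φ) := by gcongr
    _ = 4 * (1 + 1 / M ^ 2) * (r₊ ^ 2 + a ^ 2) ^ 2 * Φ := by ring

theorem horizonDecay (hS : IsModifiedSolution a M ι ζ S) (ha : |a| ≤ M) (hM : 0 < M) {p D : ℝ}
    (htrans : Tendsto (transversalL2Sq a M ι ζ S) atTop (𝓝 0))
    (hflux : ∀ τ : ℝ, 0 ≤ τ →
      alphaFlux a M ι ζ S τ ⊤ ≤ ENNReal.ofReal (D / (1 + τ) ^ (1 + p))) :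
    HorizonDecay a r₊ (4 * (1 + 1 / M ^ 2)) p D
      (onCylinder h₊ r₊ S.rho) (onCylinder h₊ r₊ S.sigma)
      (thetaComp h₊ r₊ S.al) (axialComp a h₊ r₊ S.al)
      (fun x => fluxDensity a M (fun q => q 1 ^ 2 • pullback S.al q) (cylinder h₊ r₊ x))
      (fun x => transversalDensity a M S (cylinder h₊ r₊ x)) where
  axisRegular_flux := axisRegular_fluxDensity ha (hM.trans_le (le_rPlus a M)) fun _ hx =>
    (hS.contDiffAt_cylinder (hM.trans_le (le_rPlus a M)) hx).1
  axisRegular_transversal := hS.axisRegular_transversalDensity ha (hM.trans_le (le_rPlus a M))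
  generator_sq_le _ hx hθ := hS.generator_sq_le ha hM hx hθ
  field_sq_le _ _ hθ := field_sq_le_fluxDensity (hM.trans_le (le_rPlus a M)) (sq_le_sq_rPlus ha)
    S.al (Real.sin_pos_of_mem_Ioo hθ).ne'
  dTheta_sq_le _ hx hθ := hS.dTheta_sq_le ha (hM.trans_le (le_rPlus a M)) hx hθ
  flux_le τ hτ := by
    have htop : {s : ℝ | τ < s ∧ (s : EReal) < ⊤} = Ioi τ := by
      ext s
      simp [EReal.coe_lt_top]
    exact htop ▸ hflux τ hτ
  tendsto_transversal := htrans

end IsModifiedSolution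

/-! ## Seed data, charges and the estimates for the modes -/

section Horizon

variable {a M : ℝ} {ι ζ : ℝ → ℝ}

local notation "r₊" => rPlus a M

local notation "h₊" => height a M ι ζ (rPlus a M)

theorem areaDensity_horizonPoint (hr : 0 < r₊) {θ : ℝ} (hθ : θ ∈ Icc 0 π) (τ φ : ℝ) :
    areaDensity a M (horizonPoint a M ι ζ τ θ φ) = (r₊ ^ 2 + a ^ 2) * Real.sin θ := by
  have hS : r₊ ^ 2 + a ^ 2 * Real.cos θ ^ 2 ≠ 0 := by positivity
  have hsin := Real.sin_nonneg_of_mem_Icc hθ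
  rw [areaDensity, ← Real.sqrt_sq (mul_nonneg (by positivity : 0 ≤ r₊ ^ 2 + a ^ 2) hsin)]
  congr 1
  simp only [kerrMetric, horizonPoint, Sig, Del_rPlus, zero_mul, sub_zero, Matrix.of_apply,
    Matrix.cons_val', Matrix.cons_val, Matrix.cons_val_fin_one]
  field_simp
  ring

theorem integral_mul_areaDensity_horizonPoint (hr : 0 < r₊) (g : ℝ → ℝ → ℝ) (τ : ℝ) :
    (∫ φ in (0 : ℝ)..2 * π, ∫ θ in (0 : ℝ)..π,
        g θ φ * areaDensity a M (horizonPoint a M ι ζ τ θ φ))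
      = (r₊ ^ 2 + a ^ 2) * sphereIntegral g := by
  rw [← sphereIntegral_const_mul]
  refine intervalIntegral.integral_congr fun φ _ => intervalIntegral.integral_congr fun θ hθ => ?_
  rw [uIcc_of_le Real.pi_pos.le] at hθ
  simp only [areaDensity_horizonPoint hr hθ]
  ring

theorem horizonL2Sq_comp_chart (hr : 0 < r₊) (f : R4 → ℝ) (τ : ℝ) :
    horizonL2Sq a M ι ζ (f ∘ chart) τ = sliceIntegral (fun x => onCylinder h₊ r₊ f x ^ 2) τ := by
  have harea := integral_mul_areaDensity_horizonPoint (ι := ι) (ζ := ζ) hr (fun _ _ => 1) τ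
  have hne : r₊ ^ 2 + a ^ 2 ≠ 0 := by positivity
  simp only [one_mul, sphereIntegral_const] at harea
  rw [horizonL2Sq, integral_mul_areaDensity_horizonPoint hr, harea]
  change _ = sphereIntegral _
  field_simp
  rfl

theorem chart_cylinder_mem_initialSphere (hr : 0 < r₊) (θ φ : ℝ) :
    chart (cylinder h₊ r₊ (0, θ, φ)) ∈ initialSphere a M ι ζ := by
  refine ⟨radius_chart_cylinder hr.le _, ?_⟩
  rw [radius_chart_cylinder hr.le]
  simp [chart, cylinder]

open Classical in
/-- Extension by zero to the global chart of a function on the initial horizon sphere; it lets the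
charges of the seed data be written with the components used for fields on the cylinder. -/
noncomputable def extendByZero {E : Type*} [Zero E] (f : initialSphere a M ι ζ → E) (p : R4) : E :=
  if h : p ∈ initialSphere a M ι ζ then f ⟨p, h⟩ else 0

theorem extendByZero_restrict {E : Type*} [Zero E] (f : R4 → E) {p : R4}
    (hp : p ∈ initialSphere a M ι ζ) :
    extendByZero (fun p : initialSphere a M ι ζ => f p) p = f p :=
  dif_pos hp

namespace HorizonSeed

/-- The charge `𝔮₁` of the seed data. -/
noncomputable def chargeRho (H : HorizonSeed a M ι ζ) : ℝ :=
  1 / (8 * π) * sliceIntegral (chargeDensity a r₊ (onCylinder h₊ r₊ (extendByZero H.rho))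
    (onCylinder h₊ r₊ (extendByZero H.sigma)) (axialComp a h₊ r₊ (extendByZero H.al))) 0

/-- The charge `𝔮₂` of the seed data. -/
noncomputable def chargeSigma (H : HorizonSeed a M ι ζ) : ℝ :=
  1 / (8 * π) * sliceIntegral (chargeDensity a r₊ (onCylinder h₊ r₊ (extendByZero H.sigma))
    (-onCylinder h₊ r₊ (extendByZero H.rho)) (thetaComp h₊ r₊ (extendByZero H.al))) 0

end HorizonSeed

theorem chargeRho_seed (hr : 0 < r₊) (S : Fields) :
    4 * π * (S.seed a M ι ζ).onHorizon.chargeRho = 1 / 2 * sliceIntegral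
      (chargeDensity a r₊ (onCylinder h₊ r₊ S.rho) (onCylinder h₊ r₊ S.sigma)
        (axialComp a h₊ r₊ S.al)) 0 := by
  rw [HorizonSeed.chargeRho, ← mul_assoc]
  congr 1
  · field_simp; norm_num
  refine sphereIntegral_congr fun θ _ φ => ?_
  have hp := chart_cylinder_mem_initialSphere (ι := ι) (ζ := ζ) hr θ φ
  simp only [chargeDensity, onCylinder, axialComp, Fields.seed, SeedData.onHorizon,
    extendByZero_restrict _ hp]

theorem chargeSigma_seed (hr : 0 < r₊) (S : Fields) :
    4 * π * (S.seed a M ι ζ).onHorizon.chargeSigma = 1 / 2 * sliceIntegral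
      (chargeDensity a r₊ (onCylinder h₊ r₊ S.sigma) (-onCylinder h₊ r₊ S.rho)
        (thetaComp h₊ r₊ S.al)) 0 := by
  rw [HorizonSeed.chargeSigma, ← mul_assoc]
  congr 1
  · field_simp; norm_num
  refine sphereIntegral_congr fun θ _ φ => ?_
  have hp := chart_cylinder_mem_initialSphere (ι := ι) (ζ := ζ) hr θ φ
  simp only [chargeDensity, onCylinder, thetaComp, Pi.neg_apply, Fields.seed, SeedData.onHorizon,
    extendByZero_restrict _ hp]

end Horizon

/-- The constant in the decay estimate for the square of a mode. -/
noncomputable def decayConst (M p : ℝ) : ℝ := dyadicConst p ^ 2 * (4 * π * (4 * (1 + 1 / M ^ 2)))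

theorem decayConst_nonneg (M p : ℝ) : 0 ≤ decayConst M p := by
  unfold decayConst
  positivity

theorem sq_le_of_abs_le_decay {M p D τ x : ℝ} (hD : 0 ≤ D) (hτ : 0 ≤ τ)
    (hx : |x| ≤ dyadicConst p * (√(4 * π * (4 * (1 + 1 / M ^ 2)) * D) * (1 + τ) ^ (-(p / 2)))) :
    x ^ 2 ≤ decayConst M p * (D / (1 + τ) ^ p) := by
  have hpos : 0 < 1 + τ := by linarith
  have hpow : ((1 + τ) ^ (-(p / 2))) ^ 2 = ((1 + τ) ^ p)⁻¹ := by
    rw [← Real.rpow_natCast, ← Real.rpow_mul hpos.le, ← Real.rpow_neg hpos.le]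
    congr 1
    push_cast
    ring
  calc x ^ 2
    _ = |x| ^ 2 := (sq_abs x).symm
    _ ≤ _ := pow_le_pow_left₀ (abs_nonneg x) hx 2
    _ = decayConst M p * (D / (1 + τ) ^ p) := by
      rw [mul_pow, mul_pow, Real.sq_sqrt (by positivity), hpow, decayConst]
      ring

/-- The constant of the theorem. -/
noncomputable def modeConst (M p : ℝ) : ℝ := 8 * π + 4 * decayConst M p

theorem modeConst_pos (M p : ℝ) : 0 < modeConst M p :=
  add_pos_of_pos_of_nonneg (by positivity) (mul_nonneg (by norm_num) (decayConst_nonneg M p))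

namespace IsModifiedSolution

variable {a M p D τ : ℝ} {ι ζ : ℝ → ℝ} {S : Fields}

theorem modes_sub_initial_sq_le (hS : IsModifiedSolution a M ι ζ S) (ha : |a| ≤ M) (hM : 0 < M)
    (hp : 0 < p) (hD : 0 ≤ D) (htrans : Tendsto (transversalL2Sq a M ι ζ S) atTop (𝓝 0))
    (hflux : ∀ τ : ℝ, 0 ≤ τ →
      alphaFlux a M ι ζ S τ ⊤ ≤ ENNReal.ofReal (D / (1 + τ) ^ (1 + p))) (hτ : 0 ≤ τ) :
    (rhoMode a M ι ζ S τ - rhoMode a M ι ζ S 0) ^ 2 ≤ decayConst M p * D ∧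
    (sigmaMode a M ι ζ S τ - sigmaMode a M ι ζ S 0) ^ 2 ≤ decayConst M p * D := by
  have hr := hM.trans_le (le_rPlus a M)
  have hdecay := hS.horizonDecay ha hM htrans hflux
  have hmaxwell := hS.horizonMaxwell ha hr
  have hone : decayConst M p * (D / (1 + 0) ^ p) = decayConst M p * D := by simp
  exact ⟨hone ▸ sq_le_of_abs_le_decay hD le_rfl
      (hdecay.abs_sliceIntegral_sub_le hmaxwell hr (by positivity) hD hp le_rfl hτ),
    hone ▸ sq_le_of_abs_le_decay hD le_rfl
      (hdecay.dual.abs_sliceIntegral_sub_le hmaxwell.dual hr (by positivity) hD hp le_rfl hτ)⟩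

theorem modes_sub_charge_sq_le (hS : IsModifiedSolution a M ι ζ S) (ha : |a| ≤ M) (hM : 0 < M)
    (hp : 0 < p) (hD : 0 ≤ D) (htrans : Tendsto (transversalL2Sq a M ι ζ S) atTop (𝓝 0))
    (hflux : ∀ τ : ℝ, 0 ≤ τ →
      alphaFlux a M ι ζ S τ ⊤ ≤ ENNReal.ofReal (D / (1 + τ) ^ (1 + p))) (hτ : 0 ≤ τ) :
    (rhoMode a M ι ζ S τ - 4 * π * (S.seed a M ι ζ).onHorizon.chargeRho) ^ 2
      ≤ decayConst M p * (D / (1 + τ) ^ p) ∧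
    (sigmaMode a M ι ζ S τ - 4 * π * (S.seed a M ι ζ).onHorizon.chargeSigma) ^ 2
      ≤ decayConst M p * (D / (1 + τ) ^ p) := by
  have hr := hM.trans_le (le_rPlus a M)
  have hdecay := hS.horizonDecay ha hM htrans hflux
  have hmaxwell := hS.horizonMaxwell ha hr
  rw [chargeRho_seed hr, chargeSigma_seed hr]
  exact ⟨sq_le_of_abs_le_decay hD hτ (hdecay.abs_sliceIntegral_sub_half_charge_le hmaxwell hr
      (sq_le_sq_rPlus ha) (by positivity) hD hp hτ),
    sq_le_of_abs_le_decay hD hτ (hdecay.dual.abs_sliceIntegral_sub_half_charge_le hmaxwell.dual hr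
      (sq_le_sq_rPlus ha) (by positivity) hD hp hτ)⟩

theorem modes_sub_stationary (hS : IsModifiedSolution a M ι ζ S) (ha : |a| ≤ M)
    (hr : 0 < rPlus a M) (hτ : 0 ≤ τ) (q₁ q₂ : ℝ) :
    rhoMode a M ι ζ (S - stationary q₁ q₂) τ = rhoMode a M ι ζ S τ - 4 * π * q₁ ∧
    sigmaMode a M ι ζ (S - stationary q₁ q₂) τ = sigmaMode a M ι ζ S τ - 4 * π * q₂ := by
  have hmaxwell := hS.horizonMaxwell ha hr
  rw [← sphereIntegral_const q₁, ← sphereIntegral_const q₂]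
  exact ⟨sphereIntegral_sub (continuous_slice hmaxwell.contDiff_rho.continuousOn hτ)
      continuous_const,
    sphereIntegral_sub (continuous_slice hmaxwell.contDiff_sigma.continuousOn hτ)
      continuous_const⟩

theorem modes_sq_le_horizonL2Sq (hS : IsModifiedSolution a M ι ζ S) (ha : |a| ≤ M)
    (hr : 0 < rPlus a M) (hτ : 0 ≤ τ) :
    rhoMode a M ι ζ S τ ^ 2 ≤ 4 * π * horizonL2Sq a M ι ζ (S.rho ∘ chart) τ ∧
    sigmaMode a M ι ζ S τ ^ 2 ≤ 4 * π * horizonL2Sq a M ι ζ (S.sigma ∘ chart) τ := by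
  have hmaxwell := hS.horizonMaxwell ha hr
  rw [horizonL2Sq_comp_chart hr, horizonL2Sq_comp_chart hr]
  exact ⟨hmaxwell.contDiff_rho.axisRegular.sq_sliceIntegral_le hτ,
    hmaxwell.contDiff_sigma.axisRegular.sq_sliceIntegral_le hτ⟩

theorem modes_sq_add_le (hS : IsModifiedSolution a M ι ζ S) (ha : |a| ≤ M) (hM : 0 < M)
    (hp : 0 < p) (hD : 0 ≤ D) (htrans : Tendsto (transversalL2Sq a M ι ζ S) atTop (𝓝 0))
    (hflux : ∀ τ : ℝ, 0 ≤ τ →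
      alphaFlux a M ι ζ S τ ⊤ ≤ ENNReal.ofReal (D / (1 + τ) ^ (1 + p))) (hτ : 0 ≤ τ) :
    |rhoMode a M ι ζ S τ| ^ 2 + |sigmaMode a M ι ζ S τ| ^ 2
      ≤ modeConst M p * (horizonL2Sq a M ι ζ (S.rho ∘ chart) 0
        + horizonL2Sq a M ι ζ (S.sigma ∘ chart) 0 + D) := by
  obtain ⟨hρ, hσ⟩ := hS.modes_sub_initial_sq_le ha hM hp hD htrans hflux hτ
  obtain ⟨hρ₀, hσ₀⟩ := hS.modes_sq_le_horizonL2Sq ha (hM.trans_le (le_rPlus a M)) le_rfl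
  have hsplit (x y : ℝ) : x ^ 2 ≤ 2 * y ^ 2 + 2 * (x - y) ^ 2 := by
    nlinarith [sq_nonneg (x - 2 * y)]
  set Nρ := horizonL2Sq a M ι ζ (S.rho ∘ chart) 0
  set Nσ := horizonL2Sq a M ι ζ (S.sigma ∘ chart) 0
  have hNρ : 0 ≤ Nρ := nonneg_of_mul_nonneg_right ((sq_nonneg _).trans hρ₀) (by positivity)
  have hNσ : 0 ≤ Nσ := nonneg_of_mul_nonneg_right ((sq_nonneg _).trans hσ₀) (by positivity)
  have hL := decayConst_nonneg M p
  rw [sq_abs, sq_abs]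
  calc rhoMode a M ι ζ S τ ^ 2 + sigmaMode a M ι ζ S τ ^ 2
    _ ≤ 8 * π * (Nρ + Nσ) + 4 * decayConst M p * D := by
      linarith [hsplit (rhoMode a M ι ζ S τ) (rhoMode a M ι ζ S 0),
        hsplit (sigmaMode a M ι ζ S τ) (sigmaMode a M ι ζ S 0)]
    _ ≤ modeConst M p * (Nρ + Nσ) + modeConst M p * D := by
      gcongr
      · exact le_add_of_nonneg_right (by positivity)
      · exact le_add_of_nonneg_left (by positivity)
    _ = modeConst M p * (Nρ + Nσ + D) := by ring

theorem normalised_modes_sq_add_le (hS : IsModifiedSolution a M ι ζ S) (ha : |a| ≤ M)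
    (hM : 0 < M) (hp : 0 < p) (hD : 0 ≤ D)
    (htrans : Tendsto (transversalL2Sq a M ι ζ S) atTop (𝓝 0))
    (hflux : ∀ τ : ℝ, 0 ≤ τ →
      alphaFlux a M ι ζ S τ ⊤ ≤ ENNReal.ofReal (D / (1 + τ) ^ (1 + p))) (hτ : 0 ≤ τ) :
    |rhoMode a M ι ζ (S - stationary (S.seed a M ι ζ).onHorizon.chargeRho
        (S.seed a M ι ζ).onHorizon.chargeSigma) τ| ^ 2
      + |sigmaMode a M ι ζ (S - stationary (S.seed a M ι ζ).onHorizon.chargeRho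
        (S.seed a M ι ζ).onHorizon.chargeSigma) τ| ^ 2
      ≤ modeConst M p * (D / (1 + τ) ^ p) := by
  obtain ⟨hρ, hσ⟩ := hS.modes_sub_charge_sq_le ha hM hp hD htrans hflux hτ
  obtain ⟨hρ', hσ'⟩ := hS.modes_sub_stationary ha (hM.trans_le (le_rPlus a M)) hτ
    (S.seed a M ι ζ).onHorizon.chargeRho (S.seed a M ι ζ).onHorizon.chargeSigma
  have hL := decayConst_nonneg M p
  rw [sq_abs, sq_abs, hρ', hσ']
  calc _ ≤ 2 * decayConst M p * (D / (1 + τ) ^ p) := by linarith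
    _ ≤ modeConst M p * (D / (1 + τ) ^ p) := by
      gcongr
      unfold modeConst
      linarith [Real.pi_pos]

end IsModifiedSolution

end KerrMaxwell

theorem lemma6p4 (M pα : ℝ) (hM : 0 < M) (hpα : 0 < pα) :
    (∀ a : ℝ, |a| ≤ M →
      KerrMaxwell.chargeConstant a M ≠ 0 ∧
      (a ≠ 0 → KerrMaxwell.chargeConstant a M
        = 4 * Real.pi * (2 * Real.arctan (a / KerrMaxwell.rPlus a M) / (a / KerrMaxwell.rPlus a M) - 1)) ∧
      (a = 0 → KerrMaxwell.chargeConstant a M = 4 * Real.pi)) ∧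
    ∃ C : ℝ, 0 < C ∧
      ∀ a : ℝ, |a| ≤ M →
      ∀ ι ζ : ℝ → ℝ, KerrMaxwell.IsStarCutoff a M ι → KerrMaxwell.IsHyperboloidalCutoff M ζ →
      ∃ 𝔮₁ 𝔮₂ : KerrMaxwell.HorizonSeed a M ι ζ → ℝ,
      ∀ 𝔻 : KerrMaxwell.SeedData a M ι ζ → ℝ≥0,
      ∀ S : KerrMaxwell.Fields, KerrMaxwell.IsModifiedSolution a M ι ζ S →
        Filter.Tendsto (KerrMaxwell.transversalL2Sq a M ι ζ S) Filter.atTop (𝓝 0) →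
        (∀ τ : ℝ, 0 ≤ τ → KerrMaxwell.alphaFlux a M ι ζ S τ ⊤
          ≤ ENNReal.ofReal ((𝔻 (S.seed a M ι ζ) : ℝ) / (1 + τ) ^ (1 + pα))) →
        (∀ τ : ℝ, 0 ≤ τ →
          |KerrMaxwell.rhoMode a M ι ζ S τ| ^ 2 + |KerrMaxwell.sigmaMode a M ι ζ S τ| ^ 2
            ≤ C * (KerrMaxwell.horizonL2Sq a M ι ζ (S.rho ∘ KerrMaxwell.chart) 0
                + KerrMaxwell.horizonL2Sq a M ι ζ (S.sigma ∘ KerrMaxwell.chart) 0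
                + (𝔻 (S.seed a M ι ζ) : ℝ))) ∧
        (∀ τ : ℝ, 0 ≤ τ →
          |KerrMaxwell.rhoMode a M ι ζ
              (S - KerrMaxwell.stationary (𝔮₁ (S.seed a M ι ζ).onHorizon)
                (𝔮₂ (S.seed a M ι ζ).onHorizon)) τ| ^ 2
            + |KerrMaxwell.sigmaMode a M ι ζ
              (S - KerrMaxwell.stationary (𝔮₁ (S.seed a M ι ζ).onHorizon)
                (𝔮₂ (S.seed a M ι ζ).onHorizon)) τ| ^ 2
            ≤ C * ((𝔻 (S.seed a M ι ζ) : ℝ) / (1 + τ) ^ pα)) := by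
  refine ⟨fun a ha => ⟨KerrMaxwell.chargeConstant_ne_zero hM ha,
    KerrMaxwell.chargeConstant_of_ne_zero hM, fun h => h ▸ KerrMaxwell.chargeConstant_zero M⟩,
    KerrMaxwell.modeConst M pα, KerrMaxwell.modeConst_pos M pα, fun a ha ι ζ _ _ =>
    ⟨KerrMaxwell.HorizonSeed.chargeRho, KerrMaxwell.HorizonSeed.chargeSigma,
      fun 𝔻 S hS htrans hflux => ?_⟩⟩
  have hD : (0 : ℝ) ≤ 𝔻 (S.seed a M ι ζ) := NNReal.coe_nonneg _
  exact ⟨fun _ hτ => hS.modes_sq_add_le ha hM hpα hD htrans hflux hτ,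
    fun _ hτ => hS.normalised_modes_sq_add_le ha hM hpα hD htrans hflux hτ⟩
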